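/- Let $m\ge 1$ be an integer. For $\underline a=(a_1,\dots,a_m)\in\mathbb C^m$ consider $$(\mathfrak E_m)\qquad \frac{d^2}{dx^2}\Phi(x)=\frac{P_m(x,\underline a)}{x^2}\,\Phi(x),\qquad P_m(x,\underline a)=x^m+a_1x^{m-1}+\dots+a_m ,$$ on the universal covering of $\mathbb C\setminus\{0\}$, where $\arg x$, $\ln x$ and $x^\alpha=e^{\alpha\ln x}$ are well defined. Put $\omega=e^{2i\pi/m}$, $\omega^\alpha=e^{2i\pi\alpha/m}$ for $\alpha\in\mathbb C$; $\omega^k x$ is the point of the covering over it with argument $\arg x+2\pi k/m$; and $\tau\cdot\underline a=(\tau a_1,\dots,\tau^m a_m)$. *Solutions at infinity.* Let $b_{m/2-k}(\underline a)$ be the coefficient of $x^{m/2-k-1}$ in the expansion at infinity $\sqrt{P_m(x,\underline a)}/x=x^{m/2-1}+\cdots$, let $S(x,\underline a)=\sum_{0\le k<m/2}\frac{b_{m/2-k}(\underline a)}{m/2-k}x^{m/2-k}$, and let $r(\underline a)=\frac12-\frac m4$ for $m$ odd, $r(\underline a)=\frac12-\frac m4-b_0(\underline a)$ for $m$ even.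 $\Phi_0(x,\underline a)$ denotes the unique solution of $(\mathfrak E_m)$ that has, in every strict subsector of $|\arg x|<3\pi/m$, an asymptotic expansion at infinity $x^{r(\underline a)}e^{-S(x,\underline a)}\phi_0$, with $\phi_0$ a formal power series with constant term $1$ in $x^{-1/2}$ ($m$ odd), in $x^{-1}$ ($m$ even). For $k\in\mathbb Z$ put $\Phi_k(x,\underline a)=\Phi_0(\omega^kx,\omega^k\cdot\underline a)$. The Stokes–Sibuya connection matrix $\mathfrak S_k(\underline a)=\begin{pmatrix}C_k(\underline a)&\tilde C_k(\underline a)\\1&0\end{pmatrix}$ is defined by $\Phi_{k-1}=C_k(\underline a)\Phi_k+\tilde C_k(\underline a)\Phi_{k+1}$. *Solutions at the origin.* Let $p$ be a square root of $1+4a_m$, $s(p)=\frac{1+p}2$ and $\underline a'=(a_1,\dots,a_{m-1})$. Let $(f_1,f_2)$ be the system of solutions of $(\mathfrak E_m)$ with $$f_1=x^{s(p)}g_1(x),\qquad f_2=\lambda f_1\ln x+x^{s(-p)}g_2(x),\qquad g_1,g_2\text{ entire},\quad g_1(0)=1,$$ normalized as follows: if $p\notin\mathbb Z$, $\lambda=0$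 and $g_2(0)=1$; if $p\in\mathbb N^*$, $g_2(0)=1$ and the coefficient of $x^p$ in $g_2$ is $0$; if $p=0$, $\lambda=1$ and $g_2(0)=0$; and if $-p\in\mathbb N^*$ (when solutions of this form exist), $\lambda=0$, $g_2(0)=1$ and the coefficient of $x^{-p}$ in $g_1$ is $0$. The $0\infty$ connection matrix $M_k(\underline a',p)$ is defined by $\begin{pmatrix}\Phi_{k-1}\\\Phi_k\end{pmatrix}=M_k(\underline a',p)\begin{pmatrix}f_1\\f_2\end{pmatrix}$. **Proposition.** Restrict $(\mathfrak E_m)$ to $\underline a'=0$. Then, for every $a_m\in\mathbb C$ and $p=(1+4a_m)^{1/2}$ (either square root), $$\mathfrak S_0(0,a_m)=\begin{pmatrix}2e^{-i\pi/m}\cos\left(\pi\frac pm\right)&-e^{-2i\pi/m}\\1&0\end{pmatrix}.$$ Furthermore there is an odd entire function $\beta_m$, depending only on $m$, such that for every $k\in\mathbb N^*$, $e^{\beta_m(km)}=m^k$ or $e^{\beta_m(km)}=-m^k$, and such that for every $p\in\mathbb C$ with $\frac pm\notin\mathbb Z$ (and $a_m=\frac{p^2-1}4$), $$M_0(0,p)=\begin{pmatrix}e^{\beta_m(-p)}\frac{\omega^{-1/2}}{\sqrt{m\pi}}\Gamma\left(-\frac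 pm\right)&e^{\beta_m(p)}\frac{\omega^{-1/2}}{\sqrt{m\pi}}\Gamma\left(\frac pm\right)\\[4pt]\omega^{s(p)}e^{\beta_m(-p)}\frac{\omega^{-1/2}}{\sqrt{m\pi}}\Gamma\left(-\frac pm\right)&\omega^{s(-p)}e^{\beta_m(p)}\frac{\omega^{-1/2}}{\sqrt{m\pi}}\Gamma\left(\frac pm\right)\end{pmatrix}.$$ -/

import Mathlib

namespace StokesSibuya

open Complex

noncomputable section

/-! The equation `Φ'' = (P_m(x, a) / x ^ 2) Φ` on the universal covering of `ℂ \ {0}`.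

The universal covering is identified with `ℂ` through `t ↦ x = exp t`, so that `arg x = Im t`,
`log x = t` and `x ^ α = exp (α * t)`.  A function on the covering is a function `φ : ℂ → ℂ` of
the variable `t`; it is analytic on the covering when it is entire in `t`. -/

/-- The coefficient of `x ^ (m - j)` in `x ^ m + a₁ x ^ (m - 1) + ⋯ + a_m`; the parameter
`a_j` (`1 ≤ j ≤ m`) is the entry of `a` at the index `j - 1`.  It is `1` for `j = 0`, and `0` for
`j > m`. -/
def coef {m : ℕ} (a : Fin m → ℂ) (j : ℕ) : ℂ :=
  if h : 1 ≤ j ∧ j ≤ m then a ⟨j - 1, by omega⟩ else if j = 0 then 1 else 0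

/-- `P_m(x, a) = x ^ m + a₁ x ^ (m - 1) + ⋯ + a_m`. -/
def polyP {m : ℕ} (a : Fin m → ℂ) (x : ℂ) : ℂ :=
  ∑ j ∈ Finset.range (m + 1), coef a j * x ^ (m - j)

/-- The derivative with respect to `x = exp t` of a function on the universal covering. -/
def Dx (φ : ℂ → ℂ) (t : ℂ) : ℂ := exp (-t) * deriv φ t

/-- `φ` is an analytic solution, on the universal covering of `ℂ \ {0}`, of
`d²Φ/dx² = (P_m(x, a) / x ^ 2) Φ`. -/
def IsSolution {m : ℕ} (a : Fin m → ℂ) (φ : ℂ → ℂ) : Prop :=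
  Differentiable ℂ φ ∧ ∀ t : ℂ, Dx (Dx φ) t = polyP a (exp t) / exp t ^ 2 * φ t

/-- The coefficients of the formal square root, with constant term `1`, of the power series
`q₀ + q₁ z + q₂ z ^ 2 + ⋯` with `q₀ = 1`. -/
def sqrtCoeff (q : ℕ → ℂ) : ℕ → ℂ
  | 0 => 1
  | n + 1 => (q (n + 1) - ∑ i : Fin n, sqrtCoeff q (i + 1) * sqrtCoeff q (n - i)) / 2
decreasing_by all_goals omega

theorem sqrtCoeff_sq (q : ℕ → ℂ) (hq : q 0 = 1) :
    (PowerSeries.mk (sqrtCoeff q)) ^ 2 = PowerSeries.mk q := by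
  ext n
  rw [sq, PowerSeries.coeff_mul, Finset.Nat.sum_antidiagonal_eq_sum_range_succ_mk]
  simp only [PowerSeries.coeff_mk]
  cases n with
  | zero => simp [sqrtCoeff, hq]
  | succ n =>
    rw [Finset.sum_range_succ, Finset.sum_range_succ']
    have h : ∑ k ∈ Finset.range n, sqrtCoeff q (k + 1) * sqrtCoeff q (n + 1 - (k + 1))
        = ∑ i : Fin n, sqrtCoeff q (i + 1) * sqrtCoeff q (n - i) := by
      rw [Finset.sum_range]
      refine Finset.sum_congr rfl fun i _ => ?_
      rw [Nat.add_sub_add_right]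
    rw [h]
    simp only [Nat.sub_zero, Nat.sub_self]
    have h0 : sqrtCoeff q 0 = 1 := by rw [sqrtCoeff]
    have h1 : sqrtCoeff q (n + 1)
        = (q (n + 1) - ∑ i : Fin n, sqrtCoeff q (i + 1) * sqrtCoeff q (n - i)) / 2 := by
      rw [sqrtCoeff]
    rw [h0, h1]
    ring

/-- `b_{m/2 - k}(a)`: the coefficient of `x ^ (m / 2 - k - 1)` in the expansion at infinity
of `√P_m(x, a) / x`. -/
def bCoeff {m : ℕ} (a : Fin m → ℂ) (k : ℕ) : ℂ := sqrtCoeff (coef a) k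

/-- `S(x, a) = ∑ b_{m/2 - k}(a) / (m / 2 - k) * x ^ (m / 2 - k)`, the sum over `0 ≤ k < m / 2`. -/
def expoS {m : ℕ} (a : Fin m → ℂ) (t : ℂ) : ℂ :=
  ∑ k ∈ (Finset.range m).filter (fun k => 2 * k < m),
    bCoeff a k / ((m : ℂ) / 2 - k) * exp (((m : ℂ) / 2 - k) * t)

/-- `r(a) = 1/2 - m/4` for odd `m`, and `r(a) = 1/2 - m/4 - b₀(a)` for even `m`. -/
def expoR {m : ℕ} (a : Fin m → ℂ) : ℂ :=
  1 / 2 - (m : ℂ) / 4 - (if Even m then bCoeff a (m / 2) else 0)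

/-- The formal series `φ₀` is a series in `x ^ (-κ)`, with `κ = 1/2` for odd `m` and `κ = 1` for
even `m`. -/
def stepK (m : ℕ) : ℝ := if Even m then 1 else 1 / 2

/-- `φ` is the solution with asymptotic expansion
`x ^ r(a) * exp (-S(x, a)) * (1 + c₁ x ^ (-κ) + c₂ x ^ (-2 κ) + ⋯)` at infinity
in every strict subsector of `|arg x| < 3 π / m`. -/
def IsPhi0 {m : ℕ} (a : Fin m → ℂ) (φ : ℂ → ℂ) : Prop :=
  IsSolution a φ ∧
  ∃ c : ℕ → ℂ, c 0 = 1 ∧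
    ∀ θ : ℝ, θ < 3 * Real.pi / m → ∀ N : ℕ, ∃ K R : ℝ, ∀ t : ℂ, |t.im| ≤ θ → R ≤ t.re →
      ‖φ t * exp (-(expoR a * t)) * exp (expoS a t)
          - ∑ n ∈ Finset.range N, c n * exp (-((stepK m * n : ℝ) * t))‖
        ≤ K * Real.exp (-(stepK m * N * t.re))

/-- The solution `Φ₀(·, a)`, characterized by its asymptotic expansion at infinity. -/
def Phi0 {m : ℕ} (a : Fin m → ℂ) : ℂ → ℂ := Classical.epsilon (IsPhi0 a)

/-- `ω ^ α` for `ω = exp (2 i π / m)`, that is `exp (2 i π α / m)`. -/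
def omegaPow (m : ℕ) (α : ℂ) : ℂ := exp (2 * Real.pi * I * α / m)

/-- `τ · a = (τ a₁, τ ^ 2 a₂, …, τ ^ m a_m)`. -/
def dil {m : ℕ} (τ : ℂ) (a : Fin m → ℂ) : Fin m → ℂ := fun i => τ ^ ((i : ℕ) + 1) * a i

/-- `Φ_k(x, a) = Φ₀(ω ^ k x, ω ^ k · a)`; on the universal covering, `x ↦ ω ^ k x` adds
`2 π k / m` to the argument of `x`. -/
def Phi {m : ℕ} (k : ℤ) (a : Fin m → ℂ) (t : ℂ) : ℂ :=
  Phi0 (dil (omegaPow m k) a) (t + 2 * Real.pi * I * k / m)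

/-- `M` is the Stokes-Sibuya connection matrix `𝔖_k(a)`: its rows are `(C_k(a), C̃_k(a))` and
`(1, 0)`, with `Φ_{k-1} = C_k(a) Φ_k + C̃_k(a) Φ_{k+1}`. -/
def IsStokesSibuyaMatrix {m : ℕ} (k : ℤ) (a : Fin m → ℂ) (M : Matrix (Fin 2) (Fin 2) ℂ) : Prop :=
  ∃ C C' : ℂ, M = !![C, C'; 1, 0] ∧
    ∀ t : ℂ, Phi (k - 1) a t = C * Phi k a t + C' * Phi (k + 1) a t

/-- `s(p) = (1 + p) / 2`. -/
def expoAtZero (p : ℂ) : ℂ := (1 + p) / 2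

/-- `(f₁, f₂)` is the normalized Fuchs system of solutions at the origin attached to a square
root `p` of `1 + 4 a_m`:
`f₁ = x ^ s(p) * g₁(x)` and `f₂ = lam * f₁ * log x + x ^ s(-p) * g₂(x)` with `g₁`, `g₂` entire,
`g₁(0) = 1`, and
* `lam = 0` and `g₂(0) = 1` if `p ∉ ℤ`;
* `g₂(0) = 1` and the coefficient of `x ^ p` in `g₂` is `0` if `p` is a positive integer;
* `lam = 1` and `g₂(0) = 0` if `p = 0`;
* if `-p` is a positive integer, `(f₂, f₁)` is the system attached to `-p`, this system being
  free of logarithms: `lam = 0`, `g₂(0) = 1`, and the coefficient of `x ^ (-p)` in `g₁` is `0`. -/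
def IsFuchsSystem {m : ℕ} (a : Fin m → ℂ) (p : ℂ) (f₁ f₂ : ℂ → ℂ) : Prop :=
  p ^ 2 = 1 + 4 * coef a m ∧ IsSolution a f₁ ∧ IsSolution a f₂ ∧
  ∃ (g₁ g₂ : ℂ → ℂ) (lam : ℂ), Differentiable ℂ g₁ ∧ Differentiable ℂ g₂ ∧
    (∀ t, f₁ t = exp (expoAtZero p * t) * g₁ (exp t)) ∧
    (∀ t, f₂ t = lam * f₁ t * t + exp (expoAtZero (-p) * t) * g₂ (exp t)) ∧
    g₁ 0 = 1 ∧
    (p ≠ 0 → g₂ 0 = 1) ∧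
    (p = 0 → lam = 1 ∧ g₂ 0 = 0) ∧
    ((∀ n : ℤ, p ≠ n) → lam = 0) ∧
    (∀ n : ℕ, 1 ≤ n → p = n → iteratedDeriv n g₂ 0 = 0) ∧
    (∀ n : ℕ, 1 ≤ n → p = -n → lam = 0 ∧ iteratedDeriv n g₁ 0 = 0)

/-- `M` is the `0∞` connection matrix `M_k(a', p)`: `(Φ_{k-1}, Φ_k) = M (f₁, f₂)`, as column
vectors. -/
def IsConnectionMatrix {m : ℕ} (k : ℤ) (a : Fin m → ℂ) (p : ℂ) (M : Matrix (Fin 2) (Fin 2) ℂ) :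
    Prop :=
  ∃ f₁ f₂ : ℂ → ℂ, IsFuchsSystem a p f₁ f₂ ∧
    ∀ t : ℂ, ![Phi (k - 1) a t, Phi k a t] = M.mulVec ![f₁ t, f₂ t]

/-- The parameter `(0, …, 0, a_m)`, that is `a' = 0`. -/
def lastOnly (m : ℕ) (am : ℂ) : Fin m → ℂ := fun i => if (i : ℕ) + 1 = m then am else 0

end

end StokesSibuya

namespace StokesSibuya

open Complex Filter Topology

/-! ### Entire power series -/

/-! For `a' = 0` the equation is a modified Bessel equation in disguise. On the covering, with `x =
exp t`, put `Φ = exp (t / 2) * f w` and `w = m t / 2 + log (2 / m)`. Then `f'' = (exp (2 w) + ν ^ 2)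
f` with `ν = p / m`, and the rotation `x ↦ ω x` becomes the shift `w ↦ w + π i`. Since `ω ^ m = 1`,
the dilation by `ω ^ k` fixes `(0, …, 0, a_m)`, so every `Φ_k` is a shift of the single function
`Φ_0`, and everything reduces to one subdominant Bessel solution `f` and the shift operator `T f = f
(· + π i)`.

Stokes matrix. On the two-dimensional solution space `T` preserves the Wronskian, so its determinant
is `1`. A Frobenius solution is an eigenvector with eigenvalue `exp (π i ν)`. Hence `T + T⁻¹ = 2 cos
(π ν)` by Cayley–Hamilton (`IsBessel.shift_add_shift`), also for integral `ν`. The asymptotics of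
`f` on the lines `Im w = 0` and `Im w = π` give the Wronskian of `f` and `T f` the value `-2 i`.
Thus the two are independent and the connection coefficients are unique.

Existence and uniqueness of `f`. A Laplace integral along the ray of direction `exp (i φ)`, `|φ| < π
/ 2`, solves the equation with the required expansion on `|Im w - φ| < π`. The potential is entire,
so each of these local solutions extends to all of `ℂ`. Two solutions with the same decaying leading
term on the positive real axis coincide (`IsBessel.eq_of_tendsto`), so all the extensions are one
function, whose expansion holds for `|Im w| < 3 π / 2`, that is `|arg x| < 3 π / m`.

Connection with the origin. For `ν ∉ ℤ` write `f = α F_ν + β F_{-ν}` with Frobenius solutions. The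
Wronskian of `F_ν` and `f`, computed as `w → -∞` from the Laplace integral, yields `β` through the
duplication formula. The Wronskian `-2 i` of `f` and `T f` fixes the product `α β`, and the
reflection formula then yields `α`. The Frobenius factors are series in `x ^ m`, so the normalized
system at the origin is free of logarithms as soon as `p / m ∉ ℤ`, even for integral `p`. The
remaining powers of `m` and `ω` are collected by `β_m p = (p / m) (log m + π i)`. -/

/-- The coefficients decay faster than every geometric sequence. -/
def EntireCoeff (c : ℕ → ℂ) : Prop := ∀ R : ℝ, 0 < R → ∃ C : ℝ, ∀ n, ‖c n‖ * R ^ n ≤ C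

/-- The sum of a power series. -/
noncomputable def powSum (c : ℕ → ℂ) (z : ℂ) : ℂ := ∑' n, c n * z ^ n

/-- The coefficients of the derivative of a power series. -/
def derivCoeff (c : ℕ → ℂ) (n : ℕ) : ℂ := (n + 1) * c (n + 1)

theorem EntireCoeff.exists_geometric_bound {c : ℕ → ℂ} (hc : EntireCoeff c) {R : ℝ} (hR : 0 < R) :
    ∃ C : ℝ, ∀ n, ‖c n‖ * R ^ n ≤ C * (1 / 2) ^ n := by
  obtain ⟨C, hC⟩ := hc (2 * R) (by positivity)
  refine ⟨C, fun n => ?_⟩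
  have := hC n
  rw [mul_pow] at this
  rw [one_div, inv_pow, ← div_eq_mul_inv, le_div_iff₀ (by positivity)]
  linarith

theorem EntireCoeff.summable_norm {c : ℕ → ℂ} (hc : EntireCoeff c) (z : ℂ) :
    Summable fun n => ‖c n * z ^ n‖ := by
  obtain ⟨C, hC⟩ := hc.exists_geometric_bound (R := ‖z‖ + 1) (by positivity)
  refine Summable.of_nonneg_of_le (fun n => norm_nonneg _) (fun n => ?_)
    (summable_geometric_two.mul_left C)
  rw [norm_mul, norm_pow]
  refine le_trans ?_ (hC n)
  gcongr
  linarith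

theorem EntireCoeff.hasSum {c : ℕ → ℂ} (hc : EntireCoeff c) (z : ℂ) :
    HasSum (fun n => c n * z ^ n) (powSum c z) := (hc.summable_norm z).of_norm.hasSum

theorem EntireCoeff.derivCoeff {c : ℕ → ℂ} (hc : EntireCoeff c) : EntireCoeff (derivCoeff c) := by
  intro R hR
  obtain ⟨C, hC⟩ := hc (2 * R) (by positivity)
  refine ⟨C / R, fun n => ?_⟩
  rw [le_div_iff₀ hR]
  refine le_trans ?_ (hC (n + 1))
  have h : ‖((n : ℂ) + 1)‖ ≤ 2 ^ (n + 1) := by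
    have h1 : ‖((n : ℂ) + 1)‖ = (n + 1 : ℕ) := by
      rw [← Nat.cast_succ, Complex.norm_natCast]
    rw [h1]
    exact_mod_cast (Nat.lt_two_pow_self).le
  rw [StokesSibuya.derivCoeff, norm_mul, mul_pow, pow_succ R]
  have h2 : ‖((n : ℂ) + 1)‖ * (‖c (n + 1)‖ * (R ^ n * R))
      ≤ 2 ^ (n + 1) * (‖c (n + 1)‖ * (R ^ n * R)) := by gcongr
  linarith

theorem powSum_zero (c : ℕ → ℂ) : powSum c 0 = c 0 := by
  rw [powSum, tsum_eq_single 0 (fun n hn => by simp [hn])]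
  simp

theorem EntireCoeff.hasDerivAt {c : ℕ → ℂ} (hc : EntireCoeff c) (z : ℂ) :
    HasDerivAt (powSum c) (powSum (StokesSibuya.derivCoeff c) z) z := by
  obtain ⟨C, hC⟩ := hc.derivCoeff.exists_geometric_bound (R := ‖z‖ + 1) (by positivity)
  have hz : z ∈ Metric.ball (0 : ℂ) (‖z‖ + 1) := by simp
  -- The factor `2` pays for the index shift: the derivative of the `n`-th term is the term of index
  -- `n - 1` of the series `derivCoeff c`.
  set u : ℕ → ℝ := fun n => C * 2 * (1 / 2) ^ n with hu
  have hCpos : 0 ≤ C := by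
    have := hC 0
    simp only [pow_zero, mul_one] at this
    exact (norm_nonneg _).trans this
  have key := hasDerivAt_tsum_of_isPreconnected (u := u)
    (g := fun n y => c n * y ^ n) (g' := fun n y => c n * (n * y ^ (n - 1)))
    (summable_geometric_two.mul_left (C * 2)) Metric.isOpen_ball
    (convex_ball (0 : ℂ) (‖z‖ + 1)).isPreconnected
    (fun n y _ => (hasDerivAt_pow n y).const_mul (c n)) (fun n y hy => ?_)
    hz (hc.hasSum z).summable hz
  · refine key.congr_deriv ?_
    have hs : Summable fun n : ℕ => c n * ((n : ℂ) * z ^ (n - 1)) := by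
      rw [← summable_nat_add_iff 1]
      refine (hc.derivCoeff.hasSum z).summable.congr fun n => ?_
      simp only [StokesSibuya.derivCoeff, Nat.add_sub_cancel]
      push_cast
      ring
    rw [hs.tsum_eq_zero_add, powSum]
    simp only [Nat.cast_zero, zero_mul, mul_zero, zero_add, Nat.add_sub_cancel]
    refine tsum_congr fun n => ?_
    simp only [StokesSibuya.derivCoeff]
    push_cast
    ring
  · rcases n with _ | n
    · simp [hu]; linarith
    · have hy' : ‖y‖ ≤ ‖z‖ + 1 := by
        rw [mem_ball_zero_iff] at hy
        exact hy.le
      have h1 : ‖c (n + 1) * (((n + 1 : ℕ) : ℂ) * y ^ (n + 1 - 1))‖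
          ≤ ‖StokesSibuya.derivCoeff c n‖ * (‖z‖ + 1) ^ n := by
        rw [Nat.add_sub_cancel, ← mul_assoc, norm_mul, norm_pow, StokesSibuya.derivCoeff,
          mul_comm (c (n + 1))]
        push_cast
        gcongr
      refine h1.trans ((hC n).trans (le_of_eq ?_))
      simp only [hu]
      rw [pow_succ]
      ring

theorem EntireCoeff.differentiable {c : ℕ → ℂ} (hc : EntireCoeff c) :
    Differentiable ℂ (powSum c) := fun z => (hc.hasDerivAt z).differentiableAt

/-! ### Linear differential equations `f'' = q f` with entire `q` -/

/-- The Taylor coefficients at `0` of the solution of `f'' = q f` with `f 0 = a`, `f' 0 = b`. -/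
noncomputable def odeCoeff (q : ℕ → ℂ) (a b : ℂ) : ℕ → ℂ
  | 0 => a
  | 1 => b
  | n + 2 => (∑ i : Fin (n + 1), odeCoeff q a b i * q (n - i)) / ((n + 2) * (n + 1))
decreasing_by all_goals omega

/-- The convolution with the geometrically bounded `q` costs a factor at most `2 Q`, while the
recursion divides by `(k + 2) (k + 1)`. Once this exceeds `2 Q R ^ 2`, the bound `C`, taken as the
sum of the first `n₀ + 2` scaled coefficients, propagates by induction. -/
theorem odeCoeff_entire {q : ℕ → ℂ} (hq : EntireCoeff q) (a b : ℂ) :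
    EntireCoeff (odeCoeff q a b) := by
  intro R hR
  obtain ⟨Q, hQ⟩ := hq.exists_geometric_bound hR
  have hQ0 : 0 ≤ Q := by
    have := hQ 0
    simp only [pow_zero, mul_one] at this
    exact (norm_nonneg _).trans this
  obtain ⟨n₀, hn₀⟩ := exists_nat_ge (R ^ 2 * (Q * 2))
  set c := odeCoeff q a b with hc
  set C : ℝ := ∑ k ∈ Finset.range (n₀ + 2), ‖c k‖ * R ^ k with hC
  have hC0 : 0 ≤ C := Finset.sum_nonneg fun k _ => by positivity
  refine ⟨C, fun n => ?_⟩
  induction n using Nat.strong_induction_on with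
  | _ n ih =>
    by_cases hn : n < n₀ + 2
    · exact Finset.single_le_sum (f := fun k => ‖c k‖ * R ^ k)
        (fun k _ => by positivity) (Finset.mem_range.2 hn)
    · obtain ⟨k, rfl⟩ : ∃ k, n = k + 2 := ⟨n - 2, by omega⟩
      have hk : n₀ ≤ k := by omega
      have hrec : c (k + 2) = (∑ i : Fin (k + 1), c i * q (k - i)) / ((k + 2) * (k + 1)) := by
        rw [hc, odeCoeff]
      have hnorm : ‖(((k : ℂ) + 2) * (k + 1))‖ = ((k : ℝ) + 2) * (k + 1) := by
        have h1 : (((k : ℂ) + 2) * (k + 1)) = (((k + 2) * (k + 1) : ℕ) : ℂ) := by push_cast; ring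
        rw [h1, Complex.norm_natCast]
        push_cast
        ring
      rw [hrec, norm_div, hnorm, div_mul_eq_mul_div, div_le_iff₀ (by positivity)]
      have hsum : ‖∑ i : Fin (k + 1), c i * q (k - i)‖ * R ^ k ≤ C * (Q * 2) := by
        calc ‖∑ i : Fin (k + 1), c i * q (k - i)‖ * R ^ k
            ≤ (∑ i : Fin (k + 1), ‖c i * q (k - i)‖) * R ^ k := by
              gcongr
              exact norm_sum_le _ _
          _ = ∑ i : Fin (k + 1), (‖c i‖ * R ^ (i : ℕ)) * (‖q (k - i)‖ * R ^ (k - i : ℕ)) := by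
              rw [Finset.sum_mul]
              refine Finset.sum_congr rfl fun i _ => ?_
              rw [norm_mul]
              have : R ^ k = R ^ (i : ℕ) * R ^ (k - i : ℕ) := by
                rw [← pow_add]
                congr 1
                omega
              rw [this]
              ring
          _ ≤ ∑ i : Fin (k + 1), C * (Q * (1 / 2) ^ (k - i : ℕ)) := by
              refine Finset.sum_le_sum fun i _ => ?_
              exact mul_le_mul (ih i (by omega)) (hQ _) (by positivity) hC0
          _ = C * (Q * ∑ i ∈ Finset.range (k + 1), (1 / 2 : ℝ) ^ i) := by
              rw [← Finset.mul_sum, ← Finset.mul_sum,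
                Fin.sum_univ_eq_sum_range (fun i => (1 / 2 : ℝ) ^ (k - i : ℕ)),
                ← Finset.sum_range_reflect (fun i => (1 / 2 : ℝ) ^ i)]
              simp
          _ ≤ C * (Q * 2) := by
              have h2 := summable_geometric_two.sum_le_tsum (Finset.range (k + 1))
                (fun i _ => by positivity)
              rw [tsum_geometric_two] at h2
              gcongr
      have hkk : R ^ 2 * (Q * 2) ≤ ((k : ℝ) + 2) * (k + 1) := by
        have : (n₀ : ℝ) ≤ k := by exact_mod_cast hk
        nlinarith [Nat.cast_nonneg (α := ℝ) k]
      calc _ = R ^ 2 * (‖∑ i : Fin (k + 1), c i * q (k - i)‖ * R ^ k) := by ring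
        _ ≤ R ^ 2 * (C * (Q * 2)) := by gcongr
        _ = C * (R ^ 2 * (Q * 2)) := by ring
        _ ≤ _ := by gcongr

/-- The pair `(f, f')` satisfies `f'' = q f` on `U`. -/
def SolvesOn (q : ℂ → ℂ) (U : Set ℂ) (f f' : ℂ → ℂ) : Prop :=
  ∀ w ∈ U, HasDerivAt f (f' w) w ∧ HasDerivAt f' (q w * f w) w

theorem exists_solvesOn_univ {q : ℕ → ℂ} (hq : EntireCoeff q) (a b : ℂ) :
    ∃ f f' : ℂ → ℂ, SolvesOn (powSum q) Set.univ f f' ∧ f 0 = a ∧ f' 0 = b := by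
  have hc := odeCoeff_entire hq a b
  refine ⟨powSum (odeCoeff q a b), powSum (derivCoeff (odeCoeff q a b)),
    fun w _ => ⟨hc.hasDerivAt w, ?_⟩, ?_, ?_⟩
  · refine (hc.derivCoeff.hasDerivAt w).congr_deriv ?_
    symm
    rw [mul_comm, powSum, powSum, tsum_mul_tsum_eq_tsum_sum_antidiagonal_of_summable_norm
      (hc.summable_norm w) (hq.summable_norm w), powSum]
    refine tsum_congr fun n => ?_
    rw [Finset.Nat.sum_antidiagonal_eq_sum_range_succ_mk, derivCoeff, derivCoeff, odeCoeff]
    have h1 : ((n : ℂ) + 1) ≠ 0 := by exact_mod_cast Nat.succ_ne_zero n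
    have h2 : ((n : ℂ) + 2) ≠ 0 := by exact_mod_cast Nat.succ_ne_zero (n + 1)
    have h3 : (((n + 1 : ℕ) : ℂ) + 1) = n + 2 := by push_cast; ring
    rw [h3, Fin.sum_univ_eq_sum_range (fun i => odeCoeff q a b i * q (n - i)) (n + 1)]
    have h4 : ((n : ℂ) + 1) * ((n + 2) *
        ((∑ i ∈ Finset.range (n + 1), odeCoeff q a b i * q (n - i)) / ((n + 2) * (n + 1))))
        = ∑ i ∈ Finset.range (n + 1), odeCoeff q a b i * q (n - i) := by field_simp
    rw [h4, Finset.sum_mul]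
    refine Finset.sum_congr rfl fun i hi => ?_
    have hi' : i ≤ n := Nat.lt_succ_iff.1 (Finset.mem_range.1 hi)
    have : w ^ n = w ^ i * w ^ (n - i) := by rw [← pow_add, Nat.add_sub_cancel' hi']
    rw [this]
    ring
  · rw [powSum_zero, odeCoeff]
  · rw [powSum_zero, derivCoeff, odeCoeff]
    simp

theorem SolvesOn.wronskian_eq {q : ℂ → ℂ} {U : Set ℂ} (hU : IsOpen U) (hU' : Convex ℝ U)
    {f f' g g' : ℂ → ℂ} (hf : SolvesOn q U f f') (hg : SolvesOn q U g g') {x y : ℂ}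
    (hx : x ∈ U) (hy : y ∈ U) : f x * g' x - f' x * g x = f y * g' y - f' y * g y := by
  have h : ∀ w ∈ U, HasDerivAt (fun w => f w * g' w - f' w * g w) 0 w := fun w hw => by
    have := ((hf w hw).1.mul (hg w hw).2).sub ((hf w hw).2.mul (hg w hw).1)
    exact this.congr_deriv (by ring)
  exact hU.is_const_of_deriv_eq_zero hU'.isPreconnected
    (fun w hw => (h w hw).differentiableAt.differentiableWithinAt)
    (fun w hw => (h w hw).deriv) hx hy

theorem SolvesOn.mono {q : ℂ → ℂ} {U V : Set ℂ} {f f' : ℂ → ℂ} (hf : SolvesOn q V f f')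
    (h : U ⊆ V) : SolvesOn q U f f' := fun w hw => hf w (h hw)

/-- A solution on a convex open set extends to an entire solution. -/
theorem SolvesOn.exists_extension {q : ℕ → ℂ} (hq : EntireCoeff q) {U : Set ℂ} (hU : IsOpen U)
    (hU' : Convex ℝ U) {f f' : ℂ → ℂ} (hf : SolvesOn (powSum q) U f f') (hne : U.Nonempty) :
    ∃ g g' : ℂ → ℂ, SolvesOn (powSum q) Set.univ g g' ∧ (∀ w ∈ U, g w = f w) ∧
      ∀ w ∈ U, g' w = f' w := by
  obtain ⟨A, A', hA, hA0, hA0'⟩ := exists_solvesOn_univ hq 1 0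
  obtain ⟨B, B', hB, hB0, hB0'⟩ := exists_solvesOn_univ hq 0 1
  have hAB : ∀ w, A w * B' w - A' w * B w = 1 := fun w => by
    rw [hA.wronskian_eq isOpen_univ convex_univ hB (Set.mem_univ w) (Set.mem_univ 0), hA0, hA0',
      hB0, hB0']
    ring
  obtain ⟨x, hx⟩ := hne
  -- Cramer's rule: `A` and `B` have Wronskian `1`, so `f` is recovered from its own Wronskians with
  -- `B` and `A`. These are constant on `U`, hence known from the single point `x`.
  set α := f x * B' x - f' x * B x with hα
  set β := f x * A' x - f' x * A x with hβ
  refine ⟨fun w => α * A w - β * B w, fun w => α * A' w - β * B' w, fun w hw => ⟨?_, ?_⟩,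
    fun w hw => ?_, fun w hw => ?_⟩
  · exact ((hA w hw).1.const_mul α).sub ((hB w hw).1.const_mul β)
  · exact (((hA w hw).2.const_mul α).sub ((hB w hw).2.const_mul β)).congr_deriv (by ring)
  · have h1 := hf.wronskian_eq hU hU' (hB.mono (Set.subset_univ U)) hx hw
    have h2 := hf.wronskian_eq hU hU' (hA.mono (Set.subset_univ U)) hx hw
    simp only [hα, hβ, h1, h2]
    linear_combination f w * hAB w
  · have h1 := hf.wronskian_eq hU hU' (hB.mono (Set.subset_univ U)) hx hw
    have h2 := hf.wronskian_eq hU hU' (hA.mono (Set.subset_univ U)) hx hw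
    simp only [hα, hβ, h1, h2]
    linear_combination f' w * hAB w

/-- If `f` does not vanish at `x` and the Wronskian of `f` and `g` vanishes at `x`, then `g` is a
multiple of `f`. -/
theorem SolvesOn.eq_mul_of_wronskian_eq_zero {q : ℕ → ℂ} (hq : EntireCoeff q)
    {f f' g g' : ℂ → ℂ} (hf : SolvesOn (powSum q) Set.univ f f')
    (hg : SolvesOn (powSum q) Set.univ g g') {x : ℂ} (hx : f x ≠ 0)
    (h : f x * g' x - f' x * g x = 0) (w : ℂ) : g w = g x / f x * f w := by
  obtain ⟨A, A', hA, hA0, hA0'⟩ := exists_solvesOn_univ hq 1 0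
  obtain ⟨B, B', hB, hB0, hB0'⟩ := exists_solvesOn_univ hq 0 1
  have hAB : A w * B' w - A' w * B w = 1 := by
    rw [hA.wronskian_eq isOpen_univ convex_univ hB (Set.mem_univ w) (Set.mem_univ 0), hA0, hA0',
      hB0, hB0']
    ring
  set κ := g x / f x with hκ
  have hgx : g x = κ * f x := by rw [hκ]; field_simp
  have hgx' : g' x = κ * f' x := by
    apply mul_left_cancel₀ hx
    rw [hκ]
    field_simp
    linear_combination h
  have h1 := hf.wronskian_eq isOpen_univ convex_univ hB (Set.mem_univ w) (Set.mem_univ x)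
  have h2 := hf.wronskian_eq isOpen_univ convex_univ hA (Set.mem_univ w) (Set.mem_univ x)
  have h3 := hg.wronskian_eq isOpen_univ convex_univ hB (Set.mem_univ w) (Set.mem_univ x)
  have h4 := hg.wronskian_eq isOpen_univ convex_univ hA (Set.mem_univ w) (Set.mem_univ x)
  -- At `x` the Cauchy data of `g` are `κ` times those of `f`, hence so are the Wronskians with `A`
  -- and `B`. Cramer's rule carries the proportionality to `w`.
  rw [hgx, hgx'] at h3 h4
  linear_combination A w * h3 - B w * h4 - κ * A w * h1 + κ * B w * h2
    - (g w - κ * f w) * hAB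

end StokesSibuya

namespace StokesSibuya

open Complex Filter Topology

/-! ### The modified Bessel equation in the logarithmic variable -/

/-- The potential of the modified Bessel equation `f'' = (exp (2 w) + ν ^ 2) f` in the variable
`w = log z`. -/
noncomputable def besselPot (ν w : ℂ) : ℂ := exp (2 * w) + ν ^ 2

/-- The Taylor coefficients of `besselPot ν`. -/
noncomputable def besselPotCoeff (ν : ℂ) (n : ℕ) : ℂ :=
  2 ^ n / (n.factorial : ℂ) + if n = 0 then ν ^ 2 else 0

theorem entireCoeff_besselPot (ν : ℂ) : EntireCoeff (besselPotCoeff ν) := by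
  intro R hR
  obtain ⟨C, hC⟩ := ((Real.summable_pow_div_factorial (2 * R)).tendsto_atTop_zero.bddAbove_range)
  refine ⟨C + ‖ν ^ 2‖, fun n => ?_⟩
  have h1 : (2 * R) ^ n / (n.factorial : ℝ) ≤ C := hC ⟨n, rfl⟩
  have h2 : ‖besselPotCoeff ν n‖ ≤ 2 ^ n / (n.factorial : ℝ) + if n = 0 then ‖ν ^ 2‖ else 0 := by
    refine (norm_add_le _ _).trans ?_
    rw [norm_div, norm_pow, Complex.norm_natCast]
    split_ifs <;> simp
  refine (mul_le_mul_of_nonneg_right h2 (by positivity)).trans ?_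
  rw [add_mul]
  refine add_le_add (le_trans (le_of_eq ?_) h1) ?_
  · rw [mul_pow]; ring
  · split_ifs with h
    · simp [h]
    · simp

theorem powSum_besselPotCoeff (ν : ℂ) : powSum (besselPotCoeff ν) = besselPot ν := by
  ext w
  refine ((entireCoeff_besselPot ν).hasSum w).unique ?_
  have h1 : HasSum (fun n : ℕ => (2 * w) ^ n / (n.factorial : ℂ)) (exp (2 * w)) := by
    rw [Complex.exp_eq_exp_ℂ]
    exact NormedSpace.expSeries_div_hasSum_exp (2 * w)
  have h2 : HasSum (fun n : ℕ => if n = 0 then ν ^ 2 else 0) (ν ^ 2) := hasSum_ite_eq 0 (ν ^ 2)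
  refine (h1.add h2).congr_fun ?_ |> fun h => h
  intro n
  simp only [besselPotCoeff]
  rw [mul_pow]
  split_ifs with h
  · simp [h]
  · ring

/-- `(f, f')` is an entire solution of the modified Bessel equation together with its derivative. -/
def IsBessel (ν : ℂ) (f f' : ℂ → ℂ) : Prop := SolvesOn (besselPot ν) Set.univ f f'

theorem IsBessel.hasDerivAt {ν : ℂ} {f f' : ℂ → ℂ} (h : IsBessel ν f f') (w : ℂ) :
    HasDerivAt f (f' w) w := (h w (Set.mem_univ w)).1

theorem IsBessel.hasDerivAt' {ν : ℂ} {f f' : ℂ → ℂ} (h : IsBessel ν f f') (w : ℂ) :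
    HasDerivAt f' (besselPot ν w * f w) w := (h w (Set.mem_univ w)).2

theorem IsBessel.wronskian_eq {ν : ℂ} {f f' g g' : ℂ → ℂ} (hf : IsBessel ν f f')
    (hg : IsBessel ν g g') (x y : ℂ) : f x * g' x - f' x * g x = f y * g' y - f' y * g y :=
  SolvesOn.wronskian_eq isOpen_univ convex_univ hf hg (Set.mem_univ x) (Set.mem_univ y)

theorem IsBessel.eq_mul_of_wronskian_eq_zero {ν : ℂ} {f f' g g' : ℂ → ℂ} (hf : IsBessel ν f f')
    (hg : IsBessel ν g g') {x : ℂ} (hx : f x ≠ 0) (h : f x * g' x - f' x * g x = 0) (w : ℂ) :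
    g w = g x / f x * f w := by
  rw [IsBessel, ← powSum_besselPotCoeff] at hf hg
  exact SolvesOn.eq_mul_of_wronskian_eq_zero (entireCoeff_besselPot ν) hf hg hx h w

theorem IsBessel.linComb {ν : ℂ} {f f' g g' : ℂ → ℂ} (hf : IsBessel ν f f')
    (hg : IsBessel ν g g') (a b : ℂ) :
    IsBessel ν (fun w => a * f w + b * g w) (fun w => a * f' w + b * g' w) := fun w _ =>
  ⟨((hf.hasDerivAt w).const_mul a).add ((hg.hasDerivAt w).const_mul b),
    (((hf.hasDerivAt' w).const_mul a).add ((hg.hasDerivAt' w).const_mul b)).congr_deriv (by ring)⟩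

theorem IsBessel.shift {ν : ℂ} {f f' : ℂ → ℂ} (hf : IsBessel ν f f') (n : ℤ) :
    IsBessel ν (fun w => f (w + n * (Real.pi * I))) (fun w => f' (w + n * (Real.pi * I))) := by
  refine fun w _ => ⟨(hf.hasDerivAt _).comp_add_const w _, ?_⟩
  refine ((hf.hasDerivAt' _).comp_add_const w _).congr_deriv ?_
  congr 1
  rw [besselPot, besselPot]
  congr 1
  rw [show 2 * (w + n * (Real.pi * I)) = 2 * w + n * (2 * Real.pi * I) by ring,
    Complex.exp_periodic.int_mul n]

theorem IsBessel.neg {ν : ℂ} {f f' : ℂ → ℂ} (hf : IsBessel ν f f') : IsBessel (-ν) f f' := by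
  have : besselPot (-ν) = besselPot ν := by ext w; simp [besselPot]
  rw [IsBessel, this]
  exact hf

/-! ### Frobenius solutions at the origin -/

/-- The coefficients of the Frobenius solution with exponent `ν` at the origin. -/
noncomputable def frobCoeff (ν : ℂ) : ℕ → ℂ
  | 0 => 1
  | k + 1 => frobCoeff ν k / (4 * (k + 1) * (ν + 1 + k))

/-- The Frobenius solution with exponent `ν` at the origin, without the power prefactor. -/
noncomputable def frobG (ν : ℂ) : ℂ → ℂ := powSum (frobCoeff ν)

/-- The derivative of `frobG ν`. -/
noncomputable def frobG' (ν : ℂ) : ℂ → ℂ := powSum (derivCoeff (frobCoeff ν))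

/-- The Frobenius solution with exponent `ν` at the origin. -/
noncomputable def frob (ν w : ℂ) : ℂ := exp (ν * w) * frobG ν (exp (2 * w))

/-- The derivative of `frob ν`. -/
noncomputable def frob' (ν w : ℂ) : ℂ :=
  exp (ν * w) * (ν * frobG ν (exp (2 * w)) + 2 * exp (2 * w) * frobG' ν (exp (2 * w)))

/-- For `n ≥ ‖ν‖ + R` one has `‖ν + 1 + n‖ ≥ 1` and `4 (n + 1) ≥ R`, so the scaled coefficients no
longer increase. If some `ν + 1 + n` vanishes, division by zero makes the later coefficients `0`.
The growth bound still holds; only the differential equation needs that case excluded. -/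
theorem entireCoeff_frobCoeff (ν : ℂ) : EntireCoeff (frobCoeff ν) := by
  intro R hR
  obtain ⟨n₀, hn₀⟩ := exists_nat_ge (‖ν‖ + R)
  set C : ℝ := ∑ k ∈ Finset.range (n₀ + 1), ‖frobCoeff ν k‖ * R ^ k with hC
  refine ⟨C, fun n => ?_⟩
  induction n with
  | zero =>
    exact Finset.single_le_sum (f := fun k => ‖frobCoeff ν k‖ * R ^ k)
      (fun k _ => by positivity) (Finset.mem_range.2 (Nat.succ_pos n₀))
  | succ n ih =>
    by_cases hn : n + 1 < n₀ + 1
    · exact Finset.single_le_sum (f := fun k => ‖frobCoeff ν k‖ * R ^ k)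
        (fun k _ => by positivity) (Finset.mem_range.2 hn)
    · refine le_trans ?_ ih
      have hn' : (n₀ : ℝ) ≤ n := by exact_mod_cast (by omega : n₀ ≤ n)
      have h1 : ‖((n : ℂ) + 1)‖ = n + 1 := by
        rw [← Nat.cast_succ, Complex.norm_natCast]; push_cast; ring
      have h2 : 1 ≤ ‖ν + 1 + n‖ := by
        have := norm_sub_le (ν + 1 + n) ν
        rw [show ν + 1 + n - ν = (n : ℂ) + 1 by ring, h1] at this
        linarith
      have h4 : ‖(4 : ℂ)‖ = 4 := by simp
      have h5 : 0 < 4 * ((n : ℝ) + 1) * ‖ν + 1 + n‖ := by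
        have : 0 < ‖ν + 1 + n‖ := by linarith
        positivity
      rw [frobCoeff, norm_div, norm_mul, norm_mul, h1, h4, div_mul_eq_mul_div,
        div_le_iff₀ h5, pow_succ, mul_assoc (‖frobCoeff ν n‖)]
      refine mul_le_mul_of_nonneg_left ?_ (norm_nonneg _)
      refine mul_le_mul_of_nonneg_left ?_ (by positivity)
      have : R ≤ 4 * ((n : ℝ) + 1) := by linarith [norm_nonneg ν]
      nlinarith

theorem frobG_zero (ν : ℂ) : frobG ν 0 = 1 := by rw [frobG, powSum_zero, frobCoeff]

theorem hasDerivAt_frobG (ν x : ℂ) : HasDerivAt (frobG ν) (frobG' ν x) x :=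
  (entireCoeff_frobCoeff ν).hasDerivAt x

theorem differentiable_frobG (ν : ℂ) : Differentiable ℂ (frobG ν) :=
  (entireCoeff_frobCoeff ν).differentiable

theorem differentiable_frobG' (ν : ℂ) : Differentiable ℂ (frobG' ν) :=
  (entireCoeff_frobCoeff ν).derivCoeff.differentiable

/-- This is the Bessel equation for `exp (ν w) * G x` with `x = exp (2 w)`. The hypothesis says that
no denominator of the recursion vanishes. -/
theorem frobG_ode {ν : ℂ} (hν : ∀ n : ℕ, ν ≠ -(n + 1)) (x : ℂ) :
    4 * x * deriv (frobG' ν) x + 4 * (ν + 1) * frobG' ν x = frobG ν x := by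
  have hc := entireCoeff_frobCoeff ν
  rw [frobG', (hc.derivCoeff.hasDerivAt x).deriv]
  refine HasSum.unique ?_ (hc.hasSum x)
  have h1 := (hc.derivCoeff.derivCoeff.hasSum x).mul_left (4 * x)
  have h2 := (hc.derivCoeff.hasSum x).mul_left (4 * (ν + 1))
  have h3 : HasSum (fun n : ℕ => 4 * n * derivCoeff (frobCoeff ν) n * x ^ n)
      (4 * x * powSum (derivCoeff (derivCoeff (frobCoeff ν))) x) := by
    rw [← hasSum_nat_add_iff' 1]
    simp only [Finset.range_one, Finset.sum_singleton, Nat.cast_zero, mul_zero, zero_mul, sub_zero]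
    refine h1.congr_fun fun n => ?_
    have : derivCoeff (derivCoeff (frobCoeff ν)) n = (n + 1) * derivCoeff (frobCoeff ν) (n + 1) := rfl
    rw [this]
    push_cast
    ring
  refine (h3.add h2).congr_fun fun n => ?_
  rw [derivCoeff, frobCoeff]
  have h4 : ν + 1 + n ≠ 0 := fun h => hν n (by linear_combination h)
  have h5 : ((n : ℂ) + 1) ≠ 0 := by exact_mod_cast Nat.succ_ne_zero n
  field_simp
  ring

theorem hasDerivAt_exp_mul (a w : ℂ) : HasDerivAt (fun w => exp (a * w)) (a * exp (a * w)) w := by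
  have := ((hasDerivAt_id w).const_mul a).cexp
  simp only [id_eq, mul_one] at this
  exact this.congr_deriv (by ring)

theorem isBessel_frob {ν : ℂ} (hν : ∀ n : ℕ, ν ≠ -(n + 1)) : IsBessel ν (frob ν) (frob' ν) := by
  intro w _
  have h1 := hasDerivAt_exp_mul ν w
  have h2 := hasDerivAt_exp_mul 2 w
  have h3 := (hasDerivAt_frobG ν (exp (2 * w))).comp w h2
  have h4 := ((differentiable_frobG' ν (exp (2 * w))).hasDerivAt).comp w h2
  refine ⟨(h1.mul h3).congr_deriv ?_, (h1.mul ((h3.const_mul ν).add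
    ((h2.const_mul 2).mul h4))).congr_deriv ?_⟩
  · simp only [frob', Function.comp_apply]
    ring
  · have h5 := frobG_ode hν (exp (2 * w))
    simp only [frob, besselPot, Function.comp_apply, Pi.add_apply, Pi.mul_apply]
    linear_combination exp (ν * w) * exp (2 * w) * h5

theorem frob_shift (ν w : ℂ) (n : ℤ) :
    frob ν (w + n * (Real.pi * I)) = exp (ν * (n * (Real.pi * I))) * frob ν w := by
  rw [frob, frob, show 2 * (w + n * (Real.pi * I)) = 2 * w + n * (2 * Real.pi * I) by ring,
    Complex.exp_periodic.int_mul n, mul_add, exp_add]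
  ring

theorem frob'_shift (ν w : ℂ) (n : ℤ) :
    frob' ν (w + n * (Real.pi * I)) = exp (ν * (n * (Real.pi * I))) * frob' ν w := by
  rw [frob', frob', show 2 * (w + n * (Real.pi * I)) = 2 * w + n * (2 * Real.pi * I) by ring,
    Complex.exp_periodic.int_mul n, mul_add ν w, exp_add]
  ring

/-- Two continuous functions of `x = exp t` that agree for all `t` are equal. -/
theorem eq_of_comp_exp_eq {g h : ℂ → ℂ} (hg : Continuous g) (hh : Continuous h)
    (H : ∀ t, g (exp t) = h (exp t)) : g = h := by
  refine Continuous.ext_on (dense_compl_singleton (0 : ℂ)) hg hh fun x hx => ?_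
  rw [← exp_log (x := x) hx]
  exact H _

theorem exists_frob_ne_zero (ν : ℂ) : ∃ w, frob ν w ≠ 0 := by
  by_contra! h
  have : frobG ν = fun _ => 0 := by
    refine eq_of_comp_exp_eq (differentiable_frobG ν).continuous continuous_const fun t => ?_
    have := h (t / 2)
    rw [frob, show 2 * (t / 2) = t by ring] at this
    exact (mul_eq_zero.1 this).resolve_left (exp_ne_zero _)
  have h0 := frobG_zero ν
  rw [this] at h0
  exact zero_ne_one h0

/-- The prefactors `exp (ν w)` and `exp (-ν w)` cancel, so the Wronskian is an entire function of `x
= exp (2 w)`. It is constant for `x ≠ 0`, hence equal to its value at `x = 0`, where both power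
series are `1`. -/
theorem frob_wronskian {ν : ℂ} (hν : ∀ n : ℤ, ν ≠ n) (w : ℂ) :
    frob ν w * frob' (-ν) w - frob' ν w * frob (-ν) w = -2 * ν := by
  have h1 : ∀ n : ℕ, ν ≠ -(n + 1) := fun n => by exact_mod_cast hν (-(n + 1))
  have h2 : ∀ n : ℕ, -ν ≠ -(n + 1) := fun n h => hν (n + 1) (by
    push_cast; exact neg_inj.1 h)
  have h3 := isBessel_frob h1
  have h4 := (isBessel_frob h2).neg
  rw [neg_neg] at h4
  set c := frob ν w * frob' (-ν) w - frob' ν w * frob (-ν) w with hc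
  have key : (fun x => frobG ν x * (-ν * frobG (-ν) x + 2 * x * frobG' (-ν) x)
      - (ν * frobG ν x + 2 * x * frobG' ν x) * frobG (-ν) x) = fun _ => c := by
    have c1 := (differentiable_frobG ν).continuous
    have c2 := (differentiable_frobG (-ν)).continuous
    have c3 := (differentiable_frobG' ν).continuous
    have c4 := (differentiable_frobG' (-ν)).continuous
    refine eq_of_comp_exp_eq (by fun_prop) (by fun_prop) fun t => ?_
    rw [hc, h3.wronskian_eq h4 w (t / 2)]
    simp only [frob, frob', show 2 * (t / 2) = t by ring]
    have : exp (ν * (t / 2)) * exp (-ν * (t / 2)) = 1 := by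
      rw [← exp_add, neg_mul, add_neg_cancel, exp_zero]
    linear_combination -(frobG ν (exp t) * (-ν * frobG (-ν) (exp t) +
      2 * exp t * frobG' (-ν) (exp t)) - (ν * frobG ν (exp t) +
      2 * exp t * frobG' ν (exp t)) * frobG (-ν) (exp t)) * this
  have := congrFun key 0
  simp only [frobG_zero] at this
  rw [← this]
  ring

/-- Every solution is a combination of the two Frobenius solutions if `ν` is not an integer. -/
theorem IsBessel.eq_frob_add_frob {ν : ℂ} (hν : ∀ n : ℤ, ν ≠ n) {f f' : ℂ → ℂ}
    (hf : IsBessel ν f f') : ∃ α β : ℂ, ∀ w, f w = α * frob ν w + β * frob (-ν) w ∧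
      f' w = α * frob' ν w + β * frob' (-ν) w := by
  have h1 : ∀ n : ℕ, ν ≠ -(n + 1) := fun n => by exact_mod_cast hν (-(n + 1))
  have h2 : ∀ n : ℕ, -ν ≠ -(n + 1) := fun n h => hν (n + 1) (by
    push_cast; exact neg_inj.1 h)
  have h3 := isBessel_frob h1
  have h4 := (isBessel_frob h2).neg
  rw [neg_neg] at h4
  have h0 : ν ≠ 0 := by exact_mod_cast hν 0
  refine ⟨(f 0 * frob' (-ν) 0 - f' 0 * frob (-ν) 0) / (-2 * ν),
    -(f 0 * frob' ν 0 - f' 0 * frob ν 0) / (-2 * ν), fun w => ?_⟩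
  have h5 := hf.wronskian_eq h4 w 0
  have h6 := hf.wronskian_eq h3 w 0
  have h7 := frob_wronskian hν w
  rw [← h5, ← h6]
  constructor
  · field_simp
    linear_combination f w * h7
  · field_simp
    linear_combination f' w * h7

/-- Cayley–Hamilton for the shift `T` by `π i`, with eigenvalues `ε = exp (π i ν)` and `δ = ε⁻¹`.
Since `T F = ε F` for the Frobenius solution `F` and `T` preserves Wronskians, `(T - δ) f` has zero
Wronskian with `F`. So it is a multiple of `F` and is killed by `T - ε`. One eigenvector suffices,
which is why integral `ν ≥ 0` is allowed. -/
theorem IsBessel.shift_add_shift_aux {ν : ℂ} (hν : ∀ n : ℕ, ν ≠ -(n + 1)) {f f' : ℂ → ℂ}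
    (hf : IsBessel ν f f') (w : ℂ) :
    f (w + Real.pi * I) + f (w - Real.pi * I) = 2 * Complex.cos (Real.pi * ν) * f w := by
  have hF := isBessel_frob hν
  obtain ⟨x, hx⟩ := exists_frob_ne_zero ν
  have hT := hf.shift 1
  set ε := exp (ν * (Real.pi * I)) with hε
  set δ := exp (-(ν * (Real.pi * I))) with hδ
  have hεδ : ε * δ = 1 := by rw [hε, hδ, ← exp_add, add_neg_cancel, exp_zero]
  have hg := hT.linComb hf 1 (-δ)
  have hW : frob ν x * (1 * f' (x + (1 : ℤ) * (Real.pi * I)) + -δ * f' x)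
      - frob' ν x * (1 * f (x + (1 : ℤ) * (Real.pi * I)) + -δ * f x) = 0 := by
    have h1 := hF.wronskian_eq hf (x + (1 : ℤ) * (Real.pi * I)) x
    rw [frob_shift, frob'_shift] at h1
    simp only [Int.cast_one, one_mul] at h1 ⊢
    rw [← hε] at h1
    linear_combination δ * h1 - (frob ν x * f' (x + Real.pi * I) -
      frob' ν x * f (x + Real.pi * I)) * hεδ
  have key := hF.eq_mul_of_wronskian_eq_zero hg hx hW
  set κ := (1 * f (x + (1 : ℤ) * (Real.pi * I)) + -δ * f x) / frob ν x
  have k1 := key w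
  have k2 := key (w - Real.pi * I)
  have k3 := frob_shift ν w (-1)
  have e1 : exp (ν * (((-1 : ℤ) : ℂ) * (Real.pi * I))) = δ := by
    rw [hδ]; congr 1; push_cast; ring
  rw [e1, show w + ((-1 : ℤ) : ℂ) * (Real.pi * I) = w - Real.pi * I by push_cast; ring] at k3
  simp only [Int.cast_one, one_mul, sub_add_cancel] at k1 k2
  have hcos : 2 * Complex.cos (Real.pi * ν) = ε + δ := by
    rw [Complex.cos, hε, hδ, show (Real.pi * ν * I : ℂ) = ν * (Real.pi * I) by ring,
      show (-(Real.pi * ν : ℂ) * I) = -(ν * (Real.pi * I)) by ring]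
    ring
  rw [hcos]
  rw [k3] at k2
  linear_combination k1 - ε * k2 - (f (w - Real.pi * I) + κ * frob ν w) * hεδ

/-- The connection formula satisfied by every solution. -/
theorem IsBessel.shift_add_shift {ν : ℂ} {f f' : ℂ → ℂ} (hf : IsBessel ν f f') (w : ℂ) :
    f (w + Real.pi * I) + f (w - Real.pi * I) = 2 * Complex.cos (Real.pi * ν) * f w := by
  by_cases h : ∀ n : ℕ, ν ≠ -(n + 1)
  · exact hf.shift_add_shift_aux h w
  · have h' : ∀ n : ℕ, -ν ≠ -(n + 1) := by
      push Not at h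
      obtain ⟨k, hk⟩ := h
      intro n hn
      rw [hk, neg_neg] at hn
      have : ((k + 1 + (n + 1) : ℕ) : ℂ) = 0 := by push_cast; linear_combination hn
      exact absurd (Nat.cast_eq_zero.1 this) (by omega)
    have := hf.neg.shift_add_shift_aux h' w
    rwa [mul_neg, Complex.cos_neg] at this

end StokesSibuya

namespace StokesSibuya

open Complex Filter Topology MeasureTheory

/-! ### Powers of `1 + u` in a sector -/

/-- A closed sector at the origin that avoids the negative real axis. -/
def sector (c : ℝ) : Set ℂ := {u | (2 * c ^ 2 - 1) * ‖u‖ ≤ u.re}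

theorem mem_sector {c : ℝ} {u : ℂ} : u ∈ sector c ↔ (2 * c ^ 2 - 1) * ‖u‖ ≤ u.re := Iff.rfl

theorem smul_mem_sector {c s : ℝ} {u : ℂ} (hs : 0 ≤ s) (hu : u ∈ sector c) :
    (s : ℂ) * u ∈ sector c := by
  rw [mem_sector] at *
  rw [norm_mul, Complex.norm_real, Real.norm_of_nonneg hs, re_ofReal_mul]
  nlinarith

/-- With `c = cos (θ / 2)` the constant `2 c ^ 2 - 1` is `cos θ`, so the sector is `|arg u| ≤ θ`. On
its boundary the squares of the two sides differ by `(1 - c ^ 2) (1 - ‖u‖) ^ 2`. -/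
theorem le_norm_one_add {c : ℝ} (hc : 0 < c) (hc1 : c ≤ 1) {u : ℂ} (hu : u ∈ sector c) :
    c * (1 + ‖u‖) ≤ ‖1 + u‖ := by
  rw [mem_sector] at hu
  have h1 : ‖1 + u‖ ^ 2 = 1 + 2 * u.re + ‖u‖ ^ 2 := by
    rw [Complex.sq_norm, Complex.sq_norm, normSq_apply, normSq_apply]
    simp
    ring
  refine le_of_sq_le_sq ?_ (norm_nonneg _)
  rw [h1]
  have : 0 ≤ (1 - c ^ 2) * (1 - ‖u‖) ^ 2 := mul_nonneg (by nlinarith) (sq_nonneg _)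
  nlinarith [norm_nonneg u]

theorem one_add_mem_slitPlane {c : ℝ} (hc : 0 < c) {u : ℂ} (hu : u ∈ sector c) :
    1 + u ∈ slitPlane := by
  rw [mem_sector] at hu
  rw [mem_slitPlane_iff]
  by_contra! h
  simp only [add_re, one_re, add_im, one_im, zero_add] at h
  have h1 : ‖u‖ = -u.re := by
    have : u = (u.re : ℂ) := by apply Complex.ext <;> simp [h.2]
    rw [this, Complex.norm_real, Real.norm_eq_abs, abs_of_nonpos (by linarith), ofReal_re]
  rw [h1] at hu
  nlinarith [h.1, sq_pos_of_pos hc]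

theorem exists_sector_mem_nhds {u : ℂ} (hu : u ∈ slitPlane) :
    ∃ c : ℝ, 0 < c ∧ c ≤ 1 ∧ sector c ∈ 𝓝 u := by
  have hu0 : 0 < ‖u‖ := norm_pos_iff.2 (slitPlane_ne_zero hu)
  have h1 : 0 < u.re + ‖u‖ := by
    rcases mem_slitPlane_iff.1 hu with h | h
    · positivity
    · have := abs_re_lt_norm.2 h
      linarith [neg_abs_le u.re]
  have h2 : u.re ≤ ‖u‖ := re_le_norm u
  set c : ℝ := (u.re + ‖u‖) / (4 * ‖u‖) with hc
  have hc0 : 0 < c := by positivity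
  have hc1 : c ≤ 1 / 2 := by
    rw [hc, div_le_iff₀ (by positivity)]
    linarith
  refine ⟨c, hc0, by linarith, ?_⟩
  have h3 : (2 * c ^ 2 - 1) * ‖u‖ < u.re := by
    have h4 : c * ‖u‖ = (u.re + ‖u‖) / 4 := by rw [hc]; field_simp
    nlinarith [mul_pos hc0 hu0]
  have h5 : IsOpen {v : ℂ | (2 * c ^ 2 - 1) * ‖v‖ < v.re} :=
    isOpen_lt (by fun_prop) Complex.continuous_re
  exact mem_of_superset (h5.mem_nhds h3) fun v hv => mem_sector.2 (le_of_lt hv)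

theorem exists_norm_one_add_cpow_le {c : ℝ} (hc : 0 < c) (hc1 : c ≤ 1) (b : ℂ) :
    ∃ K : ℝ, 0 ≤ K ∧ ∃ L : ℕ, ∀ u ∈ sector c, ‖(1 + u) ^ b‖ ≤ K * (1 + ‖u‖) ^ L := by
  refine ⟨(1 + c ^ b.re) * Real.exp (Real.pi * |b.im|), by positivity, ⌈|b.re|⌉₊, fun u hu => ?_⟩
  have h1 : Real.exp (-(arg (1 + u) * b.im)) ≤ Real.exp (Real.pi * |b.im|) := by
    apply Real.exp_le_exp.2
    refine (neg_le_abs _).trans ?_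
    rw [abs_mul]
    exact mul_le_mul_of_nonneg_right (abs_arg_le_pi _) (abs_nonneg _)
  have h2 : (1 + ‖u‖) ^ b.re ≤ (1 + ‖u‖) ^ ⌈|b.re|⌉₊ := by
    rw [← Real.rpow_natCast]
    exact Real.rpow_le_rpow_of_exponent_le (by linarith [norm_nonneg u])
      ((le_abs_self _).trans (Nat.le_ceil _))
  have h3 : 1 ≤ (1 + ‖u‖) ^ ⌈|b.re|⌉₊ := one_le_pow₀ (by linarith [norm_nonneg u])
  have h4 : c * (1 + ‖u‖) ≤ ‖1 + u‖ := le_norm_one_add hc hc1 hu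
  have h5 : ‖1 + u‖ ≤ 1 + ‖u‖ := by
    refine (norm_add_le _ _).trans (by simp)
  have h6 : 0 < c ^ b.re := by positivity
  have h7 : ‖1 + u‖ ^ b.re ≤ (1 + c ^ b.re) * (1 + ‖u‖) ^ ⌈|b.re|⌉₊ := by
    rcases le_total 0 b.re with hb | hb
    · have := Real.rpow_le_rpow (norm_nonneg _) h5 hb
      nlinarith
    · have h8 : c ≤ ‖1 + u‖ := by nlinarith [norm_nonneg u]
      have := Real.rpow_le_rpow_of_nonpos hc h8 hb
      nlinarith
  refine (norm_cpow_le _ _).trans ?_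
  rw [div_eq_mul_inv, ← Real.exp_neg]
  calc _ ≤ ((1 + c ^ b.re) * (1 + ‖u‖) ^ ⌈|b.re|⌉₊) * Real.exp (Real.pi * |b.im|) := by gcongr
    _ = _ := by ring

/-- The binomial coefficients with complex upper argument. -/
noncomputable def binC : ℂ → ℕ → ℂ
  | _, 0 => 1
  | c, n + 1 => c / (n + 1) * binC (c - 1) n

/-- Taylor expansion of `(1 + u) ^ b`, uniformly in a sector. -/
theorem exists_norm_one_add_cpow_sub_le {c : ℝ} (hc : 0 < c) (hc1 : c ≤ 1) (N : ℕ) :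
    ∀ b : ℂ, ∃ K : ℝ, 0 ≤ K ∧ ∃ L : ℕ, ∀ u ∈ sector c,
      ‖(1 + u) ^ b - ∑ n ∈ Finset.range N, binC b n * u ^ n‖ ≤ K * ‖u‖ ^ N * (1 + ‖u‖) ^ L := by
  induction N with
  | zero =>
    intro b
    simpa using exists_norm_one_add_cpow_le hc hc1 b
  | succ N ih =>
    intro b
    obtain ⟨K, hK, L, h⟩ := ih (b - 1)
    refine ⟨‖b‖ * K, by positivity, L, fun u hu => ?_⟩
    -- The derivative of the remainder of order `N + 1` for the exponent `b` is `b` times the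
    -- remainder of order `N` for `b - 1`, so the induction must hold for all exponents at once. The
    -- mean value inequality on the segment from `0` to `u`, which stays in the sector, gains the
    -- factor `‖u‖`.
    set g : ℂ → ℂ := fun y => (1 + y) ^ b - ∑ n ∈ Finset.range (N + 1), binC b n * y ^ n with hg
    set g' : ℂ → ℂ := fun y =>
      b * ((1 + y) ^ (b - 1) - ∑ n ∈ Finset.range N, binC (b - 1) n * y ^ n) with hg'
    have hd : ∀ y ∈ sector c, HasDerivAt g (g' y) y := fun y hy => by
      have h1 : HasDerivAt (fun y : ℂ => (1 + y) ^ b) (b * (1 + y) ^ (b - 1) * 1) y :=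
        ((hasDerivAt_id y).const_add 1).cpow_const (one_add_mem_slitPlane hc hy)
      have h2 : HasDerivAt (fun y : ℂ => ∑ n ∈ Finset.range (N + 1), binC b n * y ^ n)
          (∑ n ∈ Finset.range (N + 1), binC b n * (n * y ^ (n - 1))) y :=
        HasDerivAt.fun_sum fun n _ => (hasDerivAt_pow n y).const_mul (binC b n)
      refine (h1.sub h2).congr_deriv ?_
      rw [Finset.sum_range_succ']
      simp only [hg']
      rw [mul_sub, Finset.mul_sum]
      simp only [mul_one, Nat.cast_zero, zero_mul, mul_zero, add_zero, Nat.add_sub_cancel]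
      congr 1
      refine Finset.sum_congr rfl fun n _ => ?_
      have : ((n : ℂ) + 1) ≠ 0 := by exact_mod_cast Nat.succ_ne_zero n
      rw [binC]
      push_cast
      field_simp
    have hseg : ∀ s ∈ Set.Icc (0 : ℝ) 1, HasDerivWithinAt (fun s : ℝ => g (s * u))
        (g' (s * u) * u) (Set.Icc 0 1) s := fun s hs => by
      have h1 : HasDerivAt (fun s : ℂ => s * u) u (s : ℂ) := by
        simpa using (hasDerivAt_id (s : ℂ)).mul_const u
      have h2 := (hd _ (smul_mem_sector hs.1 hu)).comp (s : ℂ) h1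
      exact h2.comp_ofReal.hasDerivWithinAt
    have hbound : ∀ s ∈ Set.Ico (0 : ℝ) 1,
        ‖g' (s * u) * u‖ ≤ ‖b‖ * K * ‖u‖ ^ (N + 1) * (1 + ‖u‖) ^ L := fun s hs => by
      have h1 := h _ (smul_mem_sector hs.1 hu)
      have h2 : ‖(s : ℂ) * u‖ ≤ ‖u‖ := by
        rw [norm_mul, Complex.norm_real, Real.norm_of_nonneg hs.1]
        nlinarith [norm_nonneg u, hs.2]
      rw [hg']
      simp only [norm_mul b, norm_mul _ u]
      calc _ ≤ ‖b‖ * (K * ‖(s : ℂ) * u‖ ^ N * (1 + ‖(s : ℂ) * u‖) ^ L) * ‖u‖ := by gcongr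
        _ ≤ ‖b‖ * (K * ‖u‖ ^ N * (1 + ‖u‖) ^ L) * ‖u‖ := by gcongr
        _ = _ := by ring
    have := norm_image_sub_le_of_norm_deriv_le_segment_01' hseg hbound
    have h0 : g 0 = 0 := by
      simp only [hg]
      rw [Finset.sum_range_succ']
      simp [binC]
    simpa [h0] using this

/-! ### Laplace integrals -/

/-- The integrand of `lap`. -/
noncomputable def lapKer (ρ b e u : ℂ) (σ : ℝ) : ℂ :=
  exp (-(ρ * σ)) * (σ : ℂ) ^ b * (1 + σ * u) ^ e

/-- `∫ exp (-ρ σ) σ ^ b (1 + σ u) ^ e` over the positive half line. -/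
noncomputable def lap (ρ b e u : ℂ) : ℂ := ∫ σ in Set.Ioi (0 : ℝ), lapKer ρ b e u σ

theorem integrableOn_exp_mul_rpow {r : ℝ} (hr : 0 < r) (L : ℕ) : ∀ {s : ℝ}, -1 < s →
    IntegrableOn (fun σ : ℝ => Real.exp (-(r * σ)) * σ ^ s * (1 + σ) ^ L) (Set.Ioi 0) := by
  induction L with
  | zero =>
    intro s hs
    refine (integrableOn_rpow_mul_exp_neg_mul_rpow hs zero_lt_one hr).congr_fun
      (fun σ _ => ?_) measurableSet_Ioi
    simp only [Real.rpow_one, pow_zero, mul_one]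
    rw [mul_comm, neg_mul]
  | succ L ih =>
    intro s hs
    refine ((ih hs).add (ih (s := s + 1) (by linarith))).congr_fun (fun σ hσ => ?_)
      measurableSet_Ioi
    simp only [Pi.add_apply]
    rw [Real.rpow_add_one (ne_of_gt hσ), pow_succ]
    ring

theorem continuousOn_lapKer (ρ b e : ℂ) {c : ℝ} (hc : 0 < c) {u : ℂ} (hu : u ∈ sector c) :
    ContinuousOn (lapKer ρ b e u) (Set.Ioi 0) := by
  intro σ hσ
  refine ContinuousAt.continuousWithinAt ?_
  refine ContinuousAt.mul (ContinuousAt.mul (by fun_prop) ?_) ?_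
  · exact continuousAt_ofReal_cpow_const _ _ (Or.inr (ne_of_gt hσ))
  · refine ContinuousAt.cpow (by fun_prop) continuousAt_const ?_
    exact one_add_mem_slitPlane hc (smul_mem_sector (le_of_lt hσ) hu)

theorem norm_exp_mul_cpow (ρ b : ℂ) {σ : ℝ} (hσ : 0 < σ) :
    ‖exp (-(ρ * σ)) * (σ : ℂ) ^ b‖ = Real.exp (-(ρ.re * σ)) * σ ^ b.re := by
  rw [norm_mul, norm_exp, norm_cpow_eq_rpow_re_of_pos hσ]
  simp

theorem exists_norm_lapKer_le (ρ b e : ℂ) {c : ℝ} (hc : 0 < c) (hc1 : c ≤ 1) (R : ℝ) :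
    ∃ K : ℝ, ∃ L : ℕ, ∀ u ∈ sector c, ‖u‖ ≤ R → ∀ σ : ℝ, 0 < σ →
      ‖lapKer ρ b e u σ‖ ≤ K * (Real.exp (-(ρ.re * σ)) * σ ^ b.re * (1 + σ) ^ L) := by
  obtain ⟨K, hK, L, h⟩ := exists_norm_one_add_cpow_le hc hc1 e
  refine ⟨K * (1 + R) ^ L, L, fun u hu hR σ hσ => ?_⟩
  rw [lapKer, norm_mul, norm_exp_mul_cpow ρ b hσ]
  have h1 := h _ (smul_mem_sector hσ.le hu)
  have h2 : 1 + ‖(σ : ℂ) * u‖ ≤ (1 + R) * (1 + σ) := by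
    rw [norm_mul, Complex.norm_real, Real.norm_of_nonneg hσ.le]
    nlinarith [norm_nonneg u]
  calc _ ≤ Real.exp (-(ρ.re * σ)) * σ ^ b.re * (K * (1 + ‖(σ : ℂ) * u‖) ^ L) := by gcongr
    _ ≤ Real.exp (-(ρ.re * σ)) * σ ^ b.re * (K * ((1 + R) * (1 + σ)) ^ L) := by gcongr
    _ = _ := by rw [mul_pow]; ring

theorem integrableOn_lapKer {ρ b : ℂ} (hρ : 0 < ρ.re) (hb : -1 < b.re) (e : ℂ) {c : ℝ}
    (hc : 0 < c) (hc1 : c ≤ 1) {u : ℂ} (hu : u ∈ sector c) :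
    IntegrableOn (lapKer ρ b e u) (Set.Ioi 0) := by
  obtain ⟨K, L, h⟩ := exists_norm_lapKer_le ρ b e hc hc1 ‖u‖
  refine Integrable.mono' ((integrableOn_exp_mul_rpow hρ L hb).const_mul K)
    ((continuousOn_lapKer ρ b e hc hu).aestronglyMeasurable measurableSet_Ioi) ?_
  exact (ae_restrict_iff' measurableSet_Ioi).2 (ae_of_all _ fun σ hσ => h u hu le_rfl σ hσ)

theorem hasDerivAt_lap {ρ b : ℂ} (hρ : 0 < ρ.re) (hb : -1 < b.re) (e : ℂ) {u : ℂ}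
    (hu : u ∈ slitPlane) :
    HasDerivAt (lap ρ b e) (e * lap ρ (b + 1) (e - 1) u) u := by
  obtain ⟨c, hc, hc1, hcu⟩ := exists_sector_mem_nhds hu
  obtain ⟨K, L, h⟩ := exists_norm_lapKer_le ρ (b + 1) (e - 1) hc hc1 (‖u‖ + 1)
  have hb1 : -1 < (b + 1).re := by simp; linarith
  have hs : sector c ∩ Metric.closedBall 0 (‖u‖ + 1) ∈ 𝓝 u := by
    refine inter_mem hcu ?_
    refine mem_of_superset (Metric.isOpen_ball.mem_nhds (x := u) (?_ : u ∈ Metric.ball 0 (‖u‖ + 1)))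
      Metric.ball_subset_closedBall
    simp
  have key := hasDerivAt_integral_of_dominated_loc_of_deriv_le
    (μ := volume.restrict (Set.Ioi (0 : ℝ))) (F := lapKer ρ b e)
    (F' := fun u σ => e * lapKer ρ (b + 1) (e - 1) u σ)
    (bound := fun σ => ‖e‖ * (K * (Real.exp (-(ρ.re * σ)) * σ ^ (b + 1).re * (1 + σ) ^ L))) hs
    ?_ (integrableOn_lapKer hρ hb e hc hc1 (mem_of_mem_nhds hcu)) ?_ ?_ ?_ ?_
  · have := key.2
    rw [integral_const_mul] at this
    exact this
  · filter_upwards [hcu] with v hv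
    exact (continuousOn_lapKer ρ b e hc hv).aestronglyMeasurable measurableSet_Ioi
  · exact ((continuousOn_lapKer ρ _ _ hc (mem_of_mem_nhds hcu)).aestronglyMeasurable
      measurableSet_Ioi).const_mul e
  · refine (ae_restrict_iff' measurableSet_Ioi).2 (ae_of_all _ fun σ hσ v hv => ?_)
    rw [norm_mul]
    exact mul_le_mul_of_nonneg_left (h v hv.1 (by simpa using hv.2) σ hσ) (norm_nonneg _)
  · exact ((integrableOn_exp_mul_rpow hρ L hb1).const_mul K).const_mul ‖e‖
  · refine (ae_restrict_iff' measurableSet_Ioi).2 (ae_of_all _ fun σ hσ v hv => ?_)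
    have h1 : HasDerivAt (fun v : ℂ => 1 + σ * v) (σ : ℂ) v := by
      simpa using ((hasDerivAt_id v).const_mul (σ : ℂ)).const_add 1
    have h2 := (h1.cpow_const (c := e)
      (one_add_mem_slitPlane hc (smul_mem_sector (le_of_lt hσ) hv.1))).const_mul
      (exp (-(ρ * σ)) * (σ : ℂ) ^ b)
    refine h2.congr_deriv ?_
    have hσ0 : (σ : ℂ) ≠ 0 := ofReal_ne_zero.2 (ne_of_gt hσ)
    rw [lapKer, cpow_add b 1 hσ0, cpow_one]
    ring

/-! ### Relations between Laplace integrals, and their moments. -/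

theorem lap_contiguous {ρ b : ℂ} (hρ : 0 < ρ.re) (hb : -1 < b.re) (e : ℂ) {c : ℝ}
    (hc : 0 < c) (hc1 : c ≤ 1) {u : ℂ} (hu : u ∈ sector c) :
    lap ρ b (e + 1) u = lap ρ b e u + u * lap ρ (b + 1) e u := by
  have hb1 : -1 < (b + 1).re := by simp; linarith
  rw [lap, lap, lap, ← integral_const_mul, ← integral_add
    (integrableOn_lapKer hρ hb e hc hc1 hu)
    ((integrableOn_lapKer hρ hb1 e hc hc1 hu).const_mul u)]
  refine setIntegral_congr_fun measurableSet_Ioi fun σ hσ => ?_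
  have hσ0 : (σ : ℂ) ≠ 0 := ofReal_ne_zero.2 (ne_of_gt hσ)
  have h1 : 1 + (σ : ℂ) * u ≠ 0 :=
    slitPlane_ne_zero (one_add_mem_slitPlane hc (smul_mem_sector (le_of_lt hσ) hu))
  simp only [lapKer]
  rw [cpow_add b 1 hσ0, cpow_one, cpow_add e 1 h1, cpow_one]
  ring

/-- The integrand is the derivative of `lapKer ρ (b + 1) e u`. This function vanishes at `0` because
`0 < Re (b + 1)`, and at infinity because it and its derivative are integrable. -/
theorem lap_integral_by_parts {ρ b : ℂ} (hρ : 0 < ρ.re) (hb : -1 < b.re) (e : ℂ) {c : ℝ}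
    (hc : 0 < c) (hc1 : c ≤ 1) {u : ℂ} (hu : u ∈ sector c) :
    -ρ * lap ρ (b + 1) e u + (b + 1) * lap ρ b e u + e * u * lap ρ (b + 1) (e - 1) u = 0 := by
  have hb1 : -1 < (b + 1).re := by simp; linarith
  have i1 := (integrableOn_lapKer hρ hb1 e hc hc1 hu)
  have i2 := (integrableOn_lapKer hρ hb e hc hc1 hu)
  have i3 := (integrableOn_lapKer hρ hb1 (e - 1) hc hc1 hu)
  set F' : ℝ → ℂ := fun σ => -ρ * lapKer ρ (b + 1) e u σ + (b + 1) * lapKer ρ b e u σ +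
    e * u * lapKer ρ (b + 1) (e - 1) u σ with hF'
  have hint : IntegrableOn F' (Set.Ioi 0) :=
    ((i1.const_mul (-ρ)).add (i2.const_mul (b + 1))).add (i3.const_mul (e * u))
  have hder : ∀ σ ∈ Set.Ioi (0 : ℝ), HasDerivAt (lapKer ρ (b + 1) e u) (F' σ) σ := by
    intro σ hσ
    have hσ0 : (σ : ℂ) ≠ 0 := ofReal_ne_zero.2 (ne_of_gt hσ)
    have hb10 : b + 1 ≠ 0 := fun h => by
      have := congrArg re h
      simp at this
      linarith
    have h1 : HasDerivAt (fun s : ℂ => exp (-(ρ * s))) (-ρ * exp (-(ρ * σ))) (σ : ℂ) := by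
      have := ((hasDerivAt_id (σ : ℂ)).const_mul ρ).neg.cexp
      simp only [id_eq, mul_one, Pi.neg_apply] at this
      exact this.congr_deriv (by ring)
    have h2 : HasDerivAt (fun s : ℂ => s ^ (b + 1)) ((b + 1) * (σ : ℂ) ^ (b + 1 - 1) * 1)
        (σ : ℂ) :=
      (hasDerivAt_id (σ : ℂ)).cpow_const (ofReal_mem_slitPlane.2 hσ)
    have h3 : HasDerivAt (fun s : ℂ => (1 + s * u) ^ e) (e * (1 + (σ : ℂ) * u) ^ (e - 1) * u)
        (σ : ℂ) := by
      have h4 : HasDerivAt (fun s : ℂ => 1 + s * u) u (σ : ℂ) := by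
        simpa using ((hasDerivAt_id (σ : ℂ)).mul_const u).const_add 1
      exact h4.cpow_const (one_add_mem_slitPlane hc (smul_mem_sector (le_of_lt hσ) hu))
    refine ((h1.mul h2).mul h3).comp_ofReal.congr_deriv ?_
    simp only [hF', lapKer, Pi.mul_apply, add_sub_cancel_right]
    ring
  have hcont : ContinuousWithinAt (lapKer ρ (b + 1) e u) (Set.Ici 0) 0 := by
    refine ContinuousAt.continuousWithinAt ?_
    refine ContinuousAt.mul (ContinuousAt.mul (by fun_prop) ?_) ?_
    · exact continuousAt_ofReal_cpow_const _ _ (Or.inl (by simp; linarith))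
    · refine ContinuousAt.cpow (by fun_prop) continuousAt_const ?_
      exact one_add_mem_slitPlane hc (smul_mem_sector le_rfl hu)
  have h0 : lapKer ρ (b + 1) e u 0 = 0 := by
    rw [lapKer, ofReal_zero, zero_cpow]
    · simp
    · intro h
      have := congrArg re h
      simp at this
      linarith
  have key := integral_Ioi_of_hasDerivAt_of_tendsto hcont hder hint
    (tendsto_zero_of_hasDerivAt_of_integrableOn_Ioi hder hint i1)
  rw [h0, sub_zero] at key
  have i12 : IntegrableOn (fun σ => -ρ * lapKer ρ (b + 1) e u σ + (b + 1) * lapKer ρ b e u σ)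
      (Set.Ioi 0) := (i1.const_mul (-ρ)).add (i2.const_mul (b + 1))
  rw [lap, lap, lap, ← key, hF', ← integral_const_mul, ← integral_const_mul, ← integral_const_mul,
    ← integral_add (i1.const_mul (-ρ)) (i2.const_mul (b + 1)),
    ← integral_add i12 (i3.const_mul (e * u))]

/-- The moments of `exp (-ρ σ) σ ^ b`. -/
noncomputable def moment (ρ b : ℂ) : ℂ := lap ρ b 0 0

theorem zero_mem_sector (c : ℝ) : (0 : ℂ) ∈ sector c := by simp [mem_sector]

theorem moment_add_one {ρ b : ℂ} (hρ : 0 < ρ.re) (hb : -1 < b.re) :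
    moment ρ (b + 1) = (b + 1) / ρ * moment ρ b := by
  have := lap_integral_by_parts hρ hb 0 zero_lt_one le_rfl (zero_mem_sector 1)
  have h0 : ρ ≠ 0 := fun h => by simp [h] at hρ
  rw [moment, moment]
  field_simp
  linear_combination -this

theorem moment_one {b : ℂ} (hb : -1 < b.re) : moment 1 b = Gamma (b + 1) := by
  rw [Gamma_eq_integral (by simp; linarith), GammaIntegral, moment, lap]
  refine setIntegral_congr_fun measurableSet_Ioi fun σ _ => ?_
  simp [lapKer]

theorem hasDerivAt_moment {ρ b : ℂ} (hρ : 0 < ρ.re) (hb : -1 < b.re) :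
    HasDerivAt (fun ρ => moment ρ b) (-moment ρ (b + 1)) ρ := by
  have hb1 : -1 < (b + 1).re := by simp; linarith
  have hs : {z : ℂ | ρ.re / 2 < z.re} ∈ 𝓝 ρ :=
    (isOpen_lt continuous_const Complex.continuous_re).mem_nhds (by
      change ρ.re / 2 < ρ.re
      linarith)
  have h1 := zero_mem_sector 1
  have key := hasDerivAt_integral_of_dominated_loc_of_deriv_le
    (μ := volume.restrict (Set.Ioi (0 : ℝ))) (F := fun ρ => lapKer ρ b 0 0)
    (F' := fun ρ σ => -lapKer ρ (b + 1) 0 0 σ)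
    (bound := fun σ => Real.exp (-(ρ.re / 2 * σ)) * σ ^ (b + 1).re * (1 + σ) ^ 0) hs
    (Eventually.of_forall fun z => (continuousOn_lapKer z b 0 one_pos h1).aestronglyMeasurable
      measurableSet_Ioi) (integrableOn_lapKer hρ hb 0 one_pos le_rfl h1)
    ((continuousOn_lapKer ρ (b + 1) 0 one_pos h1).aestronglyMeasurable measurableSet_Ioi).neg
    ?_ (integrableOn_exp_mul_rpow (by positivity) 0 hb1) ?_
  · have := key.2
    rw [integral_neg] at this
    exact this
  · refine (ae_restrict_iff' measurableSet_Ioi).2 (ae_of_all _ fun σ hσ z hz => ?_)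
    have hσ' : (0 : ℝ) < σ := hσ
    have hz' : ρ.re / 2 < z.re := hz
    rw [norm_neg, lapKer, cpow_zero, mul_one, norm_exp_mul_cpow _ _ hσ', pow_zero, mul_one]
    gcongr
  · refine (ae_restrict_iff' measurableSet_Ioi).2 (ae_of_all _ fun σ hσ z _ => ?_)
    have hσ0 : (σ : ℂ) ≠ 0 := ofReal_ne_zero.2 (ne_of_gt hσ)
    have h2 : HasDerivAt (fun z : ℂ => exp (-(z * σ))) (-σ * exp (-(z * σ))) z := by
      have := ((hasDerivAt_id z).mul_const (σ : ℂ)).neg.cexp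
      simp only [id_eq, one_mul, Pi.neg_apply] at this
      exact this.congr_deriv (by ring)
    refine ((h2.mul_const _).mul_const _).congr_deriv ?_
    rw [lapKer, cpow_add b 1 hσ0, cpow_one]
    ring

/-- The recursion for the moments makes the left side a function of `ρ` with zero derivative on the
right half plane. It therefore equals its value at `ρ = 1`, the Gamma integral. This replaces a
rotation of the contour. -/
theorem moment_mul_cpow {ρ b : ℂ} (hρ : 0 < ρ.re) (hb : -1 < b.re) :
    moment ρ b * ρ ^ (b + 1) = Gamma (b + 1) := by
  have hopen : IsOpen {z : ℂ | 0 < z.re} := isOpen_lt continuous_const Complex.continuous_re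
  have hd : ∀ z ∈ {z : ℂ | 0 < z.re},
      HasDerivAt (fun z => moment z b * z ^ (b + 1)) 0 z := fun z hz => by
    have hz' : 0 < z.re := hz
    have hz0 : z ≠ 0 := fun h => by simp [h] at hz'
    have h1 := (hasDerivAt_id z).cpow_const (c := b + 1) (Or.inl hz')
    refine ((hasDerivAt_moment hz' hb).mul h1).congr_deriv ?_
    simp only [id_eq, add_sub_cancel_right, mul_one]
    rw [moment_add_one hz' hb, cpow_add _ _ hz0, cpow_one]
    field_simp
    ring
  have key := hopen.is_const_of_deriv_eq_zero (convex_halfSpace_re_gt 0).isPreconnected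
    (fun z hz => (hd z hz).differentiableAt.differentiableWithinAt)
    (fun z hz => (hd z hz).deriv) (x := ρ) (y := 1) hρ (by simp)
  simpa [moment_one hb] using key

theorem moment_ne_zero {ρ b : ℂ} (hρ : 0 < ρ.re) (hb : -1 < b.re) : moment ρ b ≠ 0 := fun h => by
  have := moment_mul_cpow hρ hb
  rw [h, zero_mul] at this
  exact Gamma_ne_zero_of_re_pos (by simp; linarith) this.symm

/-- The asymptotic expansion of `lap` at `u = 0`. -/
theorem exists_norm_lap_sub_le {ρ b : ℂ} (hρ : 0 < ρ.re) (hb : -1 < b.re) (e : ℂ) {c : ℝ}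
    (hc : 0 < c) (hc1 : c ≤ 1) (N : ℕ) : ∃ K : ℝ, ∀ u ∈ sector c, ‖u‖ ≤ 1 →
      ‖lap ρ b e u - ∑ n ∈ Finset.range N, binC e n * moment ρ (b + n) * u ^ n‖
        ≤ K * ‖u‖ ^ N := by
  obtain ⟨K, hK, L, h⟩ := exists_norm_one_add_cpow_sub_le hc hc1 N e
  have hbn : ∀ n : ℕ, -1 < (b + n).re := fun n => by
    simp only [add_re, natCast_re]
    linarith [Nat.cast_nonneg (α := ℝ) n]
  have hint := integrableOn_exp_mul_rpow hρ L (hbn N)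
  refine ⟨K * ∫ σ in Set.Ioi (0 : ℝ), Real.exp (-(ρ.re * σ)) * σ ^ (b + N).re * (1 + σ) ^ L,
    fun u hu hu1 => ?_⟩
  have i1 := integrableOn_lapKer hρ hb e hc hc1 hu
  have i2 : ∀ n : ℕ, IntegrableOn (lapKer ρ (b + n) 0 0) (Set.Ioi 0) := fun n =>
    integrableOn_lapKer hρ (hbn n) 0 hc hc1 (zero_mem_sector c)
  have hsum : lap ρ b e u - ∑ n ∈ Finset.range N, binC e n * moment ρ (b + n) * u ^ n
      = ∫ σ in Set.Ioi (0 : ℝ), (lapKer ρ b e u σ -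
        ∑ n ∈ Finset.range N, binC e n * u ^ n * lapKer ρ (b + n) 0 0 σ) := by
    rw [integral_sub i1 (integrable_finsetSum _ fun n _ => (i2 n).const_mul _),
      integral_finsetSum _ fun n _ => (i2 n).const_mul _]
    simp only [integral_const_mul, lap, moment]
    congr 1
    refine Finset.sum_congr rfl fun n _ => by ring
  rw [hsum, mul_right_comm, ← integral_const_mul]
  refine norm_integral_le_of_norm_le (hint.const_mul _) ?_
  refine (ae_restrict_iff' measurableSet_Ioi).2 (ae_of_all _ fun σ hσ => ?_)
  have hσ' : (0 : ℝ) < σ := hσ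
  have hσ0 : (σ : ℂ) ≠ 0 := ofReal_ne_zero.2 (ne_of_gt hσ')
  have h1 : lapKer ρ b e u σ - ∑ n ∈ Finset.range N, binC e n * u ^ n * lapKer ρ (b + n) 0 0 σ
      = (exp (-(ρ * σ)) * (σ : ℂ) ^ b) * ((1 + σ * u) ^ e -
        ∑ n ∈ Finset.range N, binC e n * (σ * u) ^ n) := by
    rw [mul_sub, Finset.mul_sum, lapKer]
    congr 1
    refine Finset.sum_congr rfl fun n _ => ?_
    rw [lapKer, cpow_add _ _ hσ0, cpow_natCast, cpow_zero, mul_pow]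
    ring
  rw [h1, norm_mul, norm_exp_mul_cpow ρ b hσ']
  have h2 := h _ (smul_mem_sector hσ'.le hu)
  have h3 : ‖(σ : ℂ) * u‖ = σ * ‖u‖ := by
    rw [norm_mul, Complex.norm_real, Real.norm_of_nonneg hσ'.le]
  rw [h3] at h2
  have h4 : σ ^ (b + N).re = σ ^ b.re * σ ^ N := by
    simp only [add_re, natCast_re]
    rw [Real.rpow_add hσ', Real.rpow_natCast]
  calc _ ≤ Real.exp (-(ρ.re * σ)) * σ ^ b.re * (K * (σ * ‖u‖) ^ N * (1 + σ * ‖u‖) ^ L) := by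
        gcongr
    _ ≤ Real.exp (-(ρ.re * σ)) * σ ^ b.re * (K * (σ * ‖u‖) ^ N * (1 + σ * 1) ^ L) := by
        gcongr
    _ = _ := by rw [h4, mul_pow]; ring

end StokesSibuya

namespace StokesSibuya

open Complex Filter Topology MeasureTheory

/-! ### The solution that is subdominant at infinity -/

theorem exp_mem_sector {θ : ℝ} (hθ : θ ≤ Real.pi) {z : ℂ} (hz : |z.im| ≤ θ) :
    exp z ∈ sector (Real.cos (θ / 2)) := by
  have h1 : 2 * Real.cos (θ / 2) ^ 2 - 1 = Real.cos θ := by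
    rw [← Real.cos_two_mul]; congr 1; ring
  rw [mem_sector, h1, norm_exp, exp_re, mul_comm, ← Real.cos_abs z.im]
  exact mul_le_mul_of_nonneg_left (Real.cos_le_cos_of_nonneg_of_le_pi (abs_nonneg _) hθ hz)
    (Real.exp_pos _).le

theorem cos_half_pos {θ : ℝ} (h0 : 0 ≤ θ) (hθ : θ < Real.pi) : 0 < Real.cos (θ / 2) :=
  Real.cos_pos_of_mem_Ioo ⟨by linarith [Real.pi_pos], by linarith⟩

theorem mem_slitPlane_of_mem_sector {c : ℝ} (hc : 0 < c) {u : ℂ} (hu : u ∈ sector c)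
    (h0 : u ≠ 0) : u ∈ slitPlane := by
  rw [mem_sector] at hu
  rw [mem_slitPlane_iff]
  by_contra! h
  have h1 : ‖u‖ = -u.re := by
    have : u = (u.re : ℂ) := by apply Complex.ext <;> simp [h.2]
    rw [this, Complex.norm_real, Real.norm_eq_abs, abs_of_nonpos (by linarith), ofReal_re]
  have h2 : 0 < ‖u‖ := norm_pos_iff.2 h0
  rw [h1] at hu h2
  nlinarith [sq_pos_of_pos hc]

/-- The variable `ρ / (2 z)` at `z = exp w`. -/
noncomputable def lapVar (ρ w : ℂ) : ℂ := ρ * exp (-w) / 2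

theorem lapVar_mem_sector {φ θ : ℝ} (hθ : θ ≤ Real.pi) {w : ℂ} (hw : |w.im - φ| ≤ θ) :
    lapVar (exp (φ * I)) w ∈ sector (Real.cos (θ / 2)) := by
  have : lapVar (exp (φ * I)) w = ((1 / 2 : ℝ) : ℂ) * exp (φ * I - w) := by
    rw [lapVar, sub_eq_add_neg, exp_add]; push_cast; ring
  rw [this]
  refine smul_mem_sector (by norm_num) (exp_mem_sector hθ ?_)
  simpa [abs_sub_comm] using hw

theorem lapVar_mem_slitPlane {φ : ℝ} {w : ℂ} (hw : |w.im - φ| < Real.pi) :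
    lapVar (exp (φ * I)) w ∈ slitPlane := by
  refine mem_slitPlane_of_mem_sector (cos_half_pos (abs_nonneg _) hw)
    (lapVar_mem_sector hw.le le_rfl) ?_
  simp [lapVar]

/-- The subdominant solution on a strip, as a Laplace integral. -/
noncomputable def locSol (ν ρ w : ℂ) : ℂ :=
  exp (-w / 2 - exp w) * (lap ρ (ν - 1 / 2) (ν - 1 / 2) (lapVar ρ w) / moment ρ (ν - 1 / 2))

/-- The derivative of `locSol ν ρ`. -/
noncomputable def locSol' (ν ρ w : ℂ) : ℂ :=
  exp (-w / 2 - exp w) * (((-1 / 2 - exp w) * lap ρ (ν - 1 / 2) (ν - 1 / 2) (lapVar ρ w) -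
    lapVar ρ w * ((ν - 1 / 2) * lap ρ (ν - 1 / 2 + 1) (ν - 1 / 2 - 1) (lapVar ρ w))) /
      moment ρ (ν - 1 / 2))

theorem hasDerivAt_lapVar (ρ w : ℂ) : HasDerivAt (lapVar ρ) (-lapVar ρ w) w := by
  have := (((hasDerivAt_neg w).cexp).const_mul ρ).div_const 2
  refine this.congr_deriv ?_
  rw [lapVar]
  ring

/-- With `L = lap ρ a a`, this is `u ^ 2 L'' + (2 u + ρ) L' - a (a + 1) L = 0`, since each
derivative of `L` raises the first exponent and lowers the second. It follows from one integration
by parts and two contiguity relations. -/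
theorem lap_ode {ρ a : ℂ} (hρ : 0 < ρ.re) (ha : -1 < a.re) {u : ℂ} (hu : u ∈ slitPlane) :
    u ^ 2 * (a * ((a - 1) * lap ρ (a + 1 + 1) (a - 1 - 1) u)) +
      (2 * u + ρ) * (a * lap ρ (a + 1) (a - 1) u) - a * (a + 1) * lap ρ a a u = 0 := by
  obtain ⟨c, hc, hc1, hcu⟩ := exists_sector_mem_nhds hu
  have hu' := mem_of_mem_nhds hcu
  have ha1 : -1 < (a + 1).re := by simp; linarith
  have h1 := lap_integral_by_parts hρ ha (a - 1) hc hc1 hu'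
  have h2 := lap_contiguous hρ ha (a - 1) hc hc1 hu'
  have h3 := lap_contiguous hρ ha1 (a - 1 - 1) hc hc1 hu'
  rw [sub_add_cancel] at h2 h3
  rw [h2]
  linear_combination -a * h1 - u * a * (a - 1) * h3

/-- The three conditions keep the integral well defined: `0 ≤ Re ν` gives integrability at `σ = 0`,
`|φ| < π / 2` gives `0 < Re ρ`, and `|Im w - φ| < π` keeps `lapVar` off the negative real axis.
Since `2 exp w * lapVar ρ w = ρ`, the Bessel equation becomes `lap_ode`. -/
theorem solvesOn_locSol {ν : ℂ} (hν : 0 ≤ ν.re) {φ : ℝ} (hφ : |φ| < Real.pi / 2) :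
    SolvesOn (besselPot ν) {w | |w.im - φ| < Real.pi} (locSol ν (exp (φ * I)))
      (locSol' ν (exp (φ * I))) := by
  intro w hw
  have hw' : |w.im - φ| < Real.pi := hw
  set ρ := exp (φ * I) with hρdef
  have hρ : 0 < ρ.re := by
    rw [hρdef, exp_ofReal_mul_I_re]
    exact Real.cos_pos_of_mem_Ioo ⟨by linarith [neg_abs_le φ], by linarith [le_abs_self φ]⟩
  set a := ν - 1 / 2 with ha
  have ha0 : -1 < a.re := by simp [ha]; linarith
  have ha1 : -1 < (a + 1).re := by simp; linarith
  have hu := lapVar_mem_slitPlane hw'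
  rw [← hρdef] at hu
  have hode := lap_ode hρ ha0 hu
  have d0 := hasDerivAt_lapVar ρ w
  have d1 := (hasDerivAt_lap hρ ha0 a hu).comp w d0
  have d2 := (hasDerivAt_lap hρ ha1 (a - 1) hu).comp w d0
  have d3 : HasDerivAt (fun w : ℂ => exp (-w / 2 - exp w))
      (exp (-w / 2 - exp w) * (-1 / 2 - exp w)) w :=
    (((hasDerivAt_neg w).div_const 2).sub (hasDerivAt_exp w)).cexp
  have d4 : HasDerivAt (fun w : ℂ => -1 / 2 - exp w) (-exp w) w := by
    simpa using (hasDerivAt_exp w).const_sub (-1 / 2)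
  have hu2 : 2 * exp w * lapVar ρ w = ρ := by
    rw [lapVar, exp_neg]
    field_simp
  have he : exp (2 * w) = exp w ^ 2 := by rw [sq, ← exp_add]; congr 1; ring
  constructor
  · refine (d3.mul (d1.div_const _)).congr_deriv ?_
    simp only [locSol', Function.comp_apply, ← ha]
    ring
  · refine (d3.mul (((d4.mul d1).sub (d0.mul (d2.const_mul a))).div_const _)).congr_deriv ?_
    simp only [locSol, Function.comp_apply, Pi.mul_apply, Pi.sub_apply, besselPot, ← ha]
    rw [he, show ν = a + 1 / 2 by rw [ha]; ring]
    linear_combination exp (-w / 2 - exp w) / moment ρ a * (hode +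
      a * lap ρ (a + 1) (a - 1) (lapVar ρ w) * hu2)

/-- The coefficients of the asymptotic expansion of the subdominant solution. -/
noncomputable def asympCoeff (ν : ℂ) (n : ℕ) : ℂ :=
  binC (ν - 1 / 2) n * (∏ k ∈ Finset.range n, (ν - 1 / 2 + k + 1)) / 2 ^ n

theorem asympCoeff_zero (ν : ℂ) : asympCoeff ν 0 = 1 := by simp [asympCoeff, binC]

/-- The right side does not involve `ρ` beyond the factor `moment ρ b`. Hence the asymptotic
coefficients of `locSol` do not depend on the direction `φ`. -/
theorem moment_add_nat {ρ b : ℂ} (hρ : 0 < ρ.re) (hb : -1 < b.re) (n : ℕ) :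
    moment ρ (b + n) * ρ ^ n = (∏ k ∈ Finset.range n, (b + k + 1)) * moment ρ b := by
  have h0 : ρ ≠ 0 := fun h => by simp [h] at hρ
  induction n with
  | zero => simp
  | succ n ih =>
    have hbn : -1 < (b + n).re := by
      simp only [add_re, natCast_re]
      linarith [Nat.cast_nonneg (α := ℝ) n]
    rw [Finset.prod_range_succ, Nat.cast_succ, ← add_assoc, moment_add_one hρ hbn, pow_succ]
    field_simp
    linear_combination (b + n + 1) * ih

theorem exists_norm_locSol_sub_le {ν : ℂ} (hν : 0 ≤ ν.re) {φ : ℝ} (hφ : |φ| < Real.pi / 2)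
    {θ : ℝ} (h0 : 0 ≤ θ) (hθ : θ < Real.pi) (N : ℕ) : ∃ K : ℝ, ∀ w : ℂ, |w.im - φ| ≤ θ →
      0 ≤ w.re → ‖locSol ν (exp (φ * I)) w * exp (w / 2 + exp w) -
        ∑ n ∈ Finset.range N, asympCoeff ν n * exp (-(n * w))‖ ≤ K * Real.exp (-(N * w.re)) := by
  set ρ := exp (φ * I) with hρdef
  have hρ : 0 < ρ.re := by
    rw [hρdef, exp_ofReal_mul_I_re]
    exact Real.cos_pos_of_mem_Ioo ⟨by linarith [neg_abs_le φ], by linarith [le_abs_self φ]⟩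
  have hρ1 : ‖ρ‖ = 1 := norm_exp_ofReal_mul_I φ
  set a := ν - 1 / 2 with ha
  have ha0 : -1 < a.re := by simp [ha]; linarith
  obtain ⟨K, hK⟩ := exists_norm_lap_sub_le hρ ha0 a (cos_half_pos h0 hθ) (Real.cos_le_one _) N
  have hM := moment_ne_zero hρ ha0
  refine ⟨K / ‖moment ρ a‖, fun w hw hre => ?_⟩
  have hu := lapVar_mem_sector hθ.le hw
  rw [← hρdef] at hu
  have hnorm : ‖lapVar ρ w‖ = Real.exp (-w.re) / 2 := by
    rw [lapVar, norm_div, norm_mul, hρ1, norm_exp]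
    simp
  have he1 : Real.exp (-w.re) ≤ 1 := Real.exp_le_one_iff.2 (by linarith)
  have h1 := hK _ hu (by rw [hnorm]; linarith)
  have h2 : locSol ν ρ w * exp (w / 2 + exp w) -
      ∑ n ∈ Finset.range N, asympCoeff ν n * exp (-(n * w)) =
      (lap ρ a a (lapVar ρ w) - ∑ n ∈ Finset.range N, binC a n * moment ρ (a + n) *
        lapVar ρ w ^ n) / moment ρ a := by
    rw [sub_div, Finset.sum_div]
    congr 1
    · rw [locSol, ← ha]
      have : exp (-w / 2 - exp w) * exp (w / 2 + exp w) = 1 := by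
        rw [← exp_add, show -w / 2 - exp w + (w / 2 + exp w) = 0 by ring, exp_zero]
      linear_combination lap ρ a a (lapVar ρ w) / moment ρ a * this
    · refine Finset.sum_congr rfl fun n _ => ?_
      have h3 := moment_add_nat hρ ha0 n
      have h5 : exp (-(n * w)) = exp (-w) ^ n := by rw [← exp_nat_mul]; congr 1; ring
      rw [asympCoeff, ← ha, lapVar, div_pow, mul_pow, eq_div_iff hM, h5]
      linear_combination -(binC a n / 2 ^ n * exp (-w) ^ n) * h3
  rw [h2, norm_div, div_mul_eq_mul_div]
  gcongr
  refine h1.trans ?_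
  have hK0 : 0 ≤ K := by
    by_contra! hneg
    have : 0 < ‖lapVar ρ w‖ ^ N := by rw [hnorm]; positivity
    nlinarith [norm_nonneg (lap ρ a a (lapVar ρ w) - ∑ n ∈ Finset.range N, binC a n *
      moment ρ (a + n) * lapVar ρ w ^ n)]
  have h4 : Real.exp (-(N * w.re)) = Real.exp (-w.re) ^ N := by
    rw [← Real.exp_nat_mul]; congr 1; ring
  rw [hnorm, h4]
  gcongr
  linarith [Real.exp_pos (-w.re)]

/-- Solutions that are subdominant on the positive real axis are determined by their leading
behaviour. -/
theorem IsBessel.eq_of_tendsto {ν : ℂ} {f f' g g' : ℂ → ℂ} (hf : IsBessel ν f f')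
    (hg : IsBessel ν g g')
    (hf1 : Tendsto (fun x : ℝ => f x * exp (x / 2 + exp x)) atTop (𝓝 1))
    (hg1 : Tendsto (fun x : ℝ => g x * exp (x / 2 + exp x)) atTop (𝓝 1)) : f = g := by
  set E : ℝ → ℂ := fun x => exp (x / 2 + exp x) with hE
  have hinv : Tendsto (fun x : ℝ => (((g x * E x) ^ 2)⁻¹).re) atTop (𝓝 1) := by
    have h1 := (hg1.pow 2).inv₀ (by norm_num)
    have h2 := (Complex.continuous_re.tendsto _).comp h1
    rw [one_pow, inv_one, one_re] at h2
    exact h2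
  have hev : ∀ᶠ x : ℝ in atTop, 1 / 2 < (((g x * E x) ^ 2)⁻¹).re :=
    hinv.eventually (lt_mem_nhds (by norm_num))
  obtain ⟨x₀, hx₀⟩ := eventually_atTop.1 (hev.and (eventually_ge_atTop 0))
  have hg0 : ∀ x : ℝ, x₀ ≤ x → g x ≠ 0 := fun x hx h => by
    have := (hx₀ x hx).1
    rw [h] at this
    norm_num at this
  set C := g x₀ * f' x₀ - g' x₀ * f x₀ with hC
  have hquot : Tendsto (fun x : ℝ => f x / g x) atTop (𝓝 1) := by
    have h1 := hf1.div hg1 one_ne_zero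
    rw [div_one] at h1
    refine h1.congr fun x => ?_
    rw [Pi.div_apply, mul_div_mul_right _ _ (exp_ne_zero _)]
  by_cases hC0 : C = 0
  · have h1 := hg.eq_mul_of_wronskian_eq_zero hf (hg0 x₀ le_rfl) hC0
    have h2 : Tendsto (fun x : ℝ => f x / g x) atTop (𝓝 (f x₀ / g x₀)) := by
      refine tendsto_const_nhds.congr' ?_
      filter_upwards [eventually_ge_atTop x₀] with x hx
      rw [h1 x, mul_div_assoc, div_self (hg0 x hx), mul_one]
    have h3 := tendsto_nhds_unique h2 hquot
    ext w
    rw [h1 w, h3, one_mul]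
  -- The derivative of `f / g / C` is `1 / g ^ 2`, whose real part is eventually at least `1 / 2`
  -- because `g` decays. So the real part of `f / g / C` would grow at least linearly, whereas `f /
  -- g` tends to `1`.
  · exfalso
    set k : ℝ → ℝ := fun x => (f x / g x / C).re with hk
    have hd : ∀ x : ℝ, x₀ ≤ x → HasDerivAt k ((1 / g x ^ 2 : ℂ).re) x := fun x hx => by
      have h1 := (((hf.hasDerivAt x).div (hg.hasDerivAt x) (hg0 x hx)).div_const C)
      refine (h1.congr_deriv ?_).real_of_complex
      have h2 := hg.wronskian_eq hf x x₀
      rw [← hC] at h2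
      have := hg0 x hx
      have h4 : f' x * g x - f x * g' x = g x * f' x - g' x * f x := by ring
      rw [h4, h2]
      field_simp
    have hd1 : ∀ x : ℝ, x₀ ≤ x → 1 / 2 ≤ ((1 / g x ^ 2 : ℂ).re) := fun x hx => by
      obtain ⟨h1, h2⟩ := hx₀ x hx
      have h3 : (1 / g x ^ 2 : ℂ) = ((Real.exp (x + 2 * Real.exp x) : ℝ) : ℂ) *
          ((g x * E x) ^ 2)⁻¹ := by
        have h4 : ((Real.exp (x + 2 * Real.exp x) : ℝ) : ℂ) = E x ^ 2 := by
          rw [hE, ← exp_nat_mul]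
          push_cast
          congr 1
          ring
        rw [h4, mul_pow, mul_inv]
        have h5 : E x ≠ 0 := exp_ne_zero _
        have h7 := hg0 x hx
        field_simp
      rw [h3, re_ofReal_mul]
      have h6 : 1 ≤ Real.exp (x + 2 * Real.exp x) := by
        apply Real.one_le_exp
        have := Real.exp_pos x
        linarith
      nlinarith
    have hlin : ∀ x : ℝ, x₀ ≤ x → 1 / 2 * (x - x₀) + k x₀ ≤ k x := fun x hx => by
      have h1 := (convex_Ici x₀).mul_sub_le_image_sub_of_le_deriv (f := k) (C := 1 / 2)
        (fun y hy => (hd y hy).continuousAt.continuousWithinAt)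
        (fun y hy => (hd y (interior_subset hy)).differentiableAt.differentiableWithinAt)
        (fun y hy => by
          rw [(hd y (interior_subset hy)).deriv]
          exact hd1 y (interior_subset hy)) x₀ Set.self_mem_Ici x hx hx
      linarith
    have h1 : Tendsto k atTop atTop := by
      refine tendsto_atTop_mono' atTop ((eventually_ge_atTop x₀).mono fun x hx => hlin x hx) ?_
      refine tendsto_atTop_add_const_right _ _ (Tendsto.const_mul_atTop (by norm_num) ?_)
      exact tendsto_atTop_add_const_right _ (-x₀) tendsto_id
    have h2 : Tendsto k atTop (𝓝 ((1 / C).re)) :=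
      (Complex.continuous_re.tendsto _).comp (hquot.div_const C)
    exact not_tendsto_nhds_of_tendsto_atTop h1 _ h2

/-- `f` has the asymptotic expansion of the subdominant solution. -/
def HasSubdominantExpansion (ν : ℂ) (f : ℂ → ℂ) : Prop :=
  ∀ θ : ℝ, θ < 3 * Real.pi / 2 → ∀ N : ℕ, ∃ K : ℝ, ∀ w : ℂ, |w.im| ≤ θ → 0 ≤ w.re →
    ‖f w * exp (w / 2 + exp w) - ∑ n ∈ Finset.range N, asympCoeff ν n * exp (-(n * w))‖
      ≤ K * Real.exp (-(N * w.re))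

theorem tendsto_one_of_norm_sub_le {F : ℝ → ℂ} {K : ℝ}
    (h : ∀ x : ℝ, 0 ≤ x → ‖F x - 1‖ ≤ K * Real.exp (-x)) : Tendsto F atTop (𝓝 1) := by
  rw [tendsto_iff_norm_sub_tendsto_zero]
  refine squeeze_zero' (Eventually.of_forall fun _ => norm_nonneg _)
    ((eventually_ge_atTop 0).mono fun x hx => h x hx) ?_
  simpa using (Real.tendsto_exp_neg_atTop_nhds_zero).const_mul K

/-- For every `|φ| < π / 2` the strip `|Im w - φ| < π` contains the positive real axis, where all
the local solutions have the same leading term. By `IsBessel.eq_of_tendsto` their entire extensions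
are equal, so the expansions obtained for different `φ` belong to one function. -/
theorem exists_subdominant {ν : ℂ} (hν : 0 ≤ ν.re) : ∃ f f' : ℂ → ℂ, IsBessel ν f f' ∧
    (∀ w : ℂ, |w.im| < Real.pi → f w = locSol ν 1 w ∧ f' w = locSol' ν 1 w) ∧
    HasSubdominantExpansion ν f := by
  have hext : ∀ φ : ℝ, |φ| < Real.pi / 2 → ∃ f f' : ℂ → ℂ, IsBessel ν f f' ∧
      (∀ w ∈ {w : ℂ | |w.im - φ| < Real.pi}, f w = locSol ν (exp (φ * I)) w) ∧
      ∀ w ∈ {w : ℂ | |w.im - φ| < Real.pi}, f' w = locSol' ν (exp (φ * I)) w := by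
    intro φ hφ
    have h1 := solvesOn_locSol hν hφ
    have hopen : IsOpen {w : ℂ | |w.im - φ| < Real.pi} := isOpen_lt (by fun_prop) continuous_const
    have hconv : Convex ℝ {w : ℂ | |w.im - φ| < Real.pi} := by
      have : {w : ℂ | |w.im - φ| < Real.pi} = Complex.imLm ⁻¹' Metric.ball φ Real.pi := by
        ext w
        simp [Real.dist_eq]
      rw [this]
      exact (convex_ball _ _).linear_preimage _
    rw [← powSum_besselPotCoeff] at h1
    have h2 := h1.exists_extension (entireCoeff_besselPot ν) hopen hconv
      ⟨φ * I, by simp [Real.pi_pos]⟩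
    simp only [powSum_besselPotCoeff] at h2
    exact h2
  have htend : ∀ φ : ℝ, |φ| < Real.pi / 2 → ∀ f : ℂ → ℂ,
      (∀ w ∈ {w : ℂ | |w.im - φ| < Real.pi}, f w = locSol ν (exp (φ * I)) w) →
      Tendsto (fun x : ℝ => f x * exp (x / 2 + exp x)) atTop (𝓝 1) := by
    intro φ hφ f hf
    have hπ := Real.pi_pos
    obtain ⟨K, hK⟩ := exists_norm_locSol_sub_le hν hφ (θ := Real.pi / 2) (by linarith)
      (by linarith) 1
    refine tendsto_one_of_norm_sub_le (K := K) fun x hx => ?_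
    have h1 := hK x (by simpa using hφ.le) (by simpa using hx)
    rw [← hf x (by simp; linarith)] at h1
    simpa [asympCoeff_zero] using h1
  have h0 : |(0 : ℝ)| < Real.pi / 2 := by simp [Real.pi_pos]
  obtain ⟨f, f', hf, hf1, hf2⟩ := hext 0 h0
  refine ⟨f, f', hf, fun w hw => ?_, ?_⟩
  · have h1 := hf1 w (by simpa using hw)
    have h2 := hf2 w (by simpa using hw)
    simp only [ofReal_zero, zero_mul, exp_zero] at h1 h2
    exact ⟨h1, h2⟩
  · have hloc : ∀ φ : ℝ, |φ| < Real.pi / 2 → ∀ w : ℂ, |w.im - φ| < Real.pi →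
        f w = locSol ν (exp (φ * I)) w := by
      intro φ hφ w hw
      obtain ⟨g, g', hg, hg1, -⟩ := hext φ hφ
      rw [hf.eq_of_tendsto hg (htend 0 h0 f hf1) (htend φ hφ g hg1), hg1 w hw]
    intro θ hθ N
    by_cases hθ0 : 0 ≤ θ
    swap
    · exact ⟨0, fun w hw => absurd ((abs_nonneg _).trans hw) hθ0⟩
    -- The strips of half-width `2 θ / 3` around `θ / 3` and `-θ / 3` cover `|Im w| ≤ θ`. The
    -- condition `θ < 3 π / 2` is exactly what makes `θ / 3 < π / 2` and `2 θ / 3 < π`.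
    have hφ1 : |θ / 3| < Real.pi / 2 := by rw [abs_of_nonneg (by linarith)]; linarith
    have hφ2 : |-(θ / 3)| < Real.pi / 2 := by rwa [abs_neg]
    have hθ' : 2 * θ / 3 < Real.pi := by linarith
    obtain ⟨K₁, hK₁⟩ := exists_norm_locSol_sub_le hν hφ1 (θ := 2 * θ / 3) (by linarith) hθ' N
    obtain ⟨K₂, hK₂⟩ := exists_norm_locSol_sub_le hν hφ2 (θ := 2 * θ / 3) (by linarith) hθ' N
    refine ⟨max K₁ K₂, fun w hw hre => ?_⟩
    rw [abs_le] at hw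
    rcases le_total 0 w.im with him | him
    · have h1 : |w.im - θ / 3| ≤ 2 * θ / 3 := by
        rw [abs_le]; constructor <;> linarith
      have h2 := hK₁ w h1 hre
      rw [← hloc _ hφ1 w (by linarith)] at h2
      exact h2.trans (by gcongr; exact le_max_left _ _)
    · have h1 : |w.im - -(θ / 3)| ≤ 2 * θ / 3 := by
        rw [abs_le]; constructor <;> linarith
      have h2 := hK₂ w h1 hre
      rw [← hloc _ hφ2 w (by linarith)] at h2
      exact h2.trans (by gcongr; exact le_max_right _ _)

end StokesSibuya

namespace StokesSibuya

open Complex Filter Topology MeasureTheory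

/-! ### Connection coefficients -/

theorem HasSubdominantExpansion.tendsto {ν : ℂ} {f : ℂ → ℂ} (hf : HasSubdominantExpansion ν f)
    {y : ℝ} (hy : |y| < 3 * Real.pi / 2) :
    Tendsto (fun x : ℝ => f (x + y * I) * exp ((x + y * I) / 2 + exp (x + y * I))) atTop (𝓝 1) := by
  obtain ⟨K, hK⟩ := hf |y| hy 1
  refine tendsto_one_of_norm_sub_le (K := K) fun x hx => ?_
  have := hK (x + y * I) (by simp) (by simpa using hx)
  simpa [asympCoeff_zero] using this

/-- Cauchy's estimate on unit discs for the normalized function `f w * exp (w / 2 + exp w)`. Its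
boundedness is the expansion of order `0`, available up to `|Im w| ≤ π + 1 < 3 π / 2`. -/
theorem HasSubdominantExpansion.exists_norm_deriv_le {ν : ℂ} {f f' : ℂ → ℂ}
    (h : HasSubdominantExpansion ν f) (hf : IsBessel ν f f') :
    ∃ C : ℝ, ∀ w : ℂ, |w.im| ≤ Real.pi → 1 ≤ w.re →
      ‖exp (w / 2 + exp w) * (f' w + (1 / 2 + exp w) * f w)‖ ≤ C := by
  have hπ := Real.pi_gt_three
  obtain ⟨K, hK⟩ := h (Real.pi + 1) (by linarith) 0
  refine ⟨K, fun w hw hre => ?_⟩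
  have hd : ∀ w : ℂ, HasDerivAt (fun w => f w * exp (w / 2 + exp w))
      (exp (w / 2 + exp w) * (f' w + (1 / 2 + exp w) * f w)) w := fun w => by
    have h1 : HasDerivAt (fun w : ℂ => w / 2 + exp w) (1 / 2 + exp w) w :=
      ((hasDerivAt_id w).div_const 2).add (hasDerivAt_exp w)
    exact ((hf.hasDerivAt w).mul h1.cexp).congr_deriv (by ring)
  have hdiff : Differentiable ℂ (fun w => f w * exp (w / 2 + exp w)) := fun w =>
    (hd w).differentiableAt
  have key := norm_deriv_le_of_forall_mem_sphere_norm_le (c := w) (C := K) one_pos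
    hdiff.diffContOnCl (fun z hz => ?_)
  · rw [(hd w).deriv, div_one] at key
    exact key
  · have hz' : ‖z - w‖ = 1 := by simpa using hz
    have h1 : |z.im - w.im| ≤ 1 := by
      rw [← sub_im, ← hz']
      exact abs_im_le_norm _
    have h2 : |z.re - w.re| ≤ 1 := by
      rw [← sub_re, ← hz']
      exact abs_re_le_norm _
    rw [abs_le] at h1 h2 hw
    have := hK z (by rw [abs_le]; constructor <;> linarith) (by linarith)
    simpa using this

/-- Let `v0`, `v1` be the normalized values at `x` and `x + π i`, and `d0`, `d1` their derivatives.
As `exp (x + π i) = -exp x`, the dominant exponentials cancel in the Wronskian `W`, leaving `I * W =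
exp (-x) * (v0 * d1 - d0 * v1) + 2 * v0 * v1`. When `x → +∞` the derivatives stay bounded and `v0`,
`v1` tend to `1`. -/
theorem HasSubdominantExpansion.wronskian_shift {ν : ℂ} {f f' : ℂ → ℂ}
    (h : HasSubdominantExpansion ν f) (hf : IsBessel ν f f') (w : ℂ) :
    f w * f' (w + Real.pi * I) - f' w * f (w + Real.pi * I) = -2 * I := by
  have hπ := Real.pi_pos
  have hT := hf.shift 1
  simp only [Int.cast_one, one_mul] at hT
  set W := f w * f' (w + Real.pi * I) - f' w * f (w + Real.pi * I) with hW
  obtain ⟨C, hC⟩ := h.exists_norm_deriv_le hf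
  have t0 := h.tendsto (y := 0) (by simp; linarith)
  have t1 := h.tendsto (y := Real.pi) (by rw [abs_of_pos hπ]; linarith)
  simp only [ofReal_zero, zero_mul, add_zero] at t0
  set v0 : ℝ → ℂ := fun x => f x * exp (x / 2 + exp x)
  set v1 : ℝ → ℂ := fun x => f (x + Real.pi * I) *
    exp ((x + Real.pi * I) / 2 + exp (x + Real.pi * I))
  set d0 : ℝ → ℂ := fun x => exp (x / 2 + exp x) * (f' x + (1 / 2 + exp x) * f x)
  set d1 : ℝ → ℂ := fun x => exp ((x + Real.pi * I) / 2 + exp (x + Real.pi * I)) *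
    (f' (x + Real.pi * I) + (1 / 2 + exp (x + Real.pi * I)) * f (x + Real.pi * I))
  have hid : ∀ x : ℝ, I * W = exp (-x) * (v0 x * d1 x - d0 x * v1 x) + 2 * (v0 x * v1 x) := by
    intro x
    rw [hW, hf.wronskian_eq hT w x]
    have e1 : exp (x + Real.pi * I) = -exp x := by rw [exp_add, exp_pi_mul_I]; ring
    have e2 : exp ((x + Real.pi * I) / 2 + -exp x) = I * exp (x / 2) * exp (-exp x) := by
      rw [exp_add, add_div, exp_add, show (Real.pi * I / 2 : ℂ) = Real.pi / 2 * I by ring,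
        exp_pi_div_two_mul_I]
      ring
    simp only [v0, v1, d0, d1, e1, e2]
    rw [exp_add]
    have e3 : exp (exp x) * exp (-exp x) = 1 := by rw [← exp_add, add_neg_cancel, exp_zero]
    have e4 : exp ((x : ℂ) / 2) * exp (x / 2) = exp x := by rw [← exp_add, add_halves]
    have e5 : exp (-x : ℂ) * exp x = 1 := by rw [← exp_add, neg_add_cancel, exp_zero]
    have e6 : exp (-x : ℂ) * (exp ((x : ℂ) / 2) * exp (x / 2)) * (exp (exp x) * exp (-exp x)) = 1 := by
      rw [e3, e4, e5, one_mul]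
    have e7 : exp ((x : ℂ) / 2) * exp (x / 2) * (exp (exp x) * exp (-exp x)) = exp x := by
      rw [e3, e4, mul_one]
    linear_combination -(I * (f x * f' (x + Real.pi * I) - f' x * f (x + Real.pi * I))) * e6
      + 2 * I * f x * f (x + Real.pi * I) * exp x * e6 - 2 * I * f x * f (x + Real.pi * I) * e7
  have hbd : Tendsto (fun x : ℝ => exp (-x) * (v0 x * d1 x - d0 x * v1 x)) atTop (𝓝 0) := by
    refine Tendsto.zero_mul_isBoundedUnder_le ?_ ?_
    · rw [tendsto_zero_iff_norm_tendsto_zero]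
      simp only [norm_exp]
      simpa using Real.tendsto_exp_neg_atTop_nhds_zero
    · have b0 : ∀ᶠ x : ℝ in atTop, ‖v0 x‖ ≤ 2 :=
        (t0.norm.eventually (ge_mem_nhds (by simp)))
      have b1 : ∀ᶠ x : ℝ in atTop, ‖v1 x‖ ≤ 2 :=
        (t1.norm.eventually (ge_mem_nhds (by simp)))
      refine isBoundedUnder_of_eventually_le (a := 2 * C + C * 2) ?_
      filter_upwards [b0, b1, eventually_ge_atTop 1] with x h0 h1 hx
      have c0 : ‖d0 x‖ ≤ C := hC x (by simp [hπ.le]) (by simpa using hx)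
      have c1 : ‖d1 x‖ ≤ C := hC (x + Real.pi * I) (by simp [abs_of_pos hπ]) (by simpa using hx)
      have hC0 : 0 ≤ C := (norm_nonneg _).trans c0
      refine (norm_sub_le _ _).trans ?_
      exact add_le_add
        ((norm_mul_le _ _).trans (mul_le_mul h0 c1 (norm_nonneg _) zero_le_two))
        ((norm_mul_le _ _).trans (mul_le_mul c0 h1 (norm_nonneg _) hC0))
  have hlim := hbd.add ((t0.mul t1).const_mul 2)
  have hconst : Tendsto (fun _ : ℝ => I * W) atTop (𝓝 (0 + 2 * (1 * 1))) :=
    hlim.congr fun x => (hid x).symm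
  have := tendsto_nhds_unique hconst tendsto_const_nhds
  linear_combination I * this + W * I_mul_I

/-! ### The Laplace integral near the origin `z = exp w → 0`, and the Frobenius coefficients. -/

theorem tendsto_integral_near_zero {a : ℂ} (ha : -1 < a.re) {m : ℝ → ℝ → ℝ} {m₀ : ℝ → ℝ}
    (hm : ∀ z σ, 0 < z → 0 < σ → |m z σ| ≤ z + σ) (hc : ∀ z, Continuous (m z))
    (hm₀ : ∀ σ, Tendsto (fun z => m z σ) (𝓝[>] 0) (𝓝 (m₀ σ))) :
    Tendsto (fun z : ℝ => ∫ σ in Set.Ioi (0 : ℝ), exp (-σ) * (σ : ℂ) ^ a * m z σ *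
      ((z + σ / 2 : ℝ) : ℂ) ^ a) (𝓝[>] 0) (𝓝 (∫ σ in Set.Ioi (0 : ℝ), exp (-σ) * (σ : ℂ) ^ a *
      m₀ σ * ((σ / 2 : ℝ) : ℂ) ^ a)) := by
  set L := ⌈a.re + 1⌉₊
  refine tendsto_integral_filter_of_dominated_convergence
    (fun σ => 2 * (Real.exp (-(1 * σ)) * σ ^ a.re * (1 + σ) ^ L)) ?_ ?_
    ((integrableOn_exp_mul_rpow one_pos L ha).const_mul 2) ?_
  · filter_upwards [self_mem_nhdsWithin] with z hz
    have hz' : (0 : ℝ) < z := hz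
    refine ContinuousOn.aestronglyMeasurable (fun σ hσ => ?_) measurableSet_Ioi
    have hσ' : (0 : ℝ) < σ := hσ
    refine ContinuousAt.continuousWithinAt (ContinuousAt.mul (ContinuousAt.mul (ContinuousAt.mul
      (by fun_prop) ?_) ?_) ?_)
    · exact continuousAt_ofReal_cpow_const _ _ (Or.inr hσ'.ne')
    · exact continuous_ofReal.continuousAt.comp (hc z).continuousAt
    · refine ContinuousAt.cpow (by fun_prop) continuousAt_const ?_
      exact ofReal_mem_slitPlane.2 (by positivity)
  · filter_upwards [Ioo_mem_nhdsGT (zero_lt_one' ℝ)] with z hz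
    refine (ae_restrict_iff' measurableSet_Ioi).2 (ae_of_all _ fun σ hσ => ?_)
    have hσ' : (0 : ℝ) < σ := hσ
    have hz' : 0 < z + σ / 2 := by have := hz.1; positivity
    have h1 : ‖exp (-(σ : ℂ)) * (σ : ℂ) ^ a‖ = Real.exp (-(1 * σ)) * σ ^ a.re := by
      have := norm_exp_mul_cpow 1 a hσ'
      simpa using this
    rw [norm_mul, norm_mul, h1, norm_cpow_eq_rpow_re_of_pos hz', Complex.norm_real,
      Real.norm_eq_abs]
    -- The weight `m` raises the exponent of `z + σ / 2` to `a + 1`, which has positive real part.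
    -- This gives a bound independent of `z < 1`, which `(z + σ / 2) ^ a` alone need not have.
    have h2 : |m z σ| ≤ 2 * (z + σ / 2) := (hm z σ hz.1 hσ').trans (by linarith [hz.1])
    have h3 : (z + σ / 2) * (z + σ / 2) ^ a.re = (z + σ / 2) ^ (a.re + 1) := by
      rw [Real.rpow_add_one hz'.ne']; ring
    have h4 : (z + σ / 2) ^ (a.re + 1) ≤ (1 + σ) ^ (a.re + 1) :=
      Real.rpow_le_rpow hz'.le (by linarith [hz.2]) (by linarith)
    have h5 : (1 + σ) ^ (a.re + 1) ≤ (1 + σ) ^ L := by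
      rw [← Real.rpow_natCast]
      exact Real.rpow_le_rpow_of_exponent_le (by linarith) (Nat.le_ceil _)
    calc _ ≤ Real.exp (-(1 * σ)) * σ ^ a.re * (2 * (z + σ / 2)) * (z + σ / 2) ^ a.re := by gcongr
      _ = 2 * (Real.exp (-(1 * σ)) * σ ^ a.re * ((z + σ / 2) * (z + σ / 2) ^ a.re)) := by ring
      _ ≤ _ := by rw [h3]; gcongr; exact h4.trans h5
  · refine (ae_restrict_iff' measurableSet_Ioi).2 (ae_of_all _ fun σ hσ => ?_)
    have hσ' : (0 : ℝ) < σ := hσ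
    refine Tendsto.mul (Tendsto.mul tendsto_const_nhds
      ((continuous_ofReal.tendsto _).comp (hm₀ σ))) ?_
    have hcont : ContinuousAt (fun z : ℝ => ((z + σ / 2 : ℝ) : ℂ) ^ a) 0 := by
      refine ContinuousAt.cpow (by fun_prop) continuousAt_const ?_
      exact ofReal_mem_slitPlane.2 (by positivity)
    have := hcont.tendsto
    simp only [zero_add] at this
    exact this.mono_left nhdsWithin_le_nhds

theorem exp_mul_lap_eq (a : ℂ) (x : ℝ) {m : ℝ → ℝ → ℝ} {b e : ℂ}
    (hm : ∀ σ : ℝ, 0 < σ → e * (σ : ℂ) ^ b = (σ : ℂ) ^ a * m (Real.exp x) σ) :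
    exp (a * x) * (e * lap 1 b a (lapVar 1 x)) = ∫ σ in Set.Ioi (0 : ℝ), exp (-σ) * (σ : ℂ) ^ a *
      m (Real.exp x) σ * ((Real.exp x + σ / 2 : ℝ) : ℂ) ^ a := by
  rw [lap, ← mul_assoc, ← integral_const_mul]
  refine setIntegral_congr_fun measurableSet_Ioi fun σ hσ => ?_
  have hσ' : (0 : ℝ) < σ := hσ
  have h1 : ((Real.exp x + σ / 2 : ℝ) : ℂ) ^ a = exp (a * x) * (1 + σ * lapVar 1 x) ^ a := by
    have e1 : Real.exp x + σ / 2 = Real.exp x * (1 + σ * (Real.exp (-x) / 2)) := by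
      rw [Real.exp_neg]
      field_simp
    have e2 : (1 + (σ : ℂ) * lapVar 1 x) = ((1 + σ * (Real.exp (-x) / 2) : ℝ) : ℂ) := by
      rw [lapVar]; push_cast; ring
    rw [e1, e2, ofReal_mul, mul_cpow_ofReal_nonneg (Real.exp_pos x).le (by positivity)]
    congr 1
    rw [cpow_def_of_ne_zero (ofReal_ne_zero.2 (Real.exp_pos x).ne'), ← ofReal_log
      (Real.exp_pos x).le, Real.log_exp, mul_comm]
  simp only [lapKer]
  rw [h1, one_mul]
  linear_combination exp (a * x) * exp (-σ) * (1 + σ * lapVar 1 x) ^ a * hm σ hσ'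

theorem integral_exp_mul_cpow_half {a : ℂ} (ha : -1 < (2 * a + 1).re) :
    ∫ σ in Set.Ioi (0 : ℝ), exp (-σ) * (σ : ℂ) ^ a * σ * ((σ / 2 : ℝ) : ℂ) ^ a
      = 2 ^ (-a) * Gamma (2 * a + 2) := by
  rw [Gamma_eq_integral (by simp at ha ⊢; linarith), GammaIntegral, ← integral_const_mul]
  refine setIntegral_congr_fun measurableSet_Ioi fun σ hσ => ?_
  have hσ' : (0 : ℝ) < σ := hσ
  have hσ0 : (σ : ℂ) ≠ 0 := ofReal_ne_zero.2 hσ'.ne'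
  have h1 : ((σ / 2 : ℝ) : ℂ) ^ a = (σ : ℂ) ^ a * 2 ^ (-a) := by
    rw [div_eq_mul_inv, ofReal_mul, mul_cpow_ofReal_nonneg hσ'.le (by positivity)]
    congr 1
    have harg : arg (2 : ℂ) ≠ Real.pi := by
      rw [show (2 : ℂ) = ((2 : ℝ) : ℂ) by norm_num,
        arg_ofReal_of_nonneg (by norm_num : (0 : ℝ) ≤ 2)]
      exact Real.pi_pos.ne
    push_cast
    rw [inv_cpow _ _ harg, cpow_neg]
  have h2 : (σ : ℂ) ^ (2 * a + 2 - 1) = (σ : ℂ) ^ a * (σ : ℂ) ^ a * σ := by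
    rw [show 2 * a + 2 - 1 = a + a + 1 by ring, cpow_add _ _ hσ0, cpow_add _ _ hσ0, cpow_one]
  rw [h1, h2]
  push_cast
  ring

/-- The Wronskian is constant, so it may be computed as `w → -∞` along the real axis. Integration by
parts turns the derivative term of `locSol'` into `lap 1 (a + 1) a`. Only two quantities remain:
`D₁`, with limit the Gamma integral `2 ^ (-a) * Gamma (2 a + 2)`, and `D₂`, which carries an extra
factor `exp x` and tends to `0`. -/
theorem wronskian_frob_subdominant {ν : ℂ} (hν : 0 ≤ ν.re) {f f' : ℂ → ℂ} (hf : IsBessel ν f f')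
    (hloc : ∀ w : ℂ, |w.im| < Real.pi → f w = locSol ν 1 w ∧ f' w = locSol' ν 1 w) (w : ℂ) :
    frob ν w * f' w - frob' ν w * f w
      = -(2 ^ (1 / 2 - ν) * Gamma (2 * ν + 1) / Gamma (ν + 1 / 2)) := by
  set a := ν - 1 / 2 with ha
  have ha0 : -1 < a.re := by simp [ha]; linarith
  have hF : IsBessel ν (frob ν) (frob' ν) := isBessel_frob fun n h => by
    have := congrArg re h
    simp at this
    have h2 : (0 : ℝ) ≤ n := Nat.cast_nonneg n
    linarith
  have hM : moment 1 a = Gamma (ν + 1 / 2) := by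
    rw [moment_one ha0, ha]; congr 1; ring
  set D₁ : ℝ → ℂ := fun x => exp (a * x) * (1 * lap 1 (a + 1) a (lapVar 1 x))
  set D₂ : ℝ → ℂ := fun x => exp (a * x) * (exp x * lap 1 a a (lapVar 1 x))
  have hD₁ : Tendsto D₁ atBot (𝓝 (2 ^ (-a) * Gamma (2 * a + 2))) := by
    rw [← integral_exp_mul_cpow_half (by simp [ha]; linarith)]
    refine ((tendsto_integral_near_zero ha0 (m := fun _ σ => σ) (m₀ := fun σ => σ) ?_ ?_ ?_).comp
      Real.tendsto_exp_atBot_nhdsGT).congr fun x => ?_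
    · intro z σ hz hσ
      rw [abs_of_pos hσ]
      linarith
    · exact fun _ => continuous_id
    · exact fun _ => tendsto_const_nhds
    · refine (exp_mul_lap_eq a x (m := fun _ σ => σ) fun σ hσ => ?_).symm
      rw [cpow_add _ _ (ofReal_ne_zero.2 hσ.ne'), cpow_one, one_mul]
  have hD₂ : Tendsto D₂ atBot (𝓝 0) := by
    have h0 : (0 : ℂ) = ∫ σ in Set.Ioi (0 : ℝ), exp (-σ) * (σ : ℂ) ^ a *
        ((0 : ℝ) : ℂ) * ((σ / 2 : ℝ) : ℂ) ^ a := by simp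
    rw [h0]
    refine ((tendsto_integral_near_zero ha0 (m := fun z _ => z) (m₀ := fun _ => 0) ?_ ?_ ?_).comp
      Real.tendsto_exp_atBot_nhdsGT).congr fun x => ?_
    · intro z σ hz hσ
      rw [abs_of_pos hz]
      linarith
    · exact fun _ => continuous_const
    · exact fun _ => tendsto_nhdsWithin_of_tendsto_nhds tendsto_id
    · refine (exp_mul_lap_eq a x (m := fun z _ => z) fun σ hσ => ?_).symm
      rw [ofReal_exp, mul_comm]
  have hexp : Tendsto (fun x : ℝ => exp (x : ℂ)) atBot (𝓝 0) := by
    rw [tendsto_zero_iff_norm_tendsto_zero]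
    simp only [norm_exp, ofReal_re]
    exact Real.tendsto_exp_atBot
  have hX : Tendsto (fun x : ℝ => exp (2 * x : ℂ)) atBot (𝓝 0) := by
    have := hexp.mul hexp
    rw [mul_zero] at this
    refine this.congr fun x => ?_
    rw [← exp_add]; congr 1; ring
  have hG := ((differentiable_frobG ν).continuous.tendsto 0).comp hX
  have hG' := ((differentiable_frobG' ν).continuous.tendsto 0).comp hX
  have hz : Tendsto (fun x : ℝ => exp (-exp (x : ℂ))) atBot (𝓝 1) := by
    have := (continuous_exp.tendsto _).comp hexp.neg
    rw [neg_zero, exp_zero] at this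
    exact this
  have hid : ∀ x : ℝ, frob ν w * f' w - frob' ν w * f w =
      exp (-exp (x : ℂ)) / Gamma (ν + 1 / 2) * (-(frobG ν (exp (2 * x)) * (D₁ x + D₂ x)) -
        2 * exp x * frobG' ν (exp (2 * x)) * D₂ x) := by
    intro x
    obtain ⟨h1, h2⟩ := hloc x (by simp [Real.pi_pos])
    rw [hF.wronskian_eq hf w x, h1, h2, frob, frob', locSol, locSol', ← ha, hM]
    have hu : lapVar 1 x ∈ slitPlane := by
      have := lapVar_mem_slitPlane (φ := 0) (w := x) (by simp [Real.pi_pos])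
      simpa using this
    obtain ⟨c, hc, hc1, hcu⟩ := exists_sector_mem_nhds hu
    have hibp := lap_integral_by_parts (ρ := 1) (by simp) ha0 a hc hc1 (mem_of_mem_nhds hcu)
    simp only [D₁, D₂]
    have e1 : exp (ν * x) * exp (-x / 2 - exp x) = exp (-exp (x : ℂ)) * exp (a * x) := by
      rw [← exp_add, ← exp_add, ha]; congr 1; ring
    have e2 : exp (2 * x : ℂ) = exp x * exp x := by rw [← exp_add]; congr 1; ring
    have hν' : ν = a + 1 / 2 := by rw [ha]; ring
    set G := frobG ν (exp (2 * x))
    set G' := frobG' ν (exp (2 * x))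
    set H := lap 1 a a (lapVar 1 x)
    set H₁ := lap 1 (a + 1) (a - 1) (lapVar 1 x)
    set H₂ := lap 1 (a + 1) a (lapVar 1 x)
    have e3 : lap 1 (a + 1) (a - 1) (lapVar 1 x) = H₁ := rfl
    calc _ = exp (ν * x) * exp (-x / 2 - exp x) / Gamma (ν + 1 / 2) *
          (G * ((-1 / 2 - exp x) * H - lapVar 1 x * (a * H₁)) -
            (ν * G + 2 * exp (2 * x) * G') * H) := by ring
      _ = exp (-exp (x : ℂ)) * exp (a * x) / Gamma (ν + 1 / 2) *
          (G * (-H₂ - exp x * H) - 2 * exp (2 * x) * G' * H) := by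
            rw [e1]
            congr 1
            linear_combination -G * hibp - G * H * hν'
      _ = _ := by rw [e2]; ring
  have hlim := (hz.div_const (Gamma (ν + 1 / 2))).mul (((hG.mul (hD₁.add hD₂)).neg).sub
    (((hexp.const_mul 2).mul hG').mul hD₂))
  have hconst := hlim.congr fun x => (hid x).symm
  have := tendsto_nhds_unique tendsto_const_nhds hconst
  rw [this, frobG_zero, show -a = 1 / 2 - ν by rw [ha]; ring,
    show 2 * a + 2 = 2 * ν + 1 by rw [ha]; ring]
  ring

/-- Pairing with `frob ν` isolates `β`, and the duplication formula simplifies it. The Wronskian of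
`f` and its shift is a multiple of `α β`, because both Frobenius solutions are eigenvectors of the
shift. It gives `2 ν sin (π ν) α β = -1`, from which the reflection formula extracts `α`. The
recessive coefficient `α` is thus never read off an asymptotic behaviour at the origin. -/
theorem subdominant_eq_frob_aux {ν : ℂ} (hν : 0 ≤ ν.re) (hν' : ∀ n : ℤ, ν ≠ n) {f f' : ℂ → ℂ}
    (hf : IsBessel ν f f') (h : HasSubdominantExpansion ν f)
    (hloc : ∀ w : ℂ, |w.im| < Real.pi → f w = locSol ν 1 w ∧ f' w = locSol' ν 1 w) (w : ℂ) :
    f w = 2 ^ (-ν - 1 / 2) * Gamma (-ν) / (Real.sqrt Real.pi : ℂ) * frob ν w +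
      2 ^ (ν - 1 / 2) * Gamma ν / (Real.sqrt Real.pi : ℂ) * frob (-ν) w := by
  obtain ⟨α, β, hαβ⟩ := hf.eq_frob_add_frob hν'
  have h1 := wronskian_frob_subdominant hν hf hloc 0
  have h2 := h.wronskian_shift hf 0
  have hW := frob_wronskian hν' 0
  have hν0 : ν ≠ 0 := by exact_mod_cast hν' 0
  have hp : (Real.sqrt Real.pi : ℂ) ≠ 0 := ofReal_ne_zero.2 (Real.sqrt_pos.2 Real.pi_pos).ne'
  have hp2 : (Real.sqrt Real.pi : ℂ) * (Real.sqrt Real.pi : ℂ) = Real.pi := by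
    rw [← ofReal_mul, Real.mul_self_sqrt Real.pi_pos.le]
  have hΓ : Gamma (ν + 1 / 2) ≠ 0 := Gamma_ne_zero_of_re_pos (by simp; linarith)
  have hΓν : Gamma ν ≠ 0 := Gamma_ne_zero fun n hn => hν' (-n) (by simpa using hn)
  rw [(hαβ 0).1, (hαβ 0).2] at h1
  have h3 : β * (-2 * ν) = -(2 ^ (1 / 2 - ν) * Gamma (2 * ν + 1) / Gamma (ν + 1 / 2)) := by
    rw [← h1]
    linear_combination -β * hW
  have hβ : β = 2 ^ (ν - 1 / 2) * Gamma ν / (Real.sqrt Real.pi : ℂ) := by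
    rw [Gamma_add_one _ (mul_ne_zero two_ne_zero hν0)] at h3
    have hdup := Gamma_mul_Gamma_add_half ν
    have h4 : (2 : ℂ) ^ (ν - 1 / 2) * 2 ^ (1 - 2 * ν) = 2 ^ (1 / 2 - ν) := by
      rw [← cpow_add _ _ two_ne_zero]; congr 1; ring
    rw [eq_div_iff hp]
    have h5 : β * Gamma (ν + 1 / 2) = 2 ^ (1 / 2 - ν) * Gamma (2 * ν) := by
      have : β * (-2 * ν) * Gamma (ν + 1 / 2) = -(2 ^ (1 / 2 - ν) * (2 * ν * Gamma (2 * ν))) := by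
        rw [h3, neg_mul, div_mul_cancel₀ _ hΓ]
      apply mul_left_cancel₀ (mul_ne_zero two_ne_zero hν0)
      linear_combination -this
    apply mul_right_cancel₀ hΓ
    linear_combination (Real.sqrt Real.pi : ℂ) * h5 - 2 ^ (ν - 1 / 2) * hdup -
      (Real.sqrt Real.pi : ℂ) * Gamma (2 * ν) * h4
  have hs1 : ∀ g : ℂ, frob g (0 + Real.pi * I) = exp (g * (Real.pi * I)) * frob g 0 := fun g => by
    simpa using frob_shift g 0 1
  have hs2 : ∀ g : ℂ, frob' g (0 + Real.pi * I) = exp (g * (Real.pi * I)) * frob' g 0 := fun g => by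
    simpa using frob'_shift g 0 1
  rw [(hαβ 0).1, (hαβ 0).2, (hαβ (0 + Real.pi * I)).1, (hαβ (0 + Real.pi * I)).2, hs1, hs1, hs2,
    hs2] at h2
  have hsin : 2 * I * Complex.sin (Real.pi * ν) =
      exp (ν * (Real.pi * I)) - exp (-ν * (Real.pi * I)) := by
    rw [Complex.sin, show (-(Real.pi * ν) * I : ℂ) = -ν * (Real.pi * I) by ring,
      show (Real.pi * ν * I : ℂ) = ν * (Real.pi * I) by ring]
    linear_combination (exp (-ν * (Real.pi * I)) - exp (ν * (Real.pi * I))) * I_mul_I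
  have h6 : α * β * (2 * ν * Complex.sin (Real.pi * ν)) = -1 := by
    have h7 : α * β * (2 * ν * (2 * I * Complex.sin (Real.pi * ν))) = -2 * I := by
      rw [hsin, ← h2]
      linear_combination -(α * β * (exp (-ν * (Real.pi * I)) - exp (ν * (Real.pi * I)))) * hW
    have h8 : (2 * I : ℂ) ≠ 0 := mul_ne_zero two_ne_zero I_ne_zero
    apply mul_left_cancel₀ h8
    linear_combination h7
  have hsin0 : Complex.sin (Real.pi * ν) ≠ 0 := fun h0 => by
    rw [h0] at h6
    norm_num at h6
  have hβ0 : β ≠ 0 := fun h0 => by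
    rw [h0] at h6
    norm_num at h6
  have hα : α = 2 ^ (-ν - 1 / 2) * Gamma (-ν) / (Real.sqrt Real.pi : ℂ) := by
    have hrefl := Gamma_mul_Gamma_one_sub ν
    have h9 : Gamma (1 - ν) = -ν * Gamma (-ν) := by
      rw [← Gamma_add_one _ (neg_ne_zero.2 hν0)]; congr 1; ring
    rw [h9, eq_div_iff hsin0] at hrefl
    have h10 : (2 : ℂ) ^ (-ν - 1 / 2) * 2 ^ (ν - 1 / 2) = 1 / 2 := by
      rw [← cpow_add _ _ two_ne_zero, show -ν - 1 / 2 + (ν - 1 / 2) = -1 by ring, cpow_neg_one]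
      norm_num
    have h11 : (Real.pi : ℂ) ≠ 0 := ofReal_ne_zero.2 Real.pi_pos.ne'
    have h12 : 2 ^ (-ν - 1 / 2) * Gamma (-ν) / (Real.sqrt Real.pi : ℂ) * β *
        (2 * ν * Complex.sin (Real.pi * ν)) = -1 := by
      have h14 : 2 ^ (-ν - 1 / 2) * Gamma (-ν) / (Real.sqrt Real.pi : ℂ) *
          (2 ^ (ν - 1 / 2) * Gamma ν / (Real.sqrt Real.pi : ℂ)) * (2 * ν * Complex.sin (Real.pi * ν))
          = 2 ^ (-ν - 1 / 2) * 2 ^ (ν - 1 / 2) * (2 * (ν * Gamma (-ν) * Gamma ν *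
            Complex.sin (Real.pi * ν))) / ((Real.sqrt Real.pi : ℂ) * (Real.sqrt Real.pi : ℂ)) := by
        ring
      rw [hβ, h14, h10, hp2, div_eq_iff h11]
      linear_combination -hrefl
    have h13 : β * (2 * ν * Complex.sin (Real.pi * ν)) ≠ 0 :=
      mul_ne_zero hβ0 (mul_ne_zero (mul_ne_zero two_ne_zero hν0) hsin0)
    apply mul_right_cancel₀ h13
    linear_combination h6 - h12
  rw [(hαβ w).1, hα, hβ]

/-- The subdominant solution, its expansion, and its connection to the Frobenius solutions. -/
theorem exists_subdominant_connection (ν : ℂ) : ∃ (μ : ℂ) (f f' : ℂ → ℂ), IsBessel ν f f' ∧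
    HasSubdominantExpansion μ f ∧
    (∀ w, f w * f' (w + Real.pi * I) - f' w * f (w + Real.pi * I) = -2 * I) ∧
    ((∀ n : ℤ, ν ≠ n) → ∀ w,
      f w = 2 ^ (-ν - 1 / 2) * Gamma (-ν) / (Real.sqrt Real.pi : ℂ) * frob ν w +
        2 ^ (ν - 1 / 2) * Gamma ν / (Real.sqrt Real.pi : ℂ) * frob (-ν) w) := by
  rcases le_total 0 ν.re with hν | hν
  · obtain ⟨f, f', hf, hloc, h⟩ := exists_subdominant hν
    exact ⟨ν, f, f', hf, h, h.wronskian_shift hf,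
      fun hν' => subdominant_eq_frob_aux hν hν' hf h hloc⟩
  -- The equation depends on `ν ^ 2` only. The construction is applied to `-ν`, whose real part is
  -- nonnegative; the connection formula is symmetric under this exchange.
  · obtain ⟨f, f', hf, hloc, h⟩ := exists_subdominant (ν := -ν) (by simpa using hν)
    refine ⟨-ν, f, f', by simpa using hf.neg, h, h.wronskian_shift hf, fun hν' w => ?_⟩
    rw [subdominant_eq_frob_aux (by simpa using hν) (fun n hn => hν' (-n) (by
      push_cast; rw [← hn, neg_neg])) hf h hloc w, neg_neg, add_comm]

end StokesSibuya

namespace StokesSibuya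

open Complex Filter Topology

/-! ### Reduction of the equation with `a' = 0` to the modified Bessel equation -/

theorem coef_lastOnly_of_pos {m : ℕ} (am : ℂ) {j : ℕ} (hj : 1 ≤ j) (hjm : j < m) :
    coef (lastOnly m am) j = 0 := by
  rw [coef, dif_pos ⟨hj, hjm.le⟩, lastOnly, if_neg]
  simp only
  omega

theorem coef_lastOnly_self {m : ℕ} (hm : 1 ≤ m) (am : ℂ) : coef (lastOnly m am) m = am := by
  rw [coef, dif_pos ⟨hm, le_rfl⟩, lastOnly, if_pos]
  simp only
  omega

theorem coef_zero {m : ℕ} (a : Fin m → ℂ) : coef a 0 = 1 := by simp [coef]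

theorem polyP_lastOnly {m : ℕ} (hm : 1 ≤ m) (am x : ℂ) :
    polyP (lastOnly m am) x = x ^ m + am := by
  obtain ⟨k, rfl⟩ : ∃ k, m = k + 1 := ⟨m - 1, by omega⟩
  rw [polyP, Finset.sum_range_succ, Finset.sum_range_succ', Finset.sum_eq_zero, coef_zero,
    coef_lastOnly_self hm]
  · simp
  · intro i hi
    rw [coef_lastOnly_of_pos am (by omega) (by simpa using hi), zero_mul]

/-- In the variable `t = log x`, the operator `x ^ 2 d²/dx²` is `d²/dt² - d/dt`. -/
theorem isSolution_lastOnly_iff {m : ℕ} (hm : 1 ≤ m) (am : ℂ) (φ : ℂ → ℂ) :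
    IsSolution (lastOnly m am) φ ↔ Differentiable ℂ φ ∧
      ∀ t, deriv (deriv φ) t - deriv φ t = (exp (m * t) + am) * φ t := by
  rw [IsSolution]
  refine and_congr_right fun hφ => forall_congr' fun t => ?_
  have h1 : Dx (Dx φ) t = exp (-t) * (exp (-t) * (deriv (deriv φ) t - deriv φ t)) := by
    have h2 : HasDerivAt (Dx φ) (-exp (-t) * deriv φ t + exp (-t) * deriv (deriv φ) t) t := by
      have h3 := (hasDerivAt_neg t).cexp.mul ((hφ.deriv) t).hasDerivAt
      exact h3.congr_deriv (by ring)
    rw [Dx, h2.deriv]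
    ring
  rw [h1, polyP_lastOnly hm, ← exp_nat_mul]
  have h4 : exp (-t) * exp t = 1 := by rw [← exp_add, neg_add_cancel, exp_zero]
  have h5 := exp_ne_zero t
  rw [exp_neg]
  constructor
  · intro h
    field_simp at h
    linear_combination h
  · intro h
    rw [h]
    field_simp

/-- `log (2 / m)`. -/
noncomputable def logShift (m : ℕ) : ℂ := (Real.log (2 / m) : ℝ)

theorem exp_logShift {m : ℕ} (hm : 1 ≤ m) : exp (logShift m) = 2 / m := by
  have : (0 : ℝ) < 2 / m := by positivity
  rw [logShift, ← ofReal_exp, Real.exp_log this]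
  push_cast
  rfl

/-- The logarithm of `2 / m * x ^ (m / 2)` at `x = exp t`. -/
noncomputable def besselVar (m : ℕ) (t : ℂ) : ℂ := m * t / 2 + logShift m

theorem exp_besselVar {m : ℕ} (hm : 1 ≤ m) (t : ℂ) :
    exp (besselVar m t) = 2 / m * exp (m / 2 * t) := by
  rw [besselVar, exp_add, exp_logShift hm, mul_comm]
  congr 2
  ring

theorem exp_two_mul_besselVar {m : ℕ} (hm : 1 ≤ m) (t : ℂ) :
    exp (2 * besselVar m t) = 4 / m ^ 2 * exp (m * t) := by
  rw [two_mul, exp_add, exp_besselVar hm]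
  have : exp (m * t) = exp (m / 2 * t) * exp (m / 2 * t) := by rw [← exp_add]; congr 1; ring
  rw [this]
  ring

theorem besselVar_add {m : ℕ} (hm : 1 ≤ m) (t : ℂ) (k : ℤ) :
    besselVar m (t + 2 * Real.pi * I * k / m) = besselVar m t + k * (Real.pi * I) := by
  have : (m : ℂ) ≠ 0 := by exact_mod_cast (by omega : m ≠ 0)
  rw [besselVar, besselVar]
  field_simp
  ring

theorem besselVar_surjective {m : ℕ} (hm : 1 ≤ m) : Function.Surjective (besselVar m) := fun w => by
  have : (m : ℂ) ≠ 0 := by exact_mod_cast (by omega : m ≠ 0)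
  refine ⟨2 / m * (w - logShift m), ?_⟩
  rw [besselVar]
  field_simp
  ring

/-- The factor `exp (t / 2)` removes the first-order term and turns `a_m` into `a_m + 1 / 4 = p ^ 2
/ 4`. The scaling by `m / 2` and the shift by `log (2 / m)` then normalize the potential to `exp (2
w) + (p / m) ^ 2`. -/
theorem IsBessel.isSolution {m : ℕ} (hm : 1 ≤ m) {am p : ℂ} (hp : p ^ 2 = 1 + 4 * am)
    {f f' : ℂ → ℂ} (hf : IsBessel (p / m) f f') :
    IsSolution (lastOnly m am) (fun t => exp (t / 2) * f (besselVar m t)) := by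
  have hm0 : (m : ℂ) ≠ 0 := by exact_mod_cast (by omega : m ≠ 0)
  have hw : ∀ t, HasDerivAt (besselVar m) (m / 2) t := fun t => by
    have := (((hasDerivAt_id t).const_mul (m : ℂ)).div_const 2).add_const (logShift m)
    exact this.congr_deriv (by simp)
  have he : ∀ t : ℂ, HasDerivAt (fun t : ℂ => exp (t / 2)) (exp (t / 2) * (1 / 2)) t := fun t =>
    ((hasDerivAt_id t).div_const 2).cexp
  have d0 : ∀ t, HasDerivAt (fun t => f (besselVar m t)) (f' (besselVar m t) * (m / 2)) t :=
    fun t => (hf.hasDerivAt _).comp t (hw t)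
  have d1 : ∀ t, HasDerivAt (fun t => f' (besselVar m t))
      (besselPot (p / m) (besselVar m t) * f (besselVar m t) * (m / 2)) t :=
    fun t => (hf.hasDerivAt' _).comp t (hw t)
  have h1 : ∀ t, HasDerivAt (fun t => exp (t / 2) * f (besselVar m t))
      (exp (t / 2) * (1 / 2 * f (besselVar m t) + m / 2 * f' (besselVar m t))) t := fun t =>
    ((he t).mul (d0 t)).congr_deriv (by ring)
  have hd1 : deriv (fun t => exp (t / 2) * f (besselVar m t)) = fun t =>
      exp (t / 2) * (1 / 2 * f (besselVar m t) + m / 2 * f' (besselVar m t)) :=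
    funext fun t => (h1 t).deriv
  refine (isSolution_lastOnly_iff hm am _).2 ⟨fun t => (h1 t).differentiableAt, fun t => ?_⟩
  rw [hd1]
  have h2 := (he t).mul (((d0 t).const_mul (1 / 2)).add ((d1 t).const_mul (m / 2 : ℂ)))
  have h3 : deriv (fun t => exp (t / 2) * (1 / 2 * f (besselVar m t) +
      m / 2 * f' (besselVar m t))) t = _ := h2.deriv
  rw [h3, besselPot, exp_two_mul_besselVar hm]
  have ham : am = (p ^ 2 - 1) / 4 := by rw [hp]; ring
  rw [ham]
  simp only [Pi.add_apply]
  field_simp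
  ring

theorem exists_isBessel_of_isSolution {m : ℕ} (hm : 1 ≤ m) {am p : ℂ} (hp : p ^ 2 = 1 + 4 * am)
    {φ : ℂ → ℂ} (hφ : IsSolution (lastOnly m am) φ) : ∃ f f' : ℂ → ℂ, IsBessel (p / m) f f' ∧
      ∀ t, φ t = exp (t / 2) * f (besselVar m t) := by
  have hm0 : (m : ℂ) ≠ 0 := by exact_mod_cast (by omega : m ≠ 0)
  obtain ⟨hd, hode⟩ := (isSolution_lastOnly_iff hm am φ).1 hφ
  set τ : ℂ → ℂ := fun w => 2 / m * (w - logShift m) with hτ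
  have hτ1 : ∀ t, τ (besselVar m t) = t := fun t => by
    rw [hτ]
    simp only [besselVar]
    field_simp
    ring
  have hτ2 : ∀ w, besselVar m (τ w) = w := fun w => by
    rw [hτ]
    simp only [besselVar]
    field_simp
    ring
  have hτd : ∀ w, HasDerivAt τ (2 / m) w := fun w => by
    have := ((hasDerivAt_id w).sub_const (logShift m)).const_mul (2 / m : ℂ)
    exact this.congr_deriv (by ring)
  have he : ∀ w, HasDerivAt (fun w => exp (-τ w / 2)) (exp (-τ w / 2) * (-(2 / m) / 2)) w :=
    fun w => (((hτd w).neg).div_const 2).cexp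
  have d0 : ∀ w, HasDerivAt (fun w => φ (τ w)) (deriv φ (τ w) * (2 / m)) w := fun w =>
    ((hd (τ w)).hasDerivAt).comp w (hτd w)
  have d1 : ∀ w, HasDerivAt (fun w => deriv φ (τ w)) (deriv (deriv φ) (τ w) * (2 / m)) w := fun w =>
    ((hd.deriv (τ w)).hasDerivAt).comp w (hτd w)
  refine ⟨fun w => exp (-τ w / 2) * φ (τ w),
    fun w => exp (-τ w / 2) * (2 / m * (deriv φ (τ w) - 1 / 2 * φ (τ w))), fun w _ => ⟨?_, ?_⟩,
    fun t => ?_⟩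
  · exact ((he w).mul (d0 w)).congr_deriv (by ring)
  · refine ((he w).mul (((d1 w).sub ((d0 w).const_mul (1 / 2))).const_mul (2 / m : ℂ))).congr_deriv ?_
    have h1 := hode (τ w)
    have h2 := exp_two_mul_besselVar hm (τ w)
    rw [hτ2] at h2
    have ham : am = (p ^ 2 - 1) / 4 := by rw [hp]; ring
    rw [ham] at h1
    rw [besselPot, h2]
    simp only [Pi.sub_apply]
    have h3 : deriv (deriv φ) (τ w) = deriv φ (τ w) + (exp (m * τ w) + (p ^ 2 - 1) / 4) * φ (τ w) := by
      linear_combination h1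
    rw [h3]
    field_simp
    ring
  · simp only [hτ1]
    rw [← mul_assoc, ← exp_add, show t / 2 + -t / 2 = 0 by ring, exp_zero, one_mul]

/-! ### The exponents `S` and `r` for `a' = 0`. -/

theorem sqrtCoeff_eq_zero {q : ℕ → ℂ} {m : ℕ} (hq : ∀ j, 1 ≤ j → j < m → q j = 0) (n : ℕ) :
    1 ≤ n → n < m → sqrtCoeff q n = 0 := by
  induction n using Nat.strong_induction_on with
  | _ n ih =>
    intro h1 hn
    obtain ⟨k, rfl⟩ : ∃ k, n = k + 1 := ⟨n - 1, by omega⟩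
    rw [sqrtCoeff, hq _ h1 hn, Finset.sum_eq_zero]
    · simp
    · intro i _
      rw [ih (i + 1) (by omega) (by omega) (by omega), zero_mul]

theorem expoS_lastOnly {m : ℕ} (hm : 1 ≤ m) (am t : ℂ) :
    expoS (lastOnly m am) t = exp (besselVar m t) := by
  rw [expoS, Finset.sum_eq_single 0]
  · rw [bCoeff, sqrtCoeff, exp_besselVar hm]
    simp
  · intro k hk hk0
    simp only [Finset.mem_filter, Finset.mem_range] at hk
    rw [bCoeff, sqrtCoeff_eq_zero (fun j h1 h2 => coef_lastOnly_of_pos am h1 h2) k (by omega) hk.1]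
    simp
  · intro h
    simp at h
    omega

theorem expoR_lastOnly {m : ℕ} (hm : 1 ≤ m) (am : ℂ) :
    expoR (lastOnly m am) = 1 / 2 - (m : ℂ) / 4 := by
  rw [expoR]
  split_ifs with h
  · obtain ⟨k, rfl⟩ := h
    rw [bCoeff, sqrtCoeff_eq_zero (fun j h1 h2 => coef_lastOnly_of_pos am h1 h2) _ (by omega)
      (by omega)]
    ring
  · ring

/-! ### The solution at infinity -/

/-- The Bessel expansion is in powers of `exp (-w)`, a constant times `x ^ (-m / 2)`. The lemma says
that this is a power of the step `x ^ (-κ)` prescribed for the formal series. -/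
theorem exists_stepK_mul_eq {m : ℕ} (hm : 1 ≤ m) :
    ∃ M : ℕ, 1 ≤ M ∧ stepK m * M = (m : ℝ) / 2 := by
  rw [stepK]
  split_ifs with h
  · obtain ⟨k, rfl⟩ := h
    exact ⟨k, by omega, by push_cast; ring⟩
  · exact ⟨m, hm, by ring⟩

theorem sum_range_mul_eq {M : ℕ} (hM : 1 ≤ M) (F : ℕ → ℂ) (hF : ∀ j, ¬ M ∣ j → F j = 0) (N : ℕ) :
    ∑ j ∈ Finset.range (M * N), F j = ∑ n ∈ Finset.range N, F (M * n) := by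
  induction N with
  | zero => simp
  | succ N ih =>
    have h : ∑ x ∈ Finset.range M, F (M * N + x) = F (M * N) := by
      rw [Finset.sum_eq_single 0, Nat.add_zero]
      · intro i hi hi0
        refine hF _ fun h => hi0 ?_
        have : M ∣ i := (Nat.dvd_add_right (Dvd.intro N rfl)).1 h
        exact Nat.eq_zero_of_dvd_of_lt this (Finset.mem_range.1 hi)
      · intro h
        simp at h
        omega
    rw [Nat.mul_succ, Finset.sum_range_add, ih, Finset.sum_range_succ, h]

theorem norm_exp_stepK {m : ℕ} (j : ℕ) (t : ℂ) :
    ‖exp (-((stepK m * j : ℝ) * t))‖ = Real.exp (-(stepK m * j * t.re)) := by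
  rw [norm_exp, neg_re, re_ofReal_mul]

/-- The constant `exp (logShift m / 2)` is the one for which the normalization `x ^ r * exp (-S)` of
`Φ_0` matches the normalization `exp (-w / 2 - exp w)` of the Bessel solution, so that both leading
coefficients are `1`. -/
theorem asymptotic_factor {m : ℕ} (hm : 1 ≤ m) (am : ℂ) (f : ℂ → ℂ) (t : ℂ) :
    exp (logShift m / 2) * (exp (t / 2) * f (besselVar m t)) *
      exp (-(expoR (lastOnly m am) * t)) * exp (expoS (lastOnly m am) t)
      = f (besselVar m t) * exp (besselVar m t / 2 + exp (besselVar m t)) := by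
  rw [expoS_lastOnly hm, expoR_lastOnly hm, exp_add (besselVar m t / 2)]
  have : exp (besselVar m t / 2) =
      exp (logShift m / 2) * exp (t / 2) * exp (-((1 / 2 - (m : ℂ) / 4) * t)) := by
    rw [← exp_add, ← exp_add, besselVar]; congr 1; ring
  rw [this]
  ring

theorem besselVar_re (m : ℕ) (t : ℂ) : (besselVar m t).re = m * t.re / 2 + Real.log (2 / m) := by
  rw [besselVar, logShift, add_re, ofReal_re, show (m * t / 2 : ℂ) = ((m / 2 : ℝ) : ℂ) * t by
    push_cast; ring, re_ofReal_mul]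
  ring

theorem besselVar_im (m : ℕ) (t : ℂ) : (besselVar m t).im = m * t.im / 2 := by
  rw [besselVar, logShift, add_im, ofReal_im, show (m * t / 2 : ℂ) = ((m / 2 : ℝ) : ℂ) * t by
    push_cast; ring, im_ofReal_mul]
  ring

theorem isPhi0_of_subdominant {m : ℕ} (hm : 1 ≤ m) {am p μ : ℂ} (hp : p ^ 2 = 1 + 4 * am)
    {f f' : ℂ → ℂ} (hf : IsBessel (p / m) f f') (h : HasSubdominantExpansion μ f) :
    IsPhi0 (lastOnly m am) (fun t => exp (logShift m / 2) * (exp (t / 2) * f (besselVar m t))) := by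
  have hm0 : (0 : ℝ) < m := by exact_mod_cast hm
  constructor
  · have h1 := (hf.linComb hf (exp (logShift m / 2)) 0).isSolution hm hp
    convert h1 using 1
    ext t
    ring
  obtain ⟨M, hM, hMm⟩ := exists_stepK_mul_eq hm
  have hstep : 0 < stepK m := by
    rw [stepK]
    split_ifs <;> norm_num
  set c : ℕ → ℂ := fun j =>
    if M ∣ j then asympCoeff μ (j / M) * exp (-((j / M : ℕ) * logShift m)) else 0 with hc
  refine ⟨c, by simp [hc, asympCoeff_zero], fun θ hθ N => ?_⟩
  have hθ' : m * θ / 2 < 3 * Real.pi / 2 := by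
    rw [lt_div_iff₀ hm0] at hθ
    linarith
  obtain ⟨K, hK⟩ := h (m * θ / 2) hθ' N
  -- `N` terms in powers of `exp (-w)` make `M * N` terms in powers of `x ^ (-κ)`. The surplus terms
  -- `N ≤ j < M * N` are absorbed into the remainder with constant `B`.
  set B := ∑ j ∈ Finset.Ico N (M * N), ‖c j‖ with hB
  -- The threshold for `t.re` guarantees `0 ≤ Re w`, where the Bessel estimate is valid.
  refine ⟨|K| * Real.exp (-(N * Real.log (2 / m))) + B, max 0 (-(2 / m * Real.log (2 / m))),
    fun t ht hR => ?_⟩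
  have hre : 0 ≤ t.re := (le_max_left _ _).trans hR
  have hw : 0 ≤ (besselVar m t).re := by
    rw [besselVar_re]
    have h1 := (le_max_right _ _).trans hR
    have h2 : (m : ℝ) / 2 * (-(2 / m * Real.log (2 / m))) ≤ m / 2 * t.re := by gcongr
    have h3 : (m : ℝ) / 2 * (-(2 / m * Real.log (2 / m))) = -Real.log (2 / m) := by
      field_simp
    linarith
  have him : |(besselVar m t).im| ≤ m * θ / 2 := by
    rw [besselVar_im, abs_div, abs_mul, abs_of_pos hm0, abs_of_pos (two_pos : (0 : ℝ) < 2)]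
    gcongr
  have h1 := hK _ him hw
  rw [← asymptotic_factor hm am f t] at h1
  set V := exp (logShift m / 2) * (exp (t / 2) * f (besselVar m t)) *
      exp (-(expoR (lastOnly m am) * t)) * exp (expoS (lastOnly m am) t)
  set F : ℕ → ℂ := fun j => c j * exp (-((stepK m * j : ℝ) * t)) with hF
  have hsum : ∑ n ∈ Finset.range N, asympCoeff μ n * exp (-(n * besselVar m t))
      = ∑ j ∈ Finset.range (M * N), F j := by
    rw [sum_range_mul_eq hM F (fun j hj => by simp [hF, hc, hj])]
    refine Finset.sum_congr rfl fun n _ => ?_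
    have e1 : stepK m * (M * n : ℕ) = n * (m / 2) := by
      push_cast
      rw [← mul_assoc, hMm]
      ring
    simp only [hF, hc]
    rw [if_pos (Dvd.intro n rfl), Nat.mul_div_cancel_left n hM, e1, mul_assoc, ← exp_add, besselVar]
    congr 2
    push_cast
    ring
  have hNM : N ≤ M * N := Nat.le_mul_of_pos_left N hM
  rw [hsum, ← Finset.sum_range_add_sum_Ico F hNM] at h1
  have h2 : ‖∑ j ∈ Finset.Ico N (M * N), F j‖ ≤ B * Real.exp (-(stepK m * N * t.re)) := by
    rw [hB, Finset.sum_mul]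
    refine (norm_sum_le _ _).trans (Finset.sum_le_sum fun j hj => ?_)
    rw [hF, norm_mul, norm_exp_stepK]
    have : (N : ℝ) ≤ j := by exact_mod_cast (Finset.mem_Ico.1 hj).1
    gcongr
  have h3 : K * Real.exp (-(N * (besselVar m t).re)) ≤
      |K| * Real.exp (-(N * Real.log (2 / m))) * Real.exp (-(stepK m * N * t.re)) := by
    rw [mul_assoc, ← Real.exp_add]
    refine mul_le_mul (le_abs_self K) (Real.exp_le_exp.2 ?_) (Real.exp_pos _).le (abs_nonneg K)
    rw [besselVar_re]
    have hstepm : stepK m ≤ m / 2 := by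
      rw [← hMm]
      have : (1 : ℝ) ≤ M := by exact_mod_cast hM
      nlinarith
    have : stepK m * (N * t.re) ≤ m / 2 * (N * t.re) := by gcongr
    linarith
  have h4 : V - ∑ j ∈ Finset.range N, F j = (V - (∑ j ∈ Finset.range N, F j +
      ∑ j ∈ Finset.Ico N (M * N), F j)) + ∑ j ∈ Finset.Ico N (M * N), F j := by ring
  rw [h4, add_mul]
  exact (norm_add_le _ _).trans (add_le_add (h1.trans h3) h2)

/-- Only the leading term on the positive real axis is used. It already determines a subdominant
solution by `IsBessel.eq_of_tendsto`. -/
theorem IsPhi0.eq {m : ℕ} (hm : 1 ≤ m) {am p μ : ℂ} (hp : p ^ 2 = 1 + 4 * am)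
    {f f' : ℂ → ℂ} (hf : IsBessel (p / m) f f') (h : HasSubdominantExpansion μ f) {φ : ℂ → ℂ}
    (hφ : IsPhi0 (lastOnly m am) φ) :
    φ = fun t => exp (logShift m / 2) * (exp (t / 2) * f (besselVar m t)) := by
  have hm0 : (0 : ℝ) < m := by exact_mod_cast hm
  obtain ⟨hsol, c, hc0, hc⟩ := hφ
  obtain ⟨g, g', hg, hgφ⟩ := exists_isBessel_of_isSolution hm hp hsol
  set κ := exp (logShift m / 2) with hκ
  have hκ0 : κ ≠ 0 := exp_ne_zero _
  have hg1 := hg.linComb hg κ⁻¹ 0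
  obtain ⟨K, R, hKR⟩ := hc 0 (by positivity) 1
  have hstep : 0 < stepK m := by
    rw [stepK]
    split_ifs <;> norm_num
  have hft := h.tendsto (y := 0) (by simp [Real.pi_pos])
  simp only [ofReal_zero, zero_mul, add_zero] at hft
  have hgt : Tendsto (fun x : ℝ => (κ⁻¹ * g x + 0 * g x) * exp (x / 2 + exp x)) atTop (𝓝 1) := by
    set τ : ℝ → ℝ := fun x => 2 / m * (x - Real.log (2 / m)) with hτ
    have hτ1 : ∀ x : ℝ, besselVar m (τ x) = x := fun x => by
      have : (m : ℂ) ≠ 0 := by exact_mod_cast hm0.ne'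
      simp only [hτ, besselVar, logShift]
      push_cast
      field_simp
      ring
    have hτt : Tendsto τ atTop atTop :=
      (tendsto_atTop_add_const_right _ (-Real.log (2 / m)) tendsto_id).const_mul_atTop
        (by positivity)
    have hV : Tendsto (fun s : ℝ => φ s * exp (-(expoR (lastOnly m am) * s)) *
        exp (expoS (lastOnly m am) s)) atTop (𝓝 1) := by
      rw [tendsto_iff_norm_sub_tendsto_zero]
      refine squeeze_zero' (Eventually.of_forall fun _ => norm_nonneg _)
        (g := fun s : ℝ => K * Real.exp (-(stepK m * s))) ?_ ?_
      · filter_upwards [eventually_ge_atTop R] with s hs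
        have := hKR s (by simp) (by simpa using hs)
        simpa [hc0] using this
      · have h1 : Tendsto (fun s : ℝ => Real.exp (-(stepK m * s))) atTop (𝓝 0) :=
          Real.tendsto_exp_neg_atTop_nhds_zero.comp (tendsto_id.const_mul_atTop hstep)
        simpa using h1.const_mul K
    refine (hV.comp hτt).congr fun x => ?_
    have h2 := asymptotic_factor hm am g (τ x)
    rw [hτ1, ← hκ] at h2
    simp only [Function.comp_apply, hgφ, hτ1]
    rw [zero_mul, add_zero, mul_assoc κ⁻¹, ← h2]
    field_simp
  have key := hg1.eq_of_tendsto hf hgt hft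
  ext t
  rw [hgφ t, ← key]
  field_simp
  ring

theorem Phi0_lastOnly {m : ℕ} (hm : 1 ≤ m) {am p μ : ℂ} (hp : p ^ 2 = 1 + 4 * am)
    {f f' : ℂ → ℂ} (hf : IsBessel (p / m) f f') (h : HasSubdominantExpansion μ f) :
    Phi0 (lastOnly m am) = fun t => exp (logShift m / 2) * (exp (t / 2) * f (besselVar m t)) :=
  IsPhi0.eq hm hp hf h (Classical.epsilon_spec ⟨_, isPhi0_of_subdominant hm hp hf h⟩)

theorem dil_lastOnly {m : ℕ} (hm : 1 ≤ m) (am : ℂ) (k : ℤ) :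
    dil (omegaPow m k) (lastOnly m am) = lastOnly m am := by
  have hm0 : (m : ℂ) ≠ 0 := by exact_mod_cast (by omega : m ≠ 0)
  ext i
  rw [dil, lastOnly]
  split_ifs with h
  · rw [h, omegaPow, ← exp_nat_mul, show (m : ℂ) * (2 * Real.pi * I * k / m) =
      k * (2 * Real.pi * I) by field_simp, exp_int_mul_two_pi_mul_I, one_mul]
  · rw [mul_zero]

theorem Phi_lastOnly {m : ℕ} (hm : 1 ≤ m) (am : ℂ) (k : ℤ) (t : ℂ) :
    Phi k (lastOnly m am) t = Phi0 (lastOnly m am) (t + 2 * Real.pi * I * k / m) := by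
  rw [Phi, dil_lastOnly hm]

/-- The Stokes-Sibuya connection matrix for `a' = 0`. -/
theorem isStokesSibuyaMatrix_lastOnly_iff {m : ℕ} (hm : 1 ≤ m) {am p : ℂ}
    (hp : p ^ 2 = 1 + 4 * am) (M : Matrix (Fin 2) (Fin 2) ℂ) :
    IsStokesSibuyaMatrix 0 (lastOnly m am) M ↔
      M = !![2 * exp (-(I * Real.pi / m)) * Complex.cos (Real.pi * p / m),
        -exp (-(2 * I * Real.pi / m)); 1, 0] := by
  have hm0 : (m : ℂ) ≠ 0 := by exact_mod_cast (by omega : m ≠ 0)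
  obtain ⟨μ, f, f', hf, hexp, hW, -⟩ := exists_subdominant_connection (p / m)
  set κ := exp (logShift m / 2) with hκ
  have hκ0 : κ ≠ 0 := exp_ne_zero _
  set δ := exp (I * Real.pi / m) with hδ
  set ε := exp (-(I * Real.pi / m)) with hε
  have hεδ : ε * δ = 1 := by rw [hε, hδ, ← exp_add, neg_add_cancel, exp_zero]
  have hε2 : exp (-(2 * I * Real.pi / m)) = ε * ε := by
    rw [hε, ← exp_add]; congr 1; ring
  have hPhi : ∀ (k : ℤ) (t : ℂ), Phi k (lastOnly m am) t =
      κ * (exp (k * (I * Real.pi / m)) * exp (t / 2) * f (besselVar m t + k * (Real.pi * I))) := by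
    intro k t
    rw [Phi_lastOnly hm, Phi0_lastOnly hm hp hf hexp]
    simp only
    rw [besselVar_add hm, ← exp_add]
    congr 3
    ring
  have p0 : ∀ t, Phi 0 (lastOnly m am) t = κ * (exp (t / 2) * f (besselVar m t)) := fun t => by
    rw [hPhi]; simp
  have p1 : ∀ t, Phi 1 (lastOnly m am) t =
      κ * (δ * exp (t / 2) * f (besselVar m t + Real.pi * I)) := fun t => by
    rw [hPhi]; simp [hδ]
  have p2 : ∀ t, Phi (-1) (lastOnly m am) t =
      κ * (ε * exp (t / 2) * f (besselVar m t - Real.pi * I)) := fun t => by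
    rw [hPhi]
    simp only [Int.cast_neg, Int.cast_one, neg_mul, one_mul, hε, ← sub_eq_add_neg]
  have hshift := fun w => hf.shift_add_shift w
  rw [IsStokesSibuyaMatrix]
  simp only [zero_sub, zero_add, p0, p1, p2]
  rw [hε2, show (Real.pi * p / m : ℂ) = Real.pi * (p / m) by ring]
  set cs := Complex.cos (Real.pi * (p / m))
  constructor
  · rintro ⟨C, C', rfl, h⟩
    have hrel : ∀ w, (2 * cs * ε - C) * f w + -(ε + C' * δ) * f (w + Real.pi * I) = 0 := by
      intro w
      obtain ⟨t, rfl⟩ := besselVar_surjective hm w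
      have h1 := h t
      have h2 := hshift (besselVar m t)
      have h3 : κ * exp (t / 2) ≠ 0 := mul_ne_zero hκ0 (exp_ne_zero _)
      apply mul_left_cancel₀ h3
      linear_combination h1 - κ * exp (t / 2) * ε * h2
    have hT := hf.shift 1
    simp only [Int.cast_one, one_mul] at hT
    have hlin := hf.linComb hT (2 * cs * ε - C) (-(ε + C' * δ))
    -- Differentiating the relation at `0` gives a second linear equation. The determinant of the
    -- resulting system is the Wronskian `-2 i`, so both coefficients vanish.
    have hrel' : (2 * cs * ε - C) * f' 0 + -(ε + C' * δ) * f' (0 + Real.pi * I) = 0 := by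
      have h1 := hlin.hasDerivAt 0
      have h2 : (fun w => (2 * cs * ε - C) * f w + -(ε + C' * δ) * f (w + Real.pi * I)) =
          fun _ => 0 := funext hrel
      rw [h2] at h1
      exact h1.unique (hasDerivAt_const (0 : ℂ) (0 : ℂ))
    have hW0 := hW 0
    have h2I : (-2 * I : ℂ) ≠ 0 := mul_ne_zero (by norm_num) I_ne_zero
    have hA : 2 * cs * ε - C = 0 := by
      apply mul_right_cancel₀ h2I
      rw [← hW0]
      linear_combination f' (0 + Real.pi * I) * hrel 0 - f (0 + Real.pi * I) * hrel'
    have hB : -(ε + C' * δ) = 0 := by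
      apply mul_right_cancel₀ h2I
      rw [← hW0]
      linear_combination f 0 * hrel' - f' 0 * hrel 0
    have hC : C = 2 * ε * cs := by linear_combination -hA
    have hC' : C' = -(ε * ε) := by linear_combination -ε * hB - C' * hεδ
    rw [hC, hC']
  · rintro rfl
    refine ⟨_, _, rfl, fun t => ?_⟩
    have h2 := hshift (besselVar m t)
    linear_combination κ * exp (t / 2) * ε * h2 +
      κ * exp (t / 2) * ε * f (besselVar m t + Real.pi * I) * hεδ

end StokesSibuya

namespace StokesSibuya

open Complex Filter Topology

/-! ### The normalized solutions at the origin -/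

/-- The entire factor of the Frobenius solution with exponent `(1 + p) / 2` at the origin. -/
noncomputable def fuchsG (m : ℕ) (p x : ℂ) : ℂ := frobG (p / m) (4 / m ^ 2 * x ^ m)

/-- The Frobenius solution with exponent `(1 + p) / 2` at the origin. -/
noncomputable def fuchs (m : ℕ) (p t : ℂ) : ℂ := exp (expoAtZero p * t) * fuchsG m p (exp t)

theorem differentiable_fuchsG (m : ℕ) (p : ℂ) : Differentiable ℂ (fuchsG m p) :=
  (differentiable_frobG (p / m)).comp (by fun_prop)

theorem fuchsG_zero {m : ℕ} (hm : 1 ≤ m) (p : ℂ) : fuchsG m p 0 = 1 := by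
  rw [fuchsG, zero_pow (by omega), mul_zero, frobG_zero]

/-- The function is invariant under `x ↦ ω x` for a primitive `m`-th root of unity `ω`, so its
Taylor coefficient of index `n` is fixed by multiplication by `ω ^ n ≠ 1`. -/
theorem iteratedDeriv_fuchsG {m n : ℕ} (hm : 1 ≤ m) (hn : ¬ m ∣ n) (p : ℂ) :
    iteratedDeriv n (fuchsG m p) 0 = 0 := by
  have hω := isPrimitiveRoot_exp m (by omega)
  set ω := exp (2 * Real.pi * I / m)
  have h1 : (fun x => fuchsG m p (ω * x)) = fuchsG m p := by
    ext x
    rw [fuchsG, fuchsG, mul_pow, hω.pow_eq_one, one_mul]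
  have h2 := congrFun (iteratedDeriv_comp_const_mul (n := n)
    (differentiable_fuchsG m p).contDiff ω) 0
  rw [h1, mul_zero] at h2
  have h3 : ω ^ n ≠ 1 := fun h => hn ((hω.pow_eq_one_iff_dvd n).1 h)
  have h4 : (ω ^ n - 1) * iteratedDeriv n (fuchsG m p) 0 = 0 := by linear_combination -h2
  exact (mul_eq_zero.1 h4).resolve_left (sub_ne_zero.2 h3)

theorem iteratedDeriv_pow_mul_zero {g : ℂ → ℂ} (hg : Differentiable ℂ g) (n : ℕ) :
    iteratedDeriv n (fun x => x ^ n * g x) 0 = n.factorial * g 0 := by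
  have h := iteratedDeriv_mul (n := n) (x := (0 : ℂ)) (f := fun x : ℂ => x ^ n) (g := g)
    (by fun_prop) hg.contDiff.contDiffAt
  refine h.trans ?_
  rw [Finset.sum_eq_single n]
  · rw [iteratedDeriv_pow, Nat.choose_self, Nat.descFactorial_self]
    simp
  · intro i hi hin
    have : n - i ≠ 0 := by have := Finset.mem_range.1 hi; omega
    rw [iteratedDeriv_pow, zero_pow this]
    simp
  · intro h
    simp at h

theorem exp_half_mul_frob {m : ℕ} (hm : 1 ≤ m) (p t : ℂ) :
    exp (t / 2) * frob (p / m) (besselVar m t) = exp (p / m * logShift m) * fuchs m p t := by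
  have hm0 : (m : ℂ) ≠ 0 := by exact_mod_cast (by omega : m ≠ 0)
  rw [frob, fuchs, fuchsG, exp_two_mul_besselVar hm, ← exp_nat_mul, ← mul_assoc, ← mul_assoc,
    ← exp_add, ← exp_add, besselVar, expoAtZero]
  congr 2
  field_simp
  ring

theorem fuchs_shift (m : ℕ) (p t : ℂ) : fuchs m p (t + 2 * Real.pi * I) =
    exp (expoAtZero p * (2 * Real.pi * I)) * fuchs m p t := by
  rw [fuchs, fuchs, exp_periodic t, mul_add, exp_add]
  ring

theorem ne_int_neg {ν : ℂ} (hν : ∀ n : ℤ, ν ≠ n) (n : ℤ) : -ν ≠ n := fun h => hν (-n) (by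
  push_cast; rw [← h, neg_neg])

theorem isBessel_frob_of_ne_int {ν : ℂ} (hν : ∀ n : ℤ, ν ≠ n) : IsBessel ν (frob ν) (frob' ν) :=
  isBessel_frob fun n => by exact_mod_cast hν (-(n + 1))

section Fuchs

variable {m : ℕ} {am p : ℂ}

theorem isSolution_fuchs (hm : 1 ≤ m) (hp : p ^ 2 = 1 + 4 * am) (hpm : ∀ n : ℤ, p / m ≠ n) :
    IsSolution (lastOnly m am) (fuchs m p) := by
  have hF := isBessel_frob_of_ne_int hpm
  have h := (hF.linComb hF (exp (-(p / m * logShift m))) 0).isSolution hm hp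
  convert h using 1
  ext t
  have h1 := exp_half_mul_frob hm p t
  have h2 : exp (-(p / m * logShift m)) * exp (p / m * logShift m) = 1 := by
    rw [← exp_add, neg_add_cancel, exp_zero]
  linear_combination -fuchs m p t * h2 - exp (-(p / m * logShift m)) * h1

theorem exists_eq_fuchs_add_fuchs (hm : 1 ≤ m) (hp : p ^ 2 = 1 + 4 * am)
    (hpm : ∀ n : ℤ, p / m ≠ n) {φ : ℂ → ℂ} (hφ : IsSolution (lastOnly m am) φ) :
    ∃ A B : ℂ, ∀ t, φ t = A * fuchs m p t + B * fuchs m (-p) t := by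
  obtain ⟨f, f', hf, hfφ⟩ := exists_isBessel_of_isSolution hm hp hφ
  obtain ⟨α, β, hαβ⟩ := hf.eq_frob_add_frob hpm
  refine ⟨α * exp (p / m * logShift m), β * exp (-p / m * logShift m), fun t => ?_⟩
  have h1 := exp_half_mul_frob hm p t
  have h2 := exp_half_mul_frob hm (-p) t
  rw [neg_div] at h2 ⊢
  rw [hfφ, (hαβ _).1]
  linear_combination α * h1 + β * h2

theorem fuchs_linearIndependent (hm : 1 ≤ m) (hpm : ∀ n : ℤ, p / m ≠ n) {A B : ℂ}
    (h : ∀ t, A * fuchs m p t + B * fuchs m (-p) t = 0) : A = 0 ∧ B = 0 := by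
  have hF := isBessel_frob_of_ne_int hpm
  have hG := (isBessel_frob_of_ne_int (ne_int_neg hpm)).neg
  rw [neg_neg] at hG
  set E := exp (-(p / m * logShift m)) with hE
  set E' := exp (p / m * logShift m) with hE'
  have hEE : E * E' = 1 := by rw [hE, hE', ← exp_add, neg_add_cancel, exp_zero]
  have hrel : ∀ w, A * E * frob (p / m) w + B * E' * frob (-(p / m)) w = 0 := by
    intro w
    obtain ⟨t, rfl⟩ := besselVar_surjective hm w
    have h1 := exp_half_mul_frob hm p t
    have h2 := exp_half_mul_frob hm (-p) t
    rw [neg_div, neg_mul] at h2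
    rw [← hE'] at h1
    rw [← hE] at h2
    apply mul_left_cancel₀ (exp_ne_zero (t / 2))
    linear_combination A * E * h1 + B * E' * h2 + h t + (A * fuchs m p t + B * fuchs m (-p) t) * hEE
  have hrel' : A * E * frob' (p / m) 0 + B * E' * frob' (-(p / m)) 0 = 0 := by
    have h1 := (hF.linComb hG (A * E) (B * E')).hasDerivAt 0
    rw [show (fun w => A * E * frob (p / m) w + B * E' * frob (-(p / m)) w) = fun _ => 0 from
      funext hrel] at h1
    exact h1.unique (hasDerivAt_const (0 : ℂ) (0 : ℂ))
  have hW := frob_wronskian hpm 0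
  have h0 : -2 * (p / m) ≠ 0 := mul_ne_zero (by norm_num) (by exact_mod_cast hpm 0)
  have hA : A * E = 0 := by
    apply mul_right_cancel₀ h0
    rw [← hW]
    linear_combination frob' (-(p / m)) 0 * hrel 0 - frob (-(p / m)) 0 * hrel'
  have hB : B * E' = 0 := by
    apply mul_right_cancel₀ h0
    rw [← hW]
    linear_combination frob (p / m) 0 * hrel' - frob' (p / m) 0 * hrel 0
  exact ⟨(mul_eq_zero.1 hA).resolve_right (exp_ne_zero _),
    (mul_eq_zero.1 hB).resolve_right (exp_ne_zero _)⟩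

theorem not_dvd_of_eq_natCast (hpm : ∀ n : ℤ, p / m ≠ n) {n : ℕ} (hn : 1 ≤ n)
    (hp : p = n ∨ p = -n) : ¬ m ∣ n := by
  rintro ⟨k, rfl⟩
  have hm0 : (m : ℂ) ≠ 0 := by
    rintro h
    rw [Nat.cast_eq_zero] at h
    simp [h] at hn
  rcases hp with rfl | rfl
  · exact hpm k (by push_cast; field_simp)
  · exact hpm (-k) (by push_cast; field_simp)

/-- In the decomposition `A * fuchs m p + B * fuchs m (-p)` the coefficient `B` must vanish. If `p`
is a positive integer, a nonzero `B` would give `g` a pole at `0`. If `p = -k`, the coefficient of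
`x ^ k` in `g` equals `B`, because `m ∤ k` removes the contribution of `fuchsG m p`, and the
normalization sets it to `0`. If `p ∉ ℤ`, the two exponents have different monodromy. Then `A = 1`
follows by evaluating at `0`. -/
theorem eq_fuchs_of_isSolution (hm : 1 ≤ m) (hp : p ^ 2 = 1 + 4 * am)
    (hpm : ∀ n : ℤ, p / m ≠ n) {φ g : ℂ → ℂ} (hφ : IsSolution (lastOnly m am) φ)
    (hg : Differentiable ℂ g) (hφg : ∀ t, φ t = exp (expoAtZero p * t) * g (exp t))
    (hg0 : g 0 = 1) (hgn : ∀ n : ℕ, 1 ≤ n → p = -n → iteratedDeriv n g 0 = 0) :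
    φ = fuchs m p := by
  obtain ⟨A, B, hAB⟩ := exists_eq_fuchs_add_fuchs hm hp hpm hφ
  have hGd := differentiable_fuchsG m p
  have hHd := differentiable_fuchsG m (-p)
  have hG0 := fuchsG_zero hm p
  have hH0 := fuchsG_zero hm (-p)
  have hp0 : p ≠ 0 := fun h => hpm 0 (by simp [h])
  have hrel : ∀ t, g (exp t) = A * fuchsG m p (exp t) +
      B * (exp (-p * t) * fuchsG m (-p) (exp t)) := by
    intro t
    have h1 := hAB t
    rw [hφg, fuchs, fuchs] at h1
    have h2 : exp (expoAtZero (-p) * t) = exp (expoAtZero p * t) * exp (-p * t) := by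
      rw [← exp_add, expoAtZero, expoAtZero]; congr 1; ring
    rw [h2] at h1
    apply mul_left_cancel₀ (exp_ne_zero (expoAtZero p * t))
    linear_combination h1
  have hAof : B = 0 → A = 1 := by
    intro hB
    have h1 : g = fun x => A * fuchsG m p x := by
      refine eq_of_comp_exp_eq hg.continuous (continuous_const.mul hGd.continuous) fun t => ?_
      rw [hrel t, hB]
      ring
    have h2 := congrFun h1 0
    rw [hg0, hG0] at h2
    linear_combination -h2
  have hBzero : B = 0 := by
    by_cases hint : ∃ n : ℤ, p = n
    · obtain ⟨n, hn⟩ := hint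
      rcases Int.eq_nat_or_neg n with ⟨k, rfl | rfl⟩
      · have hk : p = k := by exact_mod_cast hn
        have hk1 : k ≠ 0 := fun h => hp0 (by rw [hk, h]; simp)
        have h1 : (fun x => x ^ k * g x) = fun x => A * (x ^ k * fuchsG m p x) +
            B * fuchsG m (-p) x := by
          have := hg.continuous
          have := hGd.continuous
          have := hHd.continuous
          refine eq_of_comp_exp_eq (by fun_prop) (by fun_prop) fun t => ?_
          have h2 : exp t ^ k * exp (-p * t) = 1 := by
            rw [← exp_nat_mul, ← exp_add, hk, neg_mul, add_neg_cancel, exp_zero]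
          rw [hrel t]
          linear_combination B * fuchsG m (-p) (exp t) * h2
        have h2 := congrFun h1 0
        simp only [zero_pow hk1, zero_mul, mul_zero, hH0, mul_one, zero_add] at h2
        exact h2.symm
      · have hk : p = -k := by rw [hn]; push_cast; rfl
        have hk1 : 1 ≤ k := Nat.one_le_iff_ne_zero.2 fun h => hp0 (by rw [hk, h]; simp)
        have h1 : g = fun x => A * fuchsG m p x + B * (x ^ k * fuchsG m (-p) x) := by
          have := hGd.continuous
          have := hHd.continuous
          refine eq_of_comp_exp_eq hg.continuous (by fun_prop) fun t => ?_
          rw [hrel t, ← exp_nat_mul, hk, neg_neg]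
        have h2 : iteratedDeriv k g 0 = A * iteratedDeriv k (fuchsG m p) 0 +
            B * iteratedDeriv k (fun x => x ^ k * fuchsG m (-p) x) 0 := by
          have c1 : ContDiffAt ℂ k (fun x => A * fuchsG m p x) 0 :=
            (hGd.const_mul A).contDiff.contDiffAt
          have c2 : ContDiffAt ℂ k (fun x => B * (x ^ k * fuchsG m (-p) x)) 0 := by
            refine Differentiable.contDiff (Differentiable.const_mul ?_ B) |>.contDiffAt
            exact (differentiable_id.pow k).mul hHd
          conv_lhs => rw [h1]
          rw [iteratedDeriv_fun_add c1 c2, iteratedDeriv_const_mul_field,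
            iteratedDeriv_const_mul_field]
        rw [hgn k hk1 hk, iteratedDeriv_fuchsG hm (not_dvd_of_eq_natCast hpm hk1 (Or.inr hk)),
          iteratedDeriv_pow_mul_zero hHd, hH0] at h2
        have h3 : (k.factorial : ℂ) ≠ 0 := by exact_mod_cast k.factorial_ne_zero
        apply mul_right_cancel₀ h3
        linear_combination -h2
    · by_contra hB
      have hq : exp (-p * (2 * Real.pi * I)) ≠ 1 := fun h => by
        obtain ⟨n, hn⟩ := exp_eq_one_iff.1 h
        refine hint ⟨-n, ?_⟩
        have h2 : (2 * Real.pi * I : ℂ) ≠ 0 := two_pi_I_ne_zero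
        push_cast
        apply mul_right_cancel₀ h2
        linear_combination -hn
      have hz : fuchsG m (-p) = fun _ => 0 := by
        refine eq_of_comp_exp_eq hHd.continuous continuous_const fun t => ?_
        have h1 := hrel t
        have h2 := hrel (t + 2 * Real.pi * I)
        rw [exp_periodic t, mul_add, exp_add] at h2
        have h3 : B * (exp (-p * (2 * Real.pi * I)) - 1) * exp (-p * t) *
            fuchsG m (-p) (exp t) = 0 := by linear_combination h1 - h2
        exact (mul_eq_zero.1 h3).resolve_left (mul_ne_zero (mul_ne_zero hB (sub_ne_zero.2 hq))
          (exp_ne_zero _))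
      rw [hz] at hH0
      exact zero_ne_one hH0
  ext t
  rw [hAB t, hBzero, hAof hBzero]
  ring

theorem isFuchsSystem_fuchs (hm : 1 ≤ m) (hp : p ^ 2 = 1 + 4 * am)
    (hpm : ∀ n : ℤ, p / m ≠ n) : IsFuchsSystem (lastOnly m am) p (fuchs m p) (fuchs m (-p)) := by
  have hpm' : ∀ n : ℤ, -p / m ≠ n := fun n => by rw [neg_div]; exact ne_int_neg hpm n
  have hp0 : p ≠ 0 := fun h => hpm 0 (by simp [h])
  refine ⟨by rw [coef_lastOnly_self hm, hp], isSolution_fuchs hm hp hpm,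
    isSolution_fuchs hm (by rw [neg_sq, hp]) hpm', fuchsG m p, fuchsG m (-p), 0,
    differentiable_fuchsG m p, differentiable_fuchsG m (-p), fun t => rfl, fun t => ?_,
    fuchsG_zero hm p, fun _ => fuchsG_zero hm (-p), fun h => absurd h hp0, fun _ => rfl,
    fun n hn h => iteratedDeriv_fuchsG hm (not_dvd_of_eq_natCast hpm hn (Or.inl h)) (-p),
    fun n hn h => ⟨rfl, iteratedDeriv_fuchsG hm (not_dvd_of_eq_natCast hpm hn (Or.inr h)) p⟩⟩
  rw [fuchs]
  ring

theorem IsFuchsSystem.eq_fuchs (hm : 1 ≤ m) (hp : p ^ 2 = 1 + 4 * am)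
    (hpm : ∀ n : ℤ, p / m ≠ n) {f₁ f₂ : ℂ → ℂ} (h : IsFuchsSystem (lastOnly m am) p f₁ f₂) :
    f₁ = fuchs m p ∧ f₂ = fuchs m (-p) := by
  have hpm' : ∀ n : ℤ, -p / m ≠ n := fun n => by rw [neg_div]; exact ne_int_neg hpm n
  have hp0 : p ≠ 0 := fun h => hpm 0 (by simp [h])
  obtain ⟨-, hs1, hs2, g₁, g₂, lam, hg1, hg2, hf1, hf2, hg10, hg20, -, hlam, hpos, hneg⟩ := h
  have e1 : f₁ = fuchs m p :=
    eq_fuchs_of_isSolution hm hp hpm hs1 hg1 hf1 hg10 fun n hn h => (hneg n hn h).2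
  have hlam0 : lam = 0 := by
    by_cases hint : ∃ n : ℤ, p = n
    swap
    · exact hlam fun n hn => hint ⟨n, hn⟩
    obtain ⟨n, hn⟩ := hint
    obtain ⟨A, B, hAB⟩ := exists_eq_fuchs_add_fuchs hm hp hpm hs2
    -- For integral `p` both exponents have the same monodromy factor `E`, so a turn around the
    -- origin multiplies every solution by `E`. A term `lam * f₁ * log x` would add `2 π i lam E
    -- f₁`, which forces `lam = 0`.
    set E := exp (expoAtZero p * (2 * Real.pi * I)) with hE
    have hE' : exp (expoAtZero (-p) * (2 * Real.pi * I)) = E := by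
      have h1 : expoAtZero p * (2 * Real.pi * I) =
          expoAtZero (-p) * (2 * Real.pi * I) + n * (2 * Real.pi * I) := by
        rw [expoAtZero, expoAtZero, hn]; ring
      rw [hE, h1, exp_periodic.int_mul n]
    by_contra hl
    have hz : ∀ t, 1 * fuchs m p t + 0 * fuchs m (-p) t = 0 := by
      intro t
      have h1 := hf2 t
      have h2 := hf2 (t + 2 * Real.pi * I)
      rw [hAB] at h1 h2
      rw [e1] at h1 h2
      rw [fuchs_shift, fuchs_shift, ← hE, hE', exp_periodic t, mul_add (expoAtZero (-p)), exp_add,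
        hE'] at h2
      have h3 : lam * E * (2 * Real.pi * I) * fuchs m p t = 0 := by
        linear_combination E * h1 - h2
      have h4 := (mul_eq_zero.1 h3).resolve_left (mul_ne_zero (mul_ne_zero hl (exp_ne_zero _))
        two_pi_I_ne_zero)
      rw [h4]
      ring
    exact one_ne_zero (fuchs_linearIndependent hm hpm hz).1
  refine ⟨e1, eq_fuchs_of_isSolution hm (by rw [neg_sq, hp]) hpm' hs2 hg2 (fun t => ?_)
    (hg20 hp0) fun n hn h => hpos n hn (neg_inj.1 h)⟩
  rw [hf2 t, hlam0]
  ring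

end Fuchs

/-! ### The connection matrix between the origin and infinity -/

/-- The odd entire function `β_m`. -/
noncomputable def betaFun (m : ℕ) (p : ℂ) : ℂ := p / m * (Real.log m + Real.pi * I)

theorem exp_betaFun {m : ℕ} (hm : 1 ≤ m) (k : ℕ) :
    exp (betaFun m (k * m)) = (m : ℂ) ^ k ∨ exp (betaFun m (k * m)) = -(m : ℂ) ^ k := by
  have hm0 : (m : ℂ) ≠ 0 := by exact_mod_cast (by omega : m ≠ 0)
  have hmr : (0 : ℝ) < m := by exact_mod_cast hm
  have h1 : exp (betaFun m (k * m)) = (m : ℂ) ^ k * (-1) ^ k := by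
    rw [betaFun, mul_div_assoc, div_self hm0, mul_one, exp_nat_mul, exp_add, exp_pi_mul_I,
      ← ofReal_exp, Real.exp_log hmr, mul_pow, ofReal_natCast]
  rw [h1]
  rcases neg_one_pow_eq_or ℂ k with h | h <;> rw [h] <;> simp

/-- The first row of the `0∞` connection matrix. -/
noncomputable def connCoeff (m : ℕ) (p : ℂ) : ℂ :=
  exp (betaFun m (-p)) * (omegaPow m (-1 / 2) / (Real.sqrt (m * Real.pi) : ℂ)) * Gamma (-p / m)

theorem two_cpow_eq_exp (s : ℂ) : (2 : ℂ) ^ s = exp (Real.log 2 * s) := by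
  rw [cpow_def_of_ne_zero two_ne_zero, show (2 : ℂ) = ((2 : ℝ) : ℂ) by norm_num,
    ← ofReal_log (by norm_num)]

/-- The powers of `2` cancel and `m ^ (-1 / 2 - p / m)` remains. The summand `π i` in `betaFun` is
there to compensate `ω ^ (s(p) - 1 / 2) = exp (π i p / m)`. -/
theorem connection_constant {m : ℕ} (hm : 1 ≤ m) (p : ℂ) :
    exp (logShift m / 2) * (2 ^ (-(p / m) - 1 / 2) * Gamma (-(p / m)) / (Real.sqrt Real.pi : ℂ)) *
      exp (p / m * logShift m) = omegaPow m (expoAtZero p) * connCoeff m p := by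
  have hm0 : (m : ℂ) ≠ 0 := by exact_mod_cast (by omega : m ≠ 0)
  have hmr : (0 : ℝ) < m := by exact_mod_cast hm
  have hp : (Real.sqrt Real.pi : ℂ) ≠ 0 := ofReal_ne_zero.2 (Real.sqrt_pos.2 Real.pi_pos).ne'
  have hsq : (Real.sqrt (m * Real.pi) : ℂ) =
      exp (Real.log m / 2) * (Real.sqrt Real.pi : ℂ) := by
    rw [Real.sqrt_mul hmr.le, ofReal_mul]
    congr 1
    rw [Real.sqrt_eq_rpow, Real.rpow_def_of_pos hmr]
    push_cast
    congr 1
    ring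
  have hlog : logShift m = Real.log 2 - Real.log m := by
    rw [logShift, Real.log_div two_ne_zero hmr.ne']
    push_cast
    rfl
  rw [connCoeff, hsq, two_cpow_eq_exp, omegaPow, omegaPow, betaFun, expoAtZero, neg_div]
  have key : exp (logShift m / 2) * exp (Real.log 2 * (-(p / m) - 1 / 2)) *
      exp (p / m * logShift m) * exp (Real.log m / 2) =
      exp (2 * Real.pi * I * ((1 + p) / 2) / m) * exp (-(p / m) * (Real.log m + Real.pi * I)) *
        exp (2 * Real.pi * I * (-1 / 2) / m) := by
    rw [← exp_add, ← exp_add, ← exp_add, ← exp_add, ← exp_add, hlog]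
    congr 1
    field_simp
    ring
  have he := exp_ne_zero ((Real.log m : ℂ) / 2)
  rw [div_mul_eq_div_div]
  set X := exp ((Real.log m : ℂ) / 2)
  have h1 : exp (logShift m / 2) * exp (Real.log 2 * (-(p / m) - 1 / 2)) *
      exp (p / m * logShift m) =
      exp (2 * Real.pi * I * ((1 + p) / 2) / m) * exp (-(p / m) * (Real.log m + Real.pi * I)) *
        exp (2 * Real.pi * I * (-1 / 2) / m) / X := by
    rw [eq_div_iff he, key]
  linear_combination Gamma (-(p / m)) / (Real.sqrt Real.pi : ℂ) * h1

/-- The entire factor depends only on `x ^ m`, which is unchanged by `x ↦ ω⁻¹ x`. Only the prefactor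
`x ^ s(p)` contributes. -/
theorem fuchs_sub (m : ℕ) (p t : ℂ) : omegaPow m (expoAtZero p) *
    fuchs m p (t + 2 * Real.pi * I * (-1 : ℤ) / m) = fuchs m p t := by
  rcases Nat.eq_zero_or_pos m with rfl | hm
  · simp [omegaPow]
  have hm0 : (m : ℂ) ≠ 0 := by exact_mod_cast hm.ne'
  have h1 : exp (t + 2 * Real.pi * I * (-1 : ℤ) / m) ^ m = exp t ^ m := by
    rw [← exp_nat_mul, ← exp_nat_mul, show (m : ℂ) * (t + 2 * Real.pi * I * (-1 : ℤ) / m) =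
      m * t + (-1 : ℤ) * (2 * Real.pi * I) by field_simp, exp_periodic.int_mul (-1)]
  rw [fuchs, fuchs, fuchsG, fuchsG, h1, omegaPow, ← mul_assoc, ← exp_add]
  congr 2
  push_cast
  field_simp
  ring

theorem Phi_zero_eq {m : ℕ} (hm : 1 ≤ m) {am p : ℂ} (hp : p ^ 2 = 1 + 4 * am)
    (hpm : ∀ n : ℤ, p / m ≠ n) (t : ℂ) : Phi 0 (lastOnly m am) t =
      omegaPow m (expoAtZero p) * connCoeff m p * fuchs m p t +
      omegaPow m (expoAtZero (-p)) * connCoeff m (-p) * fuchs m (-p) t := by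
  obtain ⟨μ, f, f', hf, hexp, -, hconn⟩ := exists_subdominant_connection (p / m)
  have h1 := exp_half_mul_frob hm p t
  have h2 := exp_half_mul_frob hm (-p) t
  have h3 := connection_constant hm p
  have h4 := connection_constant hm (-p)
  rw [Phi_lastOnly hm, Phi0_lastOnly hm hp hf hexp]
  simp only [Int.cast_zero, mul_zero, zero_div, add_zero]
  rw [hconn hpm, ← h3, ← h4]
  rw [neg_div] at h2 ⊢
  rw [neg_neg]
  linear_combination exp (logShift m / 2) * (2 ^ (-(p / m) - 1 / 2) * Gamma (-(p / m)) /
    (Real.sqrt Real.pi : ℂ)) * h1 + exp (logShift m / 2) * (2 ^ (p / m - 1 / 2) *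
    Gamma (p / m) / (Real.sqrt Real.pi : ℂ)) * h2

/-- Here `Φ_{-1}` is `Φ_0` at `ω⁻¹ x`, and the rotation cancels the factors `ω ^ s(±p)` in the
expression of `Φ_0`. -/
theorem Phi_neg_one_eq {m : ℕ} (hm : 1 ≤ m) {am p : ℂ} (hp : p ^ 2 = 1 + 4 * am)
    (hpm : ∀ n : ℤ, p / m ≠ n) (t : ℂ) : Phi (-1) (lastOnly m am) t =
      connCoeff m p * fuchs m p t + connCoeff m (-p) * fuchs m (-p) t := by
  have h := Phi_zero_eq hm hp hpm (t + 2 * Real.pi * I * (-1 : ℤ) / m)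
  rw [Phi_lastOnly hm] at h ⊢
  simp only [Int.cast_zero, mul_zero, zero_div, add_zero] at h
  rw [h, ← fuchs_sub m p t, ← fuchs_sub m (-p) t]
  ring

theorem isConnectionMatrix_lastOnly_iff {m : ℕ} (hm : 1 ≤ m) {am p : ℂ} (hp : p ^ 2 = 1 + 4 * am)
    (hpm : ∀ n : ℤ, p / m ≠ n) (M : Matrix (Fin 2) (Fin 2) ℂ) :
    IsConnectionMatrix 0 (lastOnly m am) p M ↔
      M = !![connCoeff m p, connCoeff m (-p);
        omegaPow m (expoAtZero p) * connCoeff m p,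
        omegaPow m (expoAtZero (-p)) * connCoeff m (-p)] := by
  have hvec : ∀ (M : Matrix (Fin 2) (Fin 2) ℂ) (t : ℂ),
      ![Phi (0 - 1) (lastOnly m am) t, Phi 0 (lastOnly m am) t] =
        M.mulVec ![fuchs m p t, fuchs m (-p) t] ↔
      (connCoeff m p * fuchs m p t + connCoeff m (-p) * fuchs m (-p) t =
        M 0 0 * fuchs m p t + M 0 1 * fuchs m (-p) t) ∧
      (omegaPow m (expoAtZero p) * connCoeff m p * fuchs m p t +
        omegaPow m (expoAtZero (-p)) * connCoeff m (-p) * fuchs m (-p) t =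
        M 1 0 * fuchs m p t + M 1 1 * fuchs m (-p) t) := by
    intro M t
    rw [zero_sub, Phi_neg_one_eq hm hp hpm, Phi_zero_eq hm hp hpm, funext_iff, Fin.forall_fin_two]
    simp [Matrix.mulVec, dotProduct, Fin.sum_univ_two]
  constructor
  · rintro ⟨f₁, f₂, hF, h⟩
    obtain ⟨rfl, rfl⟩ := hF.eq_fuchs hm hp hpm
    have h1 := fuchs_linearIndependent hm hpm (A := connCoeff m p - M 0 0)
      (B := connCoeff m (-p) - M 0 1) fun t => by
        linear_combination ((hvec M t).1 (h t)).1
    have h2 := fuchs_linearIndependent hm hpm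
      (A := omegaPow m (expoAtZero p) * connCoeff m p - M 1 0)
      (B := omegaPow m (expoAtZero (-p)) * connCoeff m (-p) - M 1 1) fun t => by
        linear_combination ((hvec M t).1 (h t)).2
    rw [Matrix.eta_fin_two M, ← sub_eq_zero.1 h1.1, ← sub_eq_zero.1 h1.2, ← sub_eq_zero.1 h2.1,
      ← sub_eq_zero.1 h2.2]
  · rintro rfl
    exact ⟨_, _, isFuchsSystem_fuchs hm hp hpm, fun t => (hvec _ t).2 (by simp)⟩

end StokesSibuya

/-! ### The two connection matrices together. -/

theorem proposition7p1 (m : ℕ) (hm : 1 ≤ m) :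
    (∀ am p : ℂ, p ^ 2 = 1 + 4 * am → ∀ M : Matrix (Fin 2) (Fin 2) ℂ,
      StokesSibuya.IsStokesSibuyaMatrix 0 (StokesSibuya.lastOnly m am) M ↔
        M = !![2 * Complex.exp (-(Complex.I * Real.pi / m)) * Complex.cos (Real.pi * p / m),
                -Complex.exp (-(2 * Complex.I * Real.pi / m));
               1, 0]) ∧
    ∃ β : ℂ → ℂ, Differentiable ℂ β ∧ (∀ p : ℂ, β (-p) = -β p) ∧
      (∀ k : ℕ, 1 ≤ k →
        Complex.exp (β ((k : ℂ) * m)) = (m : ℂ) ^ k ∨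
        Complex.exp (β ((k : ℂ) * m)) = -(m : ℂ) ^ k) ∧
      ∀ am p : ℂ, p ^ 2 = 1 + 4 * am → (∀ n : ℤ, p / m ≠ n) →
        ∀ M : Matrix (Fin 2) (Fin 2) ℂ,
          StokesSibuya.IsConnectionMatrix 0 (StokesSibuya.lastOnly m am) p M ↔
            M = !![Complex.exp (β (-p)) *
                      (StokesSibuya.omegaPow m (-1 / 2) / (Real.sqrt (m * Real.pi) : ℂ)) *
                      Complex.Gamma (-p / m),
                    Complex.exp (β p) *
                      (StokesSibuya.omegaPow m (-1 / 2) / (Real.sqrt (m * Real.pi) : ℂ)) *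
                      Complex.Gamma (p / m);
                   StokesSibuya.omegaPow m (StokesSibuya.expoAtZero p) * Complex.exp (β (-p)) *
                      (StokesSibuya.omegaPow m (-1 / 2) / (Real.sqrt (m * Real.pi) : ℂ)) *
                      Complex.Gamma (-p / m),
                    StokesSibuya.omegaPow m (StokesSibuya.expoAtZero (-p)) * Complex.exp (β p) *
                      (StokesSibuya.omegaPow m (-1 / 2) / (Real.sqrt (m * Real.pi) : ℂ)) *
                      Complex.Gamma (p / m)] := by
  refine ⟨fun am p hp M => StokesSibuya.isStokesSibuyaMatrix_lastOnly_iff hm hp M,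
    StokesSibuya.betaFun m, ?_, fun p => ?_, fun k _ => StokesSibuya.exp_betaFun hm k,
    fun am p hp hpm M => ?_⟩
  · unfold StokesSibuya.betaFun
    fun_prop
  · rw [StokesSibuya.betaFun, StokesSibuya.betaFun]
    ring
  · rw [StokesSibuya.isConnectionMatrix_lastOnly_iff hm hp hpm M]
    simp only [StokesSibuya.connCoeff, neg_neg, mul_assoc]
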